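/- Let $T>0$, $r_0\ge 0$, $r_2>r_1\ge 0$ and $\gamma\in(0,1)$. Write $z=(x,v)\in\mathbb R^3\times\mathbb R^3=\mathbb R^6$, let $B_R(0)$ be the open Euclidean ball of radius $R$, and consider the initial value problem $$\partial_t f+v\cdot\partial_x f+\mathbf A\cdot\partial_v f+(v\times\mathbf B)\cdot\partial_v f=\partial_x\psi_f\cdot\mathbf C+\boldsymbol\chi\,\Phi_{\mathbf a,f}+\mathbf b,\qquad f|_{t=0}=\mathring{\mathbf f},\tag{LVL}$$ on $[0,T]\times\mathbb R^6$, where $$\psi_f(t,x)=\int\frac{\rho_f(t,y)}{|x-y|}\,dy,\quad \rho_f(t,x)=\int f(t,x,v)\,dv,\quad \Phi_{\mathbf a,f}(t,x)=-\iint\frac{x-y}{|x-y|^3}\cdot\partial_v\mathbf a(t,y,w)\,f(t,y,w)\,dw\,dy .$$ Assume $\mathbf a,\mathbf b\in C([0,T];C^1_b(\mathbb R^6))$, $\mathring{\mathbf f}\in C^2_c(\mathbb R^6)$, $\mathbf A,\mathbf B\in C([0,T];C^{1,\gamma}(\mathbb R^3;\mathbb R^3))$, $\mathbf C\in C([0,T];C^1_b(\mathbb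 R^6;\mathbb R^3))$, $\boldsymbol\chi\in C^1_c(\mathbb R^6;[0,1])$, and, for all $t\in[0,T]$, $$\operatorname{supp}\mathbf a(t),\ \operatorname{supp}\mathbf b(t),\ \operatorname{supp}\mathring{\mathbf f},\ \operatorname{supp}\mathbf C(t)\subset B_{r_0}(0),\qquad \boldsymbol\chi=1\text{ on }B_{r_1}(0),\quad \operatorname{supp}\boldsymbol\chi\subset B_{r_2}(0).$$ Put $\zeta(R)=e^{2T}\big(R+\sqrt T\,\|\mathbf A\|_{L^2(0,T;L^\infty)}\big)$ and $r=\max\{r_0,r_2\}$. Then: 1. For all $t\in[0,T]$, $z\in\mathbb R^6$ the characteristic system $\dot x=v$, $\dot v=\mathbf A(s,x)+v\times\mathbf B(s,x)$ has a unique solution $s\mapsto Z(s,t,z)$ on $[0,T]$ with $Z(t,t,z)=z$. 2. (LVL) has a unique classical solution $f\in C^1([0,T]\times\mathbb R^6)$ (time derivatives at $t=0$ and $t=T$ being one-sided). 3. $\operatorname{supp} f(t)\subset B_{\zeta(r+1)}(0)$ for all $t\in[0,T]$. 4. For all $t\in[0,T]$, $z\in\mathbb R^6$, $$f(t,z)=\mathring{\mathbf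 f}\big(Z(0,t,z)\big)+\int_0^t\big[\partial_x\psi_f\cdot\mathbf C+\boldsymbol\chi\,\Phi_{\mathbf a,f}+\mathbf b\big]\big(s,Z(s,t,z)\big)\,ds .$$ 5. $\|f\|_{C^1_b([0,T]\times\mathbb R^6)}\le K$ with a constant $K>0$ depending only on $T$, $r_0$, $r_2$ and the standard norms of the coefficients; more precisely, for all $T,r_0,r_2$ and every $M\ge0$ there is $K>0$ such that the bound holds whenever the norms of $\mathbf a,\mathbf b$ in $C([0,T];C^1_b)$, of $\mathring{\mathbf f}$ in $C^2_b$, of $\mathbf A,\mathbf B$ in $C([0,T];C^{1,\gamma})$, of $\mathbf C$ in $C([0,T];C^1_b)$ and of $\boldsymbol\chi$ in $C^1_b$ are all at most $M$. -/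

import Mathlib

open Set Filter Topology MeasureTheory
open scoped NNReal ENNReal

noncomputable section

namespace Vlasov

/-- Position (and velocity) space `ℝ³` with the Euclidean norm. -/
abbrev E3 : Type := EuclideanSpace ℝ (Fin 3)

/-- Phase space `ℝ⁶` with the Euclidean norm; of the six coordinates of a point `z = (x, v)`, those
indexed by the left copy of `Fin 3` form `x` and those indexed by the right copy form `v`. -/
abbrev Phase : Type := EuclideanSpace ℝ (Fin 3 ⊕ Fin 3)

/-- The phase space point `(x, v)`. -/
def pt (x v : E3) : Phase := WithLp.toLp 2 (Sum.elim x.ofLp v.ofLp)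

/-- The position `x` of `z = (x, v)`. -/
def xpart (z : Phase) : E3 := WithLp.toLp 2 (fun i => z (Sum.inl i))

/-- The velocity `v` of `z = (x, v)`. -/
def vpart (z : Phase) : E3 := WithLp.toLp 2 (fun i => z (Sum.inr i))

/-- The vector product of `ℝ³`. -/
def cross (v w : E3) : E3 := WithLp.toLp 2 (crossProduct v.ofLp w.ofLp)

section Spaces

variable {E F : Type*} [NormedAddCommGroup E] [NormedSpace ℝ E]
  [NormedAddCommGroup F] [NormedSpace ℝ F]

/-- The `C¹_b` norm `sup |g| + sup |Dg|`, with value `∞` if one of the suprema is infinite. -/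
def c1bNorm (g : E → F) : ℝ≥0∞ := (⨆ x, ‖g x‖ₑ) + ⨆ x, ‖fderiv ℝ g x‖ₑ

/-- The `C²_b` norm `sup |g| + sup |Dg| + sup |D²g|`. -/
def c2bNorm (g : E → F) : ℝ≥0∞ := c1bNorm g + ⨆ x, ‖fderiv ℝ (fderiv ℝ g) x‖ₑ

/-- The `C^{1,γ}` norm: the `C¹_b` norm plus the `γ`-Hölder seminorm of the derivative. -/
def c1HolderNorm (γ : ℝ≥0) (g : E → F) : ℝ≥0∞ := c1bNorm g + eHolderNorm γ (fderiv ℝ g)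

/-- `g ∈ C¹_b(E; F)`. -/
def MemC1b (g : E → F) : Prop := ContDiff ℝ 1 g ∧ c1bNorm g < ∞

/-- `g ∈ C^{1,γ}(E; F)`. -/
def MemC1Holder (γ : ℝ≥0) (g : E → F) : Prop := ContDiff ℝ 1 g ∧ c1HolderNorm γ g < ∞

/-- `t ↦ u t` is continuous on `[0,T]` with respect to the norm `N`. -/
def ContinuousInTime (T : ℝ) (N : (E → F) → ℝ≥0∞) (u : ℝ → E → F) : Prop :=
  ∀ t ∈ Icc (0 : ℝ) T, Tendsto (fun s => N (u s - u t)) (𝓝[Icc (0 : ℝ) T] t) (𝓝 0)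

/-- `u ∈ C([0,T]; C¹_b(E; F))`. -/
def MemCTC1b (T : ℝ) (u : ℝ → E → F) : Prop :=
  (∀ t ∈ Icc (0 : ℝ) T, MemC1b (u t)) ∧ ContinuousInTime T c1bNorm u

/-- `u ∈ C([0,T]; C^{1,γ}(E; F))`. -/
def MemCTC1Holder (T : ℝ) (γ : ℝ≥0) (u : ℝ → E → F) : Prop :=
  (∀ t ∈ Icc (0 : ℝ) T, MemC1Holder γ (u t)) ∧ ContinuousInTime T (c1HolderNorm γ) u

/-- The norm of `C([0,T]; X)`, where `N` is the norm of `X`. -/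
def timeSupNorm (T : ℝ) (N : (E → F) → ℝ≥0∞) (u : ℝ → E → F) : ℝ≥0∞ :=
  ⨆ t ∈ Icc (0 : ℝ) T, N (u t)

/-- The `C¹_b([0,T] × E)` norm `sup |f| + sup |∂ₜ f| + sup |∂_z f|`, with one-sided time
derivatives at the ends of `[0,T]`. -/
def spaceTimeC1bNorm (T : ℝ) (f : ℝ → E → F) : ℝ≥0∞ :=
  (⨆ t ∈ Icc (0 : ℝ) T, ⨆ z, ‖f t z‖ₑ)
    + (⨆ t ∈ Icc (0 : ℝ) T, ⨆ z, ‖derivWithin (fun τ => f τ z) (Icc (0 : ℝ) T) t‖ₑ)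
    + ⨆ t ∈ Icc (0 : ℝ) T, ⨆ z, ‖fderiv ℝ (f t) z‖ₑ

end Spaces

/-- The gradient `∂ₓ g` with respect to the position variable. -/
def gradX (g : Phase → ℝ) (z : Phase) : E3 := gradient (fun x => g (pt x (vpart z))) (xpart z)

/-- The gradient `∂ᵥ g` with respect to the velocity variable. -/
def gradV (g : Phase → ℝ) (z : Phase) : E3 := gradient (fun v => g (pt (xpart z) v)) (vpart z)

/-- `ρ_f(t,x) = ∫ f(t,x,v) dv`. -/
def density (f : ℝ → Phase → ℝ) (t : ℝ) (x : E3) : ℝ := ∫ v, f t (pt x v)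

/-- `ψ_f(t,x) = ∫ ρ_f(t,y) / |x - y| dy`. -/
def potential (f : ℝ → Phase → ℝ) (t : ℝ) (x : E3) : ℝ := ∫ y, density f t y / ‖x - y‖

/-- `Φ_{a,f}(t,x) = - ∬ (x - y)/|x - y|³ · ∂ᵥ a(t,y,w) f(t,y,w) dw dy`. -/
def Phi (a f : ℝ → Phase → ℝ) (t : ℝ) (x : E3) : ℝ :=
  - ∫ y, ∫ w, inner ℝ ((‖x - y‖ ^ 3)⁻¹ • (x - y)) (gradV (a t) (pt y w)) * f t (pt y w)

/-- The coefficients of the linear Vlasov equation (data only). -/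
structure Coefficients where
  a : ℝ → Phase → ℝ
  b : ℝ → Phase → ℝ
  f₀ : Phase → ℝ
  A : ℝ → E3 → E3
  B : ℝ → E3 → E3
  C : ℝ → Phase → E3
  χ : Phase → ℝ

/-- The regularity conditions on the coefficients. -/
structure Coefficients.Regular (D : Coefficients) (T : ℝ) (γ : ℝ≥0) : Prop where
  a_mem : MemCTC1b T D.a
  b_mem : MemCTC1b T D.b
  f₀_contDiff : ContDiff ℝ 2 D.f₀
  f₀_compact : HasCompactSupport D.f₀
  A_mem : MemCTC1Holder T γ D.A
  B_mem : MemCTC1Holder T γ D.B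
  C_mem : MemCTC1b T D.C
  χ_contDiff : ContDiff ℝ 1 D.χ
  χ_compact : HasCompactSupport D.χ
  χ_range : ∀ z, D.χ z ∈ Icc (0 : ℝ) 1

/-- The support conditions on the coefficients; balls are open and centred at `0`. -/
structure Coefficients.Supported (D : Coefficients) (T r₀ r₁ r₂ : ℝ) : Prop where
  a_supp : ∀ t ∈ Icc (0 : ℝ) T, tsupport (D.a t) ⊆ Metric.ball 0 r₀
  b_supp : ∀ t ∈ Icc (0 : ℝ) T, tsupport (D.b t) ⊆ Metric.ball 0 r₀
  f₀_supp : tsupport D.f₀ ⊆ Metric.ball 0 r₀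
  C_supp : ∀ t ∈ Icc (0 : ℝ) T, tsupport (D.C t) ⊆ Metric.ball 0 r₀
  χ_one : ∀ z ∈ Metric.ball (0 : Phase) r₁, D.χ z = 1
  χ_supp : tsupport D.χ ⊆ Metric.ball 0 r₂

/-- All standard norms of the coefficients are at most `M`. -/
structure Coefficients.NormsLE (D : Coefficients) (T : ℝ) (γ M : ℝ≥0) : Prop where
  a_le : timeSupNorm T c1bNorm D.a ≤ M
  b_le : timeSupNorm T c1bNorm D.b ≤ M
  f₀_le : c2bNorm D.f₀ ≤ M
  A_le : timeSupNorm T (c1HolderNorm γ) D.A ≤ M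
  B_le : timeSupNorm T (c1HolderNorm γ) D.B ≤ M
  C_le : timeSupNorm T c1bNorm D.C ≤ M
  χ_le : c1bNorm D.χ ≤ M

/-- The right-hand side `∂ₓψ_f · C + χ Φ_{a,f} + b` at `(t, z)`. -/
def Coefficients.source (D : Coefficients) (f : ℝ → Phase → ℝ) (t : ℝ) (z : Phase) : ℝ :=
  inner ℝ (gradient (potential f t) (xpart z)) (D.C t z) + D.χ z * Phi D.a f t (xpart z) + D.b t z

/-- `f ∈ C¹([0,T] × ℝ⁶)` solves
`∂ₜ f + v·∂ₓ f + A·∂ᵥ f + (v × B)·∂ᵥ f = ∂ₓψ_f·C + χ Φ_{a,f} + b` pointwise on `[0,T] × ℝ⁶`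
(one-sided time derivative at `t = 0` and `t = T`), with `f(0) = f₀`.
No support condition is imposed on `f`. -/
structure Coefficients.IsClassicalSolution (D : Coefficients) (T : ℝ) (f : ℝ → Phase → ℝ) :
    Prop where
  contDiffOn : ContDiffOn ℝ 1 (fun p : ℝ × Phase => f p.1 p.2) (Icc (0 : ℝ) T ×ˢ univ)
  equation : ∀ t ∈ Icc (0 : ℝ) T, ∀ z : Phase,
    derivWithin (fun τ => f τ z) (Icc (0 : ℝ) T) t
      + inner ℝ (vpart z) (gradX (f t) z)
      + inner ℝ (D.A t (xpart z)) (gradV (f t) z)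
      + inner ℝ (cross (vpart z) (D.B t (xpart z))) (gradV (f t) z)
      = D.source f t z
  initial : ∀ z, f 0 z = D.f₀ z

/-- `s ↦ Z(s,t,z) = (X,V)(s,t,z)` solves the characteristic system
`ẋ = v`, `v̇ = A(s,x) + v × B(s,x)` on `[0,T]` with `Z(t,t,z) = z`, for all `t ∈ [0,T]`, `z`. -/
structure Coefficients.IsCharacteristicFlow (D : Coefficients) (T : ℝ)
    (Z : ℝ → ℝ → Phase → Phase) : Prop where
  initial : ∀ t ∈ Icc (0 : ℝ) T, ∀ z, Z t t z = z
  ode : ∀ t ∈ Icc (0 : ℝ) T, ∀ z, ∀ s ∈ Icc (0 : ℝ) T,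
    HasDerivWithinAt (fun σ => Z σ t z)
      (pt (vpart (Z s t z))
        (D.A s (xpart (Z s t z)) + cross (vpart (Z s t z)) (D.B s (xpart (Z s t z)))))
      (Icc (0 : ℝ) T) s

/-- The norm of `A` in `L²(0,T; L^∞(ℝ³; ℝ³))`. -/
def l2LinftyNorm (T : ℝ) (A : ℝ → E3 → E3) : ℝ :=
  (eLpNorm (fun t => eLpNorm (A t) ∞ volume) 2 (volume.restrict (Ioo (0 : ℝ) T))).toReal

/-- `ζ(r) = e^{2T} (r + √T ‖A‖_{L²(0,T;L^∞)})`. -/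
def zeta (T : ℝ) (A : ℝ → E3 → E3) (r : ℝ) : ℝ :=
  Real.exp (2 * T) * (r + Real.sqrt T * l2LinftyNorm T A)

end Vlasov

end

/-! The equation is a transport equation whose source depends on the solution linearly and
nonlocally. Along the characteristics it reads `d/ds f(s, Z(s,t,z)) = source`, so a classical
solution is the same thing as a fixed point of Duhamel's formula. The proof rests on three facts.

The characteristic field has linear growth and is locally Lipschitz and C¹ in space. Its flow is
therefore global and unique by Picard-Lindelöf and Grönwall, and C¹ in all variables, the base time
included (`SmoothField.contDiff_curve_base`). The magnetic force does no work, so the growth of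
characteristics depends on `A` alone (`norm_integralCurve_lorentz_le`). Since `C`, `χ`, `b` and the
initial value vanish outside a fixed ball, the source does too, whatever `f` is. Every solution thus
has compact support automatically, and uniqueness needs no support condition.

The linear part of the source maps compactly supported C¹ functions to C¹ functions with a bound in
the C¹ norm (`exists_C1Bound_linSource`). Both of its terms are convolutions with the locally
integrable kernel `x/|x|³`, so derivatives may be put on the density. The delicate point is that `a`
is only C¹ while the density of the second term is `∫ f ∂ᵥa dw`. It is still differentiable in
position (`hasFDerivAt_moment`): an integration by parts in velocity moves `∂ᵥ` from the increment
of `a` to `f`, and the derivative is `∫ (∂ₓf ∂ᵥa - ∂ₓa ∂ᵥf) dw`.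

Consequently no derivative is lost, and in the C¹ norm with weight `exp(-lt)`, `l` large, one
Duhamel step halves the distance (`exists_C1Bound_step`). This gives existence by a Neumann series
converging in C¹, uniqueness, and the a priori bound with a constant depending only on `T`, the
support radius and the bound of the coefficients. The time derivative is then read off from the
equation. All constructions use coefficients frozen outside `[0,T]`, which changes nothing on
`[0,T]`. -/

namespace Vlasov

/-! ### Global flows of locally Lipschitz fields of linear growth. -/

section ODE

variable {E : Type*} [NormedAddCommGroup E] [NormedSpace ℝ E]

/-- Grönwall's inequality on both sides of the base time. -/
theorem norm_le_gronwallBound_abs {f f' : ℝ → E} {K ε a b t₀ : ℝ}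
    (hf : ∀ t ∈ Icc a b, HasDerivWithinAt f (f' t) (Icc a b) t)
    (bound : ∀ t ∈ Icc a b, ‖f' t‖ ≤ K * ‖f t‖ + ε) (ht₀ : t₀ ∈ Icc a b) :
    ∀ t ∈ Icc a b, ‖f t‖ ≤ gronwallBound ‖f t₀‖ K ε |t - t₀| := by
  intro t ht
  have hc : ContinuousOn f (Icc a b) := fun t ht => (hf t ht).continuousWithinAt
  rcases le_total t₀ t with h | h
  · rw [abs_of_nonneg (sub_nonneg.2 h)]
    refine norm_le_gronwallBound_of_norm_deriv_right_le (f' := f') (b := b)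
      (hc.mono (Icc_subset_Icc_left ht₀.1)) (fun x hx => ?_) le_rfl
      (fun x hx => bound x ⟨ht₀.1.trans hx.1, hx.2.le⟩) t ⟨h, ht.2⟩
    exact (hf x ⟨ht₀.1.trans hx.1, hx.2.le⟩).mono_of_mem_nhdsWithin
      (Icc_mem_nhdsGE_of_mem ⟨ht₀.1.trans hx.1, hx.2⟩)
  · rw [abs_sub_comm, abs_of_nonneg (sub_nonneg.2 h)]
    -- Times before `t₀` are reached by reversing time.
    have key := norm_le_gronwallBound_of_norm_deriv_right_le (f := fun s => f (-s))
      (f' := fun s => -f' (-s)) (K := K) (ε := ε) (δ := ‖f t₀‖) (a := -t₀) (b := -a)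
      (hc.comp continuousOn_neg fun s hs => ?_) (fun x hx => ?_) (by simp) (fun x hx => ?_)
      (-t) ⟨neg_le_neg h, neg_le_neg ht.1⟩
    · simpa [neg_add_eq_sub] using key
    · exact ⟨le_neg_of_le_neg hs.2, (neg_le.1 hs.1).trans ht₀.2⟩
    · have hx' : -x ∈ Icc a b := ⟨(lt_neg_of_lt_neg hx.2).le, (neg_le.1 hx.1).trans ht₀.2⟩
      have h1 : HasDerivWithinAt (fun s : ℝ => -s) (-1) (Ico x (-a)) x :=
        (hasDerivAt_neg x).hasDerivWithinAt
      have h2 := (hf (-x) hx').scomp x h1 (fun s hs =>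
        ⟨(lt_neg_of_lt_neg hs.2).le, (neg_le_neg hs.1).trans hx'.2⟩)
      have h3 := h2.mono_of_mem_nhdsWithin (Ico_mem_nhdsGE hx.2)
      simpa [Function.comp_def] using h3
    · rw [norm_neg]
      exact bound (-x) ⟨(lt_neg_of_lt_neg hx.2).le, (neg_le.1 hx.1).trans ht₀.2⟩

/-- A time-dependent vector field that is continuous, locally Lipschitz and of linear growth. -/
structure TameField (F : ℝ → E → E) : Prop where
  cont : Continuous fun p : ℝ × E => F p.1 p.2
  lip : ∀ S R : ℝ, ∃ K : ℝ≥0, ∀ t ∈ Icc (-S) S, LipschitzOnWith K (F t) (Metric.closedBall 0 R)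
  growth : ∀ S : ℝ, ∃ c : ℝ, 0 ≤ c ∧ ∀ t ∈ Icc (-S) S, ∀ z, ‖F t z‖ ≤ c * ‖z‖ + c

/-- Grönwall with the growth bound as differential inequality. The bound is required only along the
curve, so that it also serves for truncated fields. -/
theorem norm_curve_le {F : ℝ → E → E} {c : ℝ} {γ : ℝ → E} {a b t₀ S : ℝ}
    (hF : ∀ t ∈ Icc a b, ‖F t (γ t)‖ ≤ c * ‖γ t‖ + c) (hc : 0 ≤ c)
    (hγ : IsIntegralCurveOn γ F (Icc a b)) (ht₀ : t₀ ∈ Icc a b) (hS : b - a ≤ S) :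
    ∀ t ∈ Icc a b, ‖γ t‖ ≤ gronwallBound ‖γ t₀‖ c c S := by
  intro t ht
  refine (norm_le_gronwallBound_abs hγ hF ht₀ t ht).trans
    (gronwallBound_mono (norm_nonneg _) hc hc ?_)
  rw [abs_le]; constructor <;> linarith [ht.1, ht.2, ht₀.1, ht₀.2]

theorem dist_curve_le {F : ℝ → E → E} {K : ℝ≥0} {s : Set E} {γ γ' : ℝ → E} {a b t₀ S : ℝ}
    (hF : ∀ t ∈ Icc a b, LipschitzOnWith K (F t) s)
    (hγ : IsIntegralCurveOn γ F (Icc a b)) (hγs : ∀ t ∈ Icc a b, γ t ∈ s)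
    (hγ' : IsIntegralCurveOn γ' F (Icc a b)) (hγs' : ∀ t ∈ Icc a b, γ' t ∈ s)
    (ht₀ : t₀ ∈ Icc a b) (hS : b - a ≤ S) :
    ∀ t ∈ Icc a b, ‖γ t - γ' t‖ ≤ ‖γ t₀ - γ' t₀‖ * Real.exp (K * S) := by
  intro t ht
  have h := norm_le_gronwallBound_abs (f := fun t => γ t - γ' t) (K := K) (ε := 0)
    (fun t ht => (hγ t ht).sub (hγ' t ht))
    (fun t ht => by
      simpa using (hF t ht).norm_sub_le (hγs t ht) (hγs' t ht)) ht₀ t ht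
  rw [gronwallBound_ε0] at h
  refine h.trans (mul_le_mul_of_nonneg_left (Real.exp_le_exp.2 ?_) (norm_nonneg _))
  refine mul_le_mul_of_nonneg_left ?_ K.2
  rw [abs_le]; constructor <;> linarith [ht.1, ht.2, ht₀.1, ht₀.2]

/-- Integral curves of a tame field that agree at one time agree. -/
theorem TameField.eqOn {F : ℝ → E → E} (hF : TameField F) {γ γ' : ℝ → E} {a b t₀ : ℝ}
    (hγ : IsIntegralCurveOn γ F (Icc a b)) (hγ' : IsIntegralCurveOn γ' F (Icc a b))
    (ht₀ : t₀ ∈ Icc a b) (h : γ t₀ = γ' t₀) : EqOn γ γ' (Icc a b) := by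
  obtain ⟨C, hC⟩ := isCompact_Icc.exists_bound_of_continuousOn hγ.continuousOn
  obtain ⟨C', hC'⟩ := isCompact_Icc.exists_bound_of_continuousOn hγ'.continuousOn
  obtain ⟨K, hK⟩ := hF.lip (max |a| |b|) (max C C')
  intro t ht
  have := dist_curve_le (s := Metric.closedBall 0 (max C C')) (fun t ht => hK t
    ⟨by linarith [neg_le_neg (le_max_left |a| |b|), neg_abs_le a, ht.1],
      ht.2.trans ((le_abs_self b).trans (le_max_right _ _))⟩) hγ
    (fun t ht => by simpa using Or.inl (hC t ht)) hγ'
    (fun t ht => by simpa using Or.inr (hC' t ht)) ht₀ le_rfl t ht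
  rw [h, sub_self, norm_zero, zero_mul] at this
  exact sub_eq_zero.1 (norm_le_zero_iff.1 this)

/-- The cutoff is 1-Lipschitz, equals 1 on the ball of radius `R` and vanishes outside the ball of
radius `R + 1`. If one of two points lies outside the larger ball, the cutoff at the other is at
most their distance; hence only bounds of `G` inside the ball enter. -/
theorem lipschitzWith_cutoff_smul {G : E → E} {K : ℝ≥0} {R B : ℝ}
    (hG : LipschitzOnWith K G (Metric.closedBall 0 (R + 1)))
    (hB : ∀ z ∈ Metric.closedBall (0 : E) (R + 1), ‖G z‖ ≤ B) :
    LipschitzWith (K + B.toNNReal) fun z => max 0 (min 1 (R + 1 - ‖z‖)) • G z := by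
  have hθ : ∀ x y : E, |max 0 (min 1 (R + 1 - ‖x‖)) - max 0 (min 1 (R + 1 - ‖y‖))| ≤ ‖x - y‖ := by
    intro x y
    refine (abs_max_sub_max_le_max _ _ _ _).trans ?_
    rw [sub_self, abs_zero]
    refine max_le (norm_nonneg _) ((abs_min_sub_min_le_max _ _ _ _).trans ?_)
    rw [sub_self, abs_zero]
    refine max_le (norm_nonneg _) ?_
    rw [sub_sub_sub_cancel_left, abs_sub_comm]
    exact abs_norm_sub_norm_le x y
  have hout : ∀ x : E, x ∉ Metric.closedBall (0 : E) (R + 1) →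
      max 0 (min 1 (R + 1 - ‖x‖)) = 0 := by
    intro x hx
    rw [mem_closedBall_zero_iff, not_le] at hx
    exact max_eq_left ((min_le_right _ _).trans (by linarith))
  have key : ∀ x ∈ Metric.closedBall (0 : E) (R + 1), ∀ y,
      ‖max 0 (min 1 (R + 1 - ‖x‖)) • G x - max 0 (min 1 (R + 1 - ‖y‖)) • G y‖
        ≤ (K + B.toNNReal) * ‖x - y‖ := by
    intro x hx y
    have hB0 : ‖G x‖ ≤ B.toNNReal := (hB x hx).trans (Real.le_coe_toNNReal B)
    by_cases hy : y ∈ Metric.closedBall (0 : E) (R + 1)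
    · have e : max 0 (min 1 (R + 1 - ‖x‖)) • G x - max 0 (min 1 (R + 1 - ‖y‖)) • G y
          = max 0 (min 1 (R + 1 - ‖y‖)) • (G x - G y)
            + (max 0 (min 1 (R + 1 - ‖x‖)) - max 0 (min 1 (R + 1 - ‖y‖))) • G x := by
        rw [smul_sub, sub_smul]; abel
      rw [e, add_mul]
      refine (norm_add_le _ _).trans (add_le_add ?_ ?_)
      · rw [norm_smul, Real.norm_eq_abs, abs_of_nonneg (le_max_left _ _)]
        have h1 : max 0 (min 1 (R + 1 - ‖y‖)) ≤ 1 := max_le zero_le_one (min_le_left _ _)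
        calc _ ≤ 1 * ‖G x - G y‖ := mul_le_mul_of_nonneg_right h1 (norm_nonneg _)
          _ ≤ _ := by rw [one_mul]; exact hG.norm_sub_le hx hy
      · rw [norm_smul, Real.norm_eq_abs, mul_comm]
        exact mul_le_mul hB0 (hθ x y) (abs_nonneg _) (NNReal.coe_nonneg _)
    · rw [hout y hy, zero_smul, sub_zero, norm_smul, Real.norm_eq_abs]
      have := hθ x y
      rw [hout y hy, sub_zero] at this
      calc _ ≤ ‖x - y‖ * B.toNNReal := mul_le_mul this hB0 (norm_nonneg _) (norm_nonneg _)
        _ ≤ _ := by nlinarith [norm_nonneg (x - y), K.2]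
  refine LipschitzWith.of_dist_le_mul fun x y => ?_
  rw [dist_eq_norm, dist_eq_norm, NNReal.coe_add]
  by_cases hx : x ∈ Metric.closedBall (0 : E) (R + 1)
  · exact key x hx y
  · by_cases hy : y ∈ Metric.closedBall (0 : E) (R + 1)
    · rw [norm_sub_rev, norm_sub_rev x y]; exact key y hy x
    · rw [hout x hx, hout y hy, zero_smul, zero_smul, sub_self, norm_zero]
      positivity

variable [CompleteSpace E]

/-- Picard-Lindelöf applies on the whole interval to the truncated field, which is bounded and
globally Lipschitz. The truncation only shrinks the field, so the a priori bound holds for its curve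
and keeps it where the cutoff equals 1. -/
theorem TameField.exists_isIntegralCurveOn {F : ℝ → E → E} (hF : TameField F) {S t₀ : ℝ}
    (ht₀ : t₀ ∈ Icc (-S) S) (z₀ : E) :
    ∃ γ : ℝ → E, γ t₀ = z₀ ∧ IsIntegralCurveOn γ F (Icc (-S) S) := by
  obtain ⟨c, hc, hg⟩ := hF.growth S
  have hS : 0 ≤ S := by linarith [ht₀.1, ht₀.2]
  -- The a priori bound of a curve through `z₀` over an interval of length `2 * S`.
  set R := gronwallBound ‖z₀‖ c c (2 * S) with hR
  have hR0 : 0 ≤ R := by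
    have := gronwallBound_mono (norm_nonneg z₀) hc hc (by linarith : 0 ≤ 2 * S)
    rw [gronwallBound_x0] at this
    exact (norm_nonneg _).trans this
  obtain ⟨K, hK⟩ := hF.lip S (R + 1)
  set B := c * (R + 1) + c with hBdef
  have hB0 : 0 ≤ B := by positivity
  set G : ℝ → E → E := fun t z => max 0 (min 1 (R + 1 - ‖z‖)) • F t z with hG
  have hθ1 : ∀ z : E, max 0 (min 1 (R + 1 - ‖z‖)) ≤ 1 := fun z =>
    max_le zero_le_one (min_le_left _ _)
  have hGle : ∀ t z, ‖G t z‖ ≤ ‖F t z‖ := by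
    intro t z
    rw [hG, norm_smul, Real.norm_eq_abs, abs_of_nonneg (le_max_left _ _)]
    exact mul_le_of_le_one_left (norm_nonneg _) (hθ1 z)
  have hFB : ∀ t ∈ Icc (-S) S, ∀ z ∈ Metric.closedBall (0 : E) (R + 1), ‖F t z‖ ≤ B := by
    intro t ht z hz
    rw [mem_closedBall_zero_iff] at hz
    exact (hg t ht z).trans (by rw [hBdef]; gcongr)
  -- The truncated field is bounded by `B` everywhere, so the ball of radius `B * 2S` suffices
  -- without any smallness of the interval.
  have hpl : IsPicardLindelof G (⟨t₀, ht₀⟩ : Icc (-S) S) z₀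
      (B.toNNReal * (2 * S).toNNReal) 0 B.toNNReal (K + B.toNNReal) := by
    refine ⟨fun t ht => (lipschitzWith_cutoff_smul (hK t ht) (hFB t ht)).lipschitzOnWith,
      fun x _ => ?_, fun t ht x _ => ?_, ?_⟩
    · have : Continuous fun t => F t x := hF.cont.comp (by fun_prop : Continuous fun t => (t, x))
      exact (this.const_smul _).continuousOn
    · rw [Real.coe_toNNReal _ hB0]
      by_cases hx : x ∈ Metric.closedBall (0 : E) (R + 1)
      · exact (hGle t x).trans (hFB t ht x hx)
      · rw [mem_closedBall_zero_iff, not_le] at hx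
        have : max 0 (min 1 (R + 1 - ‖x‖)) = 0 :=
          max_eq_left ((min_le_right _ _).trans (by linarith))
        rw [hG]; simp only [this, zero_smul, norm_zero]; exact hB0
    · rw [NNReal.coe_mul, Real.coe_toNNReal _ hB0, Real.coe_toNNReal _ (by linarith),
        NNReal.coe_zero, sub_zero]
      refine mul_le_mul_of_nonneg_left (max_le ?_ ?_) hB0 <;> linarith [ht₀.1, ht₀.2]
  obtain ⟨γ, h0, hγ⟩ := hpl.exists_eq_forall_mem_Icc_hasDerivWithinAt₀
  refine ⟨γ, h0, fun t ht => ?_⟩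
  have hb := norm_curve_le (F := G) (c := c) (S := 2 * S)
    (fun t ht => (hGle t _).trans (hg t ht _)) hc hγ ht₀ (by linarith) t ht
  have : G t (γ t) = F t (γ t) := by
    have h0' : γ t₀ = z₀ := h0
    rw [h0', ← hR] at hb
    have : max 0 (min 1 (R + 1 - ‖γ t‖)) = 1 := by
      rw [min_eq_left (by linarith), max_eq_right zero_le_one]
    rw [hG]; simp only [this, one_smul]
  rw [← this]
  exact hγ t ht

theorem TameField.exists_isIntegralCurve {F : ℝ → E → E} (hF : TameField F) (t₀ : ℝ) (z₀ : E) :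
    ∃ γ : ℝ → E, γ t₀ = z₀ ∧ IsIntegralCurve γ F := by
  have hmem : ∀ n : ℝ, |t₀| ≤ n → t₀ ∈ Icc (-n) n := fun n hn => abs_le.1 hn
  have hex : ∀ n : ℝ, ∃ γ : ℝ → E, |t₀| ≤ n → γ t₀ = z₀ ∧ IsIntegralCurveOn γ F (Icc (-n) n) := by
    intro n
    by_cases h : |t₀| ≤ n
    · obtain ⟨γ, h1, h2⟩ := hF.exists_isIntegralCurveOn (hmem n h) z₀
      exact ⟨γ, fun _ => ⟨h1, h2⟩⟩
    · exact ⟨0, fun h' => absurd h' h⟩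
  choose φ hφ using hex
  have hagree : ∀ m n : ℝ, |t₀| ≤ m → m ≤ n → EqOn (φ m) (φ n) (Icc (-m) m) := by
    intro m n hm hmn
    refine hF.eqOn (hφ m hm).2 ((hφ n (hm.trans hmn)).2.mono
      (Icc_subset_Icc (neg_le_neg hmn) hmn)) (hmem m hm) ?_
    rw [(hφ m hm).1, (hφ n (hm.trans hmn)).1]
  -- The half-length `|t₀| + |s|` covers both `t₀` and `s`. Near `s` all these curves agree with the
  -- one on a slightly longer interval, of which `s` is an interior point.
  refine ⟨fun s => φ (|t₀| + |s|) s, ?_, fun s => ?_⟩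
  · exact (hφ _ (by linarith [abs_nonneg t₀])).1
  · set N := |t₀| + |s| + 1 with hN
    have hloc : (fun s => φ (|t₀| + |s|) s) =ᶠ[𝓝 s] φ N := by
      have : ∀ᶠ r in 𝓝 s, |r| < |s| + 1 :=
        (continuous_abs.tendsto s).eventually (gt_mem_nhds (by linarith))
      filter_upwards [this] with r hr
      refine hagree _ _ (by linarith [abs_nonneg r]) (by linarith) (abs_le.1 ?_)
      linarith [abs_nonneg t₀]
    have hd := ((hφ N (by linarith [abs_nonneg s])).2).isIntegralCurveAt (t₀ := s)
      (Icc_mem_nhds (by linarith [neg_abs_le s, abs_nonneg t₀])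
        (by linarith [le_abs_self s, abs_nonneg t₀]))
    have := hd.hasDerivAt
    have e : φ (|t₀| + |s|) s = φ N s := hloc.self_of_nhds
    show HasDerivAt (fun s => φ (|t₀| + |s|) s) (F s (φ (|t₀| + |s|) s)) s
    rw [e]
    exact this.congr_of_eventuallyEq hloc

/-- The integral curve of a tame field through `z` at time `t`, evaluated at time `s`. -/
noncomputable def TameField.curve {F : ℝ → E → E} (hF : TameField F) (t : ℝ) (z : E) : ℝ → E :=
  (hF.exists_isIntegralCurve t z).choose

variable {F : ℝ → E → E} (hF : TameField F)
include hF

@[simp] theorem TameField.curve_self (t : ℝ) (z : E) : hF.curve t z t = z :=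
  (hF.exists_isIntegralCurve t z).choose_spec.1

theorem TameField.isIntegralCurve_curve (t : ℝ) (z : E) : IsIntegralCurve (hF.curve t z) F :=
  (hF.exists_isIntegralCurve t z).choose_spec.2

theorem TameField.hasDerivAt_curve (t : ℝ) (z : E) (s : ℝ) :
    HasDerivAt (hF.curve t z) (F s (hF.curve t z s)) s :=
  hF.isIntegralCurve_curve t z s

theorem TameField.eq_curve {γ : ℝ → E} {a b t₀ : ℝ} (hγ : IsIntegralCurveOn γ F (Icc a b))
    (ht₀ : t₀ ∈ Icc a b) : EqOn γ (hF.curve t₀ (γ t₀)) (Icc a b) :=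
  hF.eqOn hγ ((hF.isIntegralCurve_curve _ _).isIntegralCurveOn _) ht₀ (by simp)

/-- The flow property: both sides solve the equation and agree at time `r`. -/
theorem TameField.curve_curve (t r s : ℝ) (z : E) :
    hF.curve r (hF.curve t z r) s = hF.curve t z s := by
  have := hF.eq_curve (a := min r s) (b := max r s) (t₀ := r)
    ((hF.isIntegralCurve_curve t z).isIntegralCurveOn _) ⟨min_le_left _ _, le_max_left _ _⟩
    (x := s) ⟨min_le_right _ _, le_max_right _ _⟩
  exact this.symm

/-- The curves with data in a bounded set are bounded and depend Lipschitz continuously on the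
data, on bounded time intervals. -/
theorem TameField.curve_bounds (S R : ℝ) :
    ∃ R' C : ℝ, 0 ≤ C ∧ ∀ t ∈ Icc (-S) S, ∀ s ∈ Icc (-S) S, ∀ z ∈ Metric.closedBall (0 : E) R,
      ‖hF.curve t z s‖ ≤ R' ∧ ∀ z' ∈ Metric.closedBall (0 : E) R,
        ‖hF.curve t z s - hF.curve t z' s‖ ≤ C * ‖z - z'‖ := by
  obtain ⟨c, hc, hg⟩ := hF.growth S
  obtain ⟨K, hK⟩ := hF.lip S (gronwallBound R c c (2 * S))
  have hb : ∀ t ∈ Icc (-S) S, ∀ s ∈ Icc (-S) S, ∀ z ∈ Metric.closedBall (0 : E) R,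
      ‖hF.curve t z s‖ ≤ gronwallBound R c c (2 * S) := by
    intro t ht s hs z hz
    refine (norm_curve_le (S := 2 * S) (fun r hr => hg r hr _) hc
      ((hF.isIntegralCurve_curve t z).isIntegralCurveOn _) ht (by linarith) s hs).trans ?_
    rw [hF.curve_self, mem_closedBall_zero_iff] at *
    unfold gronwallBound
    split_ifs <;> gcongr
  refine ⟨_, Real.exp (K * (2 * S)), (Real.exp_pos _).le,
    fun t ht s hs z hz => ⟨hb t ht s hs z hz, fun z' hz' => ?_⟩⟩
  have := dist_curve_le (S := 2 * S) hK
    ((hF.isIntegralCurve_curve t z).isIntegralCurveOn _)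
    (fun r hr => mem_closedBall_zero_iff.2 (hb t ht r hr z hz))
    ((hF.isIntegralCurve_curve t z').isIntegralCurveOn _)
    (fun r hr => mem_closedBall_zero_iff.2 (hb t ht r hr z' hz')) ht (by linarith) s hs
  simpa [mul_comm] using this

theorem TameField.continuous_curve (t : ℝ) :
    Continuous fun p : ℝ × E => hF.curve t p.2 p.1 := by
  refine continuous_iff_continuousAt.2 fun ⟨s₀, z₀⟩ => ?_
  obtain ⟨R', C, hC, h⟩ := hF.curve_bounds (|t| + |s₀| + 1) (‖z₀‖ + 1)
  have h1 : Tendsto (fun p : ℝ × E => C * ‖p.2 - z₀‖ + ‖hF.curve t z₀ p.1 - hF.curve t z₀ s₀‖)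
      (𝓝 (s₀, z₀)) (𝓝 0) := by
    have : Continuous fun p : ℝ × E =>
        C * ‖p.2 - z₀‖ + ‖hF.curve t z₀ p.1 - hF.curve t z₀ s₀‖ := by
      have := (hF.isIntegralCurve_curve t z₀).continuous
      fun_prop
    simpa using this.tendsto (s₀, z₀)
  rw [ContinuousAt, tendsto_iff_norm_sub_tendsto_zero]
  refine squeeze_zero' (Eventually.of_forall fun _ => norm_nonneg _) ?_ h1
  have e1 : ∀ᶠ p : ℝ × E in 𝓝 (s₀, z₀), |p.1| < |s₀| + 1 :=
    ((continuous_abs.comp continuous_fst).tendsto (s₀, z₀)).eventually (gt_mem_nhds (by simp))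
  have e2 : ∀ᶠ p : ℝ × E in 𝓝 (s₀, z₀), ‖p.2‖ < ‖z₀‖ + 1 :=
    ((continuous_norm.comp continuous_snd).tendsto (s₀, z₀)).eventually (gt_mem_nhds (by simp))
  filter_upwards [e1, e2] with p h1 h2
  have := (h t (abs_le.1 (by linarith [abs_nonneg s₀])) p.1
    (abs_le.1 (by linarith [abs_nonneg t])) p.2 (by simpa using h2.le)).2 z₀ (by simp)
  calc _ = ‖(hF.curve t p.2 p.1 - hF.curve t z₀ p.1)
        + (hF.curve t z₀ p.1 - hF.curve t z₀ s₀)‖ := by congr 1; abel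
    _ ≤ _ := (norm_add_le _ _).trans (by gcongr)

end ODE

/-! ### Joint differentiability from continuous partial derivatives. -/

section Partial

variable {E₁ E₂ G : Type*} [NormedAddCommGroup E₁] [NormedSpace ℝ E₁] [NormedAddCommGroup E₂]
  [NormedSpace ℝ E₂] [NormedAddCommGroup G] [NormedSpace ℝ G]

/-- Strict differentiability is what the inverse function argument for the straightening map
requires. -/
theorem hasStrictFDerivAt_of_continuous_partials {f : E₁ → E₂ → G} {f₁ : E₁ → E₂ → E₁ →L[ℝ] G}
    {f₂ : E₁ → E₂ → E₂ →L[ℝ] G} (h₁ : ∀ x y, HasFDerivAt (fun x => f x y) (f₁ x y) x)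
    (h₂ : ∀ x y, HasFDerivAt (f x) (f₂ x y) y) (c₁ : Continuous fun p : E₁ × E₂ => f₁ p.1 p.2)
    (c₂ : Continuous fun p : E₁ × E₂ => f₂ p.1 p.2) (p : E₁ × E₂) :
    HasStrictFDerivAt (fun p : E₁ × E₂ => f p.1 p.2)
      ((f₁ p.1 p.2).coprod (f₂ p.1 p.2)) p :=
  hasStrictFDerivAt_uncurry_coprod (f := f) (f₁ := f₁) (f₂ := f₂)
    (Eventually.of_forall fun v => h₁ v.1 v.2) (Eventually.of_forall fun v => h₂ v.1 v.2)
    c₁.continuousAt c₂.continuousAt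

theorem contDiff_one_of_continuous_partials {f : E₁ → E₂ → G} {f₁ : E₁ → E₂ → E₁ →L[ℝ] G}
    {f₂ : E₁ → E₂ → E₂ →L[ℝ] G} (h₁ : ∀ x y, HasFDerivAt (fun x => f x y) (f₁ x y) x)
    (h₂ : ∀ x y, HasFDerivAt (f x) (f₂ x y) y) (c₁ : Continuous fun p : E₁ × E₂ => f₁ p.1 p.2)
    (c₂ : Continuous fun p : E₁ × E₂ => f₂ p.1 p.2) :
    ContDiff ℝ 1 fun p : E₁ × E₂ => f p.1 p.2 :=
  contDiff_one_iff_hasFDerivAt.2 ⟨fun p => (f₁ p.1 p.2).coprod (f₂ p.1 p.2),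
    c₁.continuousLinearMapCoprod c₂,
    fun p => (hasStrictFDerivAt_of_continuous_partials h₁ h₂ c₁ c₂ p).hasFDerivAt⟩

/-- The tube lemma: continuity in `x` is uniform over the compact time interval. -/
theorem eventually_forall_norm_sub_le {X G : Type*} [NormedAddCommGroup G] [TopologicalSpace X]
    {H : ℝ → X → G}
    (hH : Continuous fun p : ℝ × X => H p.1 p.2) (x₀ : X) (a b : ℝ) {ε : ℝ} (hε : 0 < ε) :
    ∀ᶠ x in 𝓝 x₀, ∀ s ∈ Icc a b, ‖H s x - H s x₀‖ ≤ ε := by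
  refine isCompact_Icc.eventually_forall_of_forall_eventually fun s _ => ?_
  have hc : Continuous fun q : X × ℝ => ‖H q.2 q.1 - H q.2 x₀‖ :=
    ((hH.comp (by fun_prop : Continuous fun q : X × ℝ => (q.2, q.1))).sub
      (hH.comp (by fun_prop : Continuous fun q : X × ℝ => (q.2, x₀)))).norm
  exact (hc.tendsto (x₀, s)).eventually_le_const (by simpa using hε)

end Partial

/-! ### Differentiability of the flow with respect to the initial value. -/

section ODE

variable {E : Type*} [NormedAddCommGroup E] [NormedSpace ℝ E]

theorem gronwallBound_zero_left (K ε x : ℝ) :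
    gronwallBound 0 K ε x = ε * gronwallBound 0 K 1 x := by
  unfold gronwallBound
  split_ifs <;> ring

theorem gronwallBound_zero_one_nonneg {K x : ℝ} (hK : 0 ≤ K) (hx : 0 ≤ x) :
    0 ≤ gronwallBound 0 K 1 x := by
  have := gronwallBound_mono le_rfl zero_le_one hK hx
  rwa [gronwallBound_x0] at this

/-- A tame field with a jointly continuous space derivative `F'`. -/
structure SmoothField (F : ℝ → E → E) (F' : ℝ → E → E →L[ℝ] E) : Prop extends TameField F where
  hasFDerivAt : ∀ t z, HasFDerivAt (F t) (F' t z) z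
  cont' : Continuous fun p : ℝ × E => F' p.1 p.2

variable [CompleteSpace E] {F : ℝ → E → E} {F' : ℝ → E → E →L[ℝ] E}

/-- The field of the variational equation along an integral curve. -/
theorem SmoothField.variation (hF : SmoothField F F') (t : ℝ) (z : E) :
    TameField fun s (W : E →L[ℝ] E) => (F' s (hF.curve t z s)).comp W := by
  have hc : Continuous fun s => F' s (hF.curve t z s) :=
    hF.cont'.comp (continuous_id.prodMk (hF.isIntegralCurve_curve t z).continuous)
  refine ⟨(hc.comp continuous_fst).clm_comp continuous_snd, fun S R => ?_, fun S => ?_⟩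
  · obtain ⟨C, hC⟩ := (isCompact_Icc (a := -S) (b := S)).exists_bound_of_continuousOn
      hc.continuousOn
    refine ⟨C.toNNReal, fun s hs => (LipschitzWith.of_dist_le_mul fun W W' => ?_).lipschitzOnWith⟩
    rw [dist_eq_norm, dist_eq_norm, ← ContinuousLinearMap.comp_sub]
    exact (ContinuousLinearMap.opNorm_comp_le _ _).trans
      (mul_le_mul_of_nonneg_right ((hC s hs).trans (Real.le_coe_toNNReal C)) (norm_nonneg _))
  · obtain ⟨C, hC⟩ := (isCompact_Icc (a := -S) (b := S)).exists_bound_of_continuousOn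
      hc.continuousOn
    refine ⟨max C 0, le_max_right _ _, fun s hs W => ?_⟩
    calc _ ≤ ‖F' s (hF.curve t z s)‖ * ‖W‖ := ContinuousLinearMap.opNorm_comp_le _ _
      _ ≤ max C 0 * ‖W‖ :=
        mul_le_mul_of_nonneg_right ((hC s hs).trans (le_max_left _ _)) (norm_nonneg _)
      _ ≤ _ := le_add_of_nonneg_right (le_max_right _ _)

/-- The derivative of the integral curves with respect to the initial value. -/
noncomputable def SmoothField.dcurve (hF : SmoothField F F') (t : ℝ) (z : E) (s : ℝ) : E →L[ℝ] E :=
  (hF.variation t z).curve t (ContinuousLinearMap.id ℝ E) s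

variable (hF : SmoothField F F')
include hF

theorem SmoothField.hasDerivAt_dcurve (t : ℝ) (z : E) (s : ℝ) :
    HasDerivAt (hF.dcurve t z) ((F' s (hF.curve t z s)).comp (hF.dcurve t z s)) s :=
  (hF.variation t z).hasDerivAt_curve t _ s

theorem SmoothField.dcurve_self (t : ℝ) (z : E) :
    hF.dcurve t z t = ContinuousLinearMap.id ℝ E :=
  (hF.variation t z).curve_self t _

theorem SmoothField.continuous_fderiv_curve (t : ℝ) :
    Continuous fun p : ℝ × E => F' p.1 (hF.curve t p.2 p.1) :=
  hF.cont'.comp (continuous_fst.prodMk (hF.continuous_curve t))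

/-- Near a point of the reference curve `F'` oscillates by less than `ε` on a ball, which is convex
and contains both curves, so the mean value inequality bounds the first order remainder. Compactness
of `[a,b]` makes this uniform in time. -/
theorem SmoothField.eventually_remainder_le (t : ℝ) (z₀ : E) (a b : ℝ) {ε : ℝ} (hε : 0 < ε) :
    ∀ᶠ z in 𝓝 z₀, ∀ s ∈ Icc a b,
      ‖F s (hF.curve t z s) - F s (hF.curve t z₀ s)
        - F' s (hF.curve t z₀ s) (hF.curve t z s - hF.curve t z₀ s)‖
      ≤ ε * ‖hF.curve t z s - hF.curve t z₀ s‖ := by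
  refine isCompact_Icc.eventually_forall_of_forall_eventually fun s₀ _ => ?_
  have hY : Continuous fun q : E × ℝ => hF.curve t q.1 q.2 :=
    (hF.continuous_curve t).comp continuous_swap
  have hY₀ : Continuous fun q : E × ℝ => hF.curve t z₀ q.2 :=
    (hF.isIntegralCurve_curve t z₀).continuous.comp continuous_snd
  have hH : Continuous fun q : ℝ × E => ‖F' q.1 q.2 - F' s₀ (hF.curve t z₀ s₀)‖ :=
    (hF.cont'.sub continuous_const).norm
  have h1 := (hH.tendsto (s₀, hF.curve t z₀ s₀)).eventually_lt_const
    (u := ε / 2) (by simpa using hε)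
  obtain ⟨δ, hδ, hb⟩ := Metric.eventually_nhds_iff_ball.1 h1
  have e1 : ∀ᶠ q : E × ℝ in 𝓝 (z₀, s₀), hF.curve t q.1 q.2 ∈ Metric.ball (hF.curve t z₀ s₀) δ :=
    (hY.tendsto (z₀, s₀)).eventually (Metric.ball_mem_nhds _ hδ)
  have e2 : ∀ᶠ q : E × ℝ in 𝓝 (z₀, s₀), hF.curve t z₀ q.2 ∈ Metric.ball (hF.curve t z₀ s₀) δ :=
    (hY₀.tendsto (z₀, s₀)).eventually (Metric.ball_mem_nhds _ hδ)
  have e3 : ∀ᶠ q : E × ℝ in 𝓝 (z₀, s₀), q.2 ∈ Metric.ball s₀ δ :=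
    (continuous_snd.tendsto (z₀, s₀)).eventually (Metric.ball_mem_nhds _ hδ)
  filter_upwards [e1, e2, e3] with q h1 h2 h3
  have hq : ∀ y ∈ Metric.ball (hF.curve t z₀ s₀) δ,
      ‖F' q.2 y - F' s₀ (hF.curve t z₀ s₀)‖ < ε / 2 := fun y hy => by
    refine hb (q.2, y) ?_
    rw [← ball_prod_same]
    exact ⟨h3, hy⟩
  refine (convex_ball _ _).norm_image_sub_le_of_norm_hasFDerivWithin_le'
    (fun y _ => (hF.hasFDerivAt q.2 y).hasFDerivWithinAt) (fun y hy => ?_) h2 h1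
  calc _ = ‖(F' q.2 y - F' s₀ (hF.curve t z₀ s₀))
        - (F' q.2 (hF.curve t z₀ q.2) - F' s₀ (hF.curve t z₀ s₀))‖ := by congr 1; abel
    _ ≤ _ := (norm_sub_le _ _).trans (by linarith [hq y hy, hq _ h2])

/-- The deviation of the curve from its linearisation starts at zero and satisfies the variational
equation with the Taylor remainder as forcing term. Grönwall shows that it is `o(‖z - z₀‖)`. -/
theorem SmoothField.hasFDerivAt_curve (t s : ℝ) (z₀ : E) :
    HasFDerivAt (fun z => hF.curve t z s) (hF.dcurve t z₀ s) z₀ := by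
  set S := max |t| |s| with hS
  have ht : t ∈ Icc (-S) S := abs_le.1 (le_max_left _ _)
  have hs : s ∈ Icc (-S) S := abs_le.1 (le_max_right _ _)
  have hS0 : 0 ≤ S := (abs_nonneg t).trans (le_max_left _ _)
  obtain ⟨R', C, hC, hY⟩ := hF.curve_bounds S (‖z₀‖ + 1)
  obtain ⟨C₁, hC₁⟩ := (isCompact_Icc (a := -S) (b := S)).exists_bound_of_continuousOn
    ((hF.continuous_fderiv_curve t).comp
      (by fun_prop : Continuous fun s : ℝ => (s, z₀))).continuousOn
  have hC₁0 : 0 ≤ C₁ := (norm_nonneg _).trans (hC₁ t ht)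
  have hg0 := gronwallBound_zero_one_nonneg hC₁0 (by linarith : 0 ≤ 2 * S)
  rw [hasFDerivAt_iff_isLittleO, Asymptotics.isLittleO_iff]
  intro ε hε
  set M := C * gronwallBound 0 C₁ 1 (2 * S) with hM
  have hM0 : 0 ≤ M := mul_nonneg hC hg0
  have hball : ∀ᶠ z in 𝓝 z₀, ‖z‖ < ‖z₀‖ + 1 :=
    (continuous_norm.tendsto z₀).eventually (gt_mem_nhds (by simp))
  filter_upwards [hF.eventually_remainder_le t z₀ (-S) S (ε := ε / (M + 1)) (by positivity), hball]
    with z hz hzb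
  -- The forcing is at most `ε/(M+1) * C‖z - z₀‖`, and Grönwall multiplies it by at most `M/C`-type
  -- factors collected in `M`; the `+1` avoids dividing by zero.
  have key := norm_le_gronwallBound_abs
    (f := fun r => hF.curve t z r - hF.curve t z₀ r - hF.dcurve t z₀ r (z - z₀))
    (f' := fun r => F r (hF.curve t z r) - F r (hF.curve t z₀ r)
      - (F' r (hF.curve t z₀ r)).comp (hF.dcurve t z₀ r) (z - z₀))
    (K := C₁) (ε := ε / (M + 1) * (C * ‖z - z₀‖)) (a := -S) (b := S) (t₀ := t)
    (fun r _ => (((hF.hasDerivAt_curve t z r).sub (hF.hasDerivAt_curve t z₀ r)).sub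
      ((hF.hasDerivAt_dcurve t z₀ r).clm_apply (hasDerivAt_const r (z - z₀))
        |>.congr_deriv (by simp))).hasDerivWithinAt)
    (fun r hr => ?_) ht s hs
  · simp only [hF.curve_self, hF.dcurve_self, ContinuousLinearMap.id_apply, sub_self,
      norm_zero] at key
    refine key.trans ((gronwallBound_mono le_rfl (by positivity) hC₁0 (b := 2 * S) ?_).trans ?_)
    · rw [abs_le]; constructor <;> linarith [ht.1, ht.2, hs.1, hs.2]
    · rw [gronwallBound_zero_left]
      calc _ = ε * (M / (M + 1)) * ‖z - z₀‖ := by rw [hM]; ring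
        _ ≤ ε * 1 * ‖z - z₀‖ := by
          gcongr
          exact div_le_one_of_le₀ (by linarith) (by linarith)
        _ = _ := by ring
  · have e : F r (hF.curve t z r) - F r (hF.curve t z₀ r)
        - (F' r (hF.curve t z₀ r)).comp (hF.dcurve t z₀ r) (z - z₀)
        = F' r (hF.curve t z₀ r)
            (hF.curve t z r - hF.curve t z₀ r - hF.dcurve t z₀ r (z - z₀))
          + (F r (hF.curve t z r) - F r (hF.curve t z₀ r)
            - F' r (hF.curve t z₀ r) (hF.curve t z r - hF.curve t z₀ r)) := by
      rw [map_sub _ _ (hF.dcurve t z₀ r (z - z₀)), ContinuousLinearMap.comp_apply]; abel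
    rw [e]
    refine (norm_add_le _ _).trans (add_le_add ?_ ((hz r hr).trans ?_))
    · exact (ContinuousLinearMap.le_opNorm _ _).trans
        (mul_le_mul_of_nonneg_right (hC₁ r hr) (norm_nonneg _))
    · gcongr
      exact (hY t ht r hr z (by simpa using hzb.le)).2 z₀ (by simp)

/-- The difference of two solutions of the variational equation solves the equation along one curve,
forced by the difference of the two coefficients. That difference is uniformly small when the
initial values are close. -/
theorem SmoothField.continuous_dcurve (t : ℝ) :
    Continuous fun p : ℝ × E => hF.dcurve t p.2 p.1 := by
  refine continuous_iff_continuousAt.2 fun ⟨s₀, z₀⟩ => ?_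
  set S := max |t| (|s₀| + 1) with hS
  have ht : t ∈ Icc (-S) S := abs_le.1 (le_max_left _ _)
  have hcW : Continuous (hF.dcurve t z₀) :=
    continuous_iff_continuousAt.2 fun s => (hF.hasDerivAt_dcurve t z₀ s).continuousAt
  obtain ⟨C₁, hC₁⟩ := (isCompact_Icc (a := -S) (b := S)).exists_bound_of_continuousOn
    ((hF.continuous_fderiv_curve t).comp
      (by fun_prop : Continuous fun s : ℝ => (s, z₀))).continuousOn
  obtain ⟨C₂, hC₂⟩ := (isCompact_Icc (a := -S) (b := S)).exists_bound_of_continuousOn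
    hcW.continuousOn
  have hS0 : 0 ≤ S := (abs_nonneg t).trans (le_max_left _ _)
  have hC₁0 : 0 ≤ C₁ := (norm_nonneg _).trans (hC₁ t ht)
  have hC₂0 : 0 ≤ C₂ := (norm_nonneg _).trans (hC₂ t ht)
  have hg0 := gronwallBound_zero_one_nonneg (by linarith : 0 ≤ C₁ + 1) (by linarith : 0 ≤ 2 * S)
  set M := C₂ * gronwallBound 0 (C₁ + 1) 1 (2 * S) with hM
  have hM0 : 0 ≤ M := mul_nonneg hC₂0 hg0
  rw [ContinuousAt, Metric.tendsto_nhds]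
  intro ε hε
  -- The `1` keeps the coefficient along the perturbed curve below `C₁ + 1`, the other entry makes
  -- the Grönwall bound `η * M` less than `ε / 2`.
  set η := min 1 (ε / (2 * (M + 1))) with hη
  have hη0 : 0 < η := lt_min one_pos (by positivity)
  have e1 : ∀ᶠ p : ℝ × E in 𝓝 (s₀, z₀), |p.1| < |s₀| + 1 :=
    ((continuous_abs.comp continuous_fst).tendsto (s₀, z₀)).eventually (gt_mem_nhds (by simp))
  have e2 : ∀ᶠ p : ℝ × E in 𝓝 (s₀, z₀), ∀ s ∈ Icc (-S) S,
      ‖F' s (hF.curve t p.2 s) - F' s (hF.curve t z₀ s)‖ ≤ η :=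
    (continuous_snd.tendsto (s₀, z₀)).eventually
      (eventually_forall_norm_sub_le (H := fun s z => F' s (hF.curve t z s))
        (hF.continuous_fderiv_curve t) z₀ (-S) S hη0)
  have e3 : ∀ᶠ p : ℝ × E in 𝓝 (s₀, z₀), dist (hF.dcurve t z₀ p.1) (hF.dcurve t z₀ s₀) < ε / 2 :=
    ((hcW.comp continuous_fst).tendsto (s₀, z₀)).eventually
      (Metric.ball_mem_nhds _ (by linarith))
  filter_upwards [e1, e2, e3] with p h1 h2 h3
  have hp : p.1 ∈ Icc (-S) S := abs_le.1 (h1.le.trans (le_max_right _ _))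
  have key := norm_le_gronwallBound_abs
    (f := fun r => hF.dcurve t p.2 r - hF.dcurve t z₀ r)
    (f' := fun r => (F' r (hF.curve t p.2 r)).comp (hF.dcurve t p.2 r)
      - (F' r (hF.curve t z₀ r)).comp (hF.dcurve t z₀ r))
    (K := C₁ + 1) (ε := η * C₂) (a := -S) (b := S) (t₀ := t)
    (fun r _ => ((hF.hasDerivAt_dcurve t p.2 r).sub
      (hF.hasDerivAt_dcurve t z₀ r)).hasDerivWithinAt)
    (fun r hr => ?_) ht p.1 hp
  · simp only [hF.dcurve_self, sub_self, norm_zero] at key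
    have hb : ‖hF.dcurve t p.2 p.1 - hF.dcurve t z₀ p.1‖ ≤ η * M := by
      refine key.trans ((gronwallBound_mono le_rfl (by positivity) (by linarith)
        (b := 2 * S) ?_).trans ?_)
      · rw [abs_le]; constructor <;> linarith [ht.1, ht.2, hp.1, hp.2]
      · rw [gronwallBound_zero_left, hM, mul_assoc]
    have hb' : η * M < ε / 2 := by
      calc η * M ≤ ε / (2 * (M + 1)) * M := mul_le_mul_of_nonneg_right (min_le_right _ _) hM0
        _ = ε / 2 * (M / (M + 1)) := by field_simp
        _ < ε / 2 * 1 := by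
          refine mul_lt_mul_of_pos_left ?_ (by linarith)
          rw [div_lt_one (by linarith)]; linarith
        _ = ε / 2 := mul_one _
    refine (dist_triangle _ (hF.dcurve t z₀ p.1) _).trans_lt ?_
    rw [dist_eq_norm]
    linarith
  · have e : (F' r (hF.curve t p.2 r)).comp (hF.dcurve t p.2 r)
        - (F' r (hF.curve t z₀ r)).comp (hF.dcurve t z₀ r)
        = (F' r (hF.curve t p.2 r)).comp (hF.dcurve t p.2 r - hF.dcurve t z₀ r)
          + (F' r (hF.curve t p.2 r) - F' r (hF.curve t z₀ r)).comp (hF.dcurve t z₀ r) := by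
      rw [ContinuousLinearMap.comp_sub, ContinuousLinearMap.sub_comp]; abel
    rw [e]
    refine (norm_add_le _ _).trans (add_le_add
      ((ContinuousLinearMap.opNorm_comp_le _ _).trans
        (mul_le_mul_of_nonneg_right ?_ (norm_nonneg _)))
      ((ContinuousLinearMap.opNorm_comp_le _ _).trans
        (mul_le_mul (h2 r hr) (hC₂ r hr) (norm_nonneg _) hη0.le)))
    calc _ = ‖F' r (hF.curve t z₀ r) + (F' r (hF.curve t p.2 r) - F' r (hF.curve t z₀ r))‖ := by
          congr 1; abel
      _ ≤ _ := (norm_add_le _ _).trans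
        (add_le_add (hC₁ r hr) ((h2 r hr).trans (min_le_left _ _)))

theorem SmoothField.hasStrictFDerivAt_curve (t : ℝ) (p : ℝ × E) :
    HasStrictFDerivAt (fun p : ℝ × E => hF.curve t p.2 p.1)
      ((ContinuousLinearMap.toSpanSingleton ℝ (F p.1 (hF.curve t p.2 p.1))).coprod
        (hF.dcurve t p.2 p.1)) p := by
  refine hasStrictFDerivAt_of_continuous_partials (f := fun s z => hF.curve t z s)
    (f₁ := fun s z => ContinuousLinearMap.toSpanSingleton ℝ (F s (hF.curve t z s)))
    (f₂ := fun s z => hF.dcurve t z s)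
    (fun s z => (hF.hasDerivAt_curve t z s).hasFDerivAt)
    (fun s z => hF.hasFDerivAt_curve t s z) ?_ (hF.continuous_dcurve t) p
  exact (ContinuousLinearMap.toSpanSingletonCLE (𝕜 := ℝ) (E := E)).continuous.comp
    (hF.cont.comp (continuous_fst.prodMk (hF.continuous_curve t)))

end ODE

/-! ### The transport equation and Duhamel's formula along the flow. -/

section Transport

variable {E : Type*} [NormedAddCommGroup E] [NormedSpace ℝ E]

theorem hasFDerivAt_intervalIntegral_of_continuous {g : ℝ → E → ℝ} {g' : ℝ → E → E →L[ℝ] ℝ}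
    (hd : ∀ s z, HasFDerivAt (g s) (g' s z) z) (hg : Continuous fun p : ℝ × E => g p.1 p.2)
    (hg' : Continuous fun p : ℝ × E => g' p.1 p.2) (a b : ℝ) (z₀ : E) :
    HasFDerivAt (fun z => ∫ s in a..b, g s z) (∫ s in a..b, g' s z₀) z₀ := by
  have hc : ∀ z, Continuous fun s => g s z := fun z =>
    hg.comp (by fun_prop : Continuous fun s : ℝ => (s, z))
  have hc' : ∀ z, Continuous fun s => g' s z := fun z =>
    hg'.comp (by fun_prop : Continuous fun s : ℝ => (s, z))
  have hev := eventually_forall_norm_sub_le (H := g') hg' z₀ (min a b) (max a b) one_pos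
  refine intervalIntegral.hasFDerivAt_integral_of_dominated_of_fderiv_le (μ := volume)
    (bound := fun s => ‖g' s z₀‖ + 1) hev
    (Eventually.of_forall fun z => (hc z).aestronglyMeasurable)
    ((hc z₀).intervalIntegrable _ _) (hc' z₀).aestronglyMeasurable ?_
    (((hc' z₀).norm.add continuous_const).intervalIntegrable _ _)
    (Eventually.of_forall fun s _ z _ => hd s z)
  refine Eventually.of_forall fun s hs z hz => ?_
  have := hz s (Ioc_subset_Icc_self hs)
  calc _ = ‖g' s z₀ + (g' s z - g' s z₀)‖ := by congr 1; abel
    _ ≤ _ := (norm_add_le _ _).trans (add_le_add le_rfl this)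

theorem contDiff_intervalIntegral {g : ℝ → E → ℝ} {g' : ℝ → E → E →L[ℝ] ℝ}
    (hd : ∀ s z, HasFDerivAt (g s) (g' s z) z) (hg : Continuous fun p : ℝ × E => g p.1 p.2)
    (hg' : Continuous fun p : ℝ × E => g' p.1 p.2) (a : ℝ) :
    ContDiff ℝ 1 fun p : ℝ × E => ∫ s in a..p.1, g s p.2 := by
  have hc : ∀ z, Continuous fun s => g s z := fun z =>
    hg.comp (by fun_prop : Continuous fun s : ℝ => (s, z))
  refine contDiff_one_of_continuous_partials (f := fun t z => ∫ s in a..t, g s z)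
    (f₁ := fun t z => ContinuousLinearMap.toSpanSingleton ℝ (g t z))
    (f₂ := fun t z => ∫ s in a..t, g' s z)
    (fun t z => (intervalIntegral.integral_hasDerivAt_right ((hc z).intervalIntegrable _ _)
      ((hc z).stronglyMeasurableAtFilter _ _) (hc z).continuousAt).hasFDerivAt)
    (fun t z => hasFDerivAt_intervalIntegral_of_continuous hd hg hg' a t z)
    ((ContinuousLinearMap.toSpanSingletonCLE (𝕜 := ℝ) (E := ℝ)).continuous.comp hg) ?_
  exact intervalIntegral.continuous_parametric_intervalIntegral_of_continuous
    (f := fun (p : ℝ × E) s => g' s p.2)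
    (hg'.comp (by fun_prop : Continuous fun q : (ℝ × E) × ℝ => (q.2, q.1.2))) continuous_fst

variable [CompleteSpace E] {F : ℝ → E → E} {F' : ℝ → E → E →L[ℝ] E} (hF : SmoothField F F')
include hF

/-- Differentiate the identity that flowing from `t` to `s` and back is the identity. -/
theorem SmoothField.dcurve_comp_dcurve (t s : ℝ) (z : E) :
    (hF.dcurve s (hF.curve t z s) t).comp (hF.dcurve t z s) = ContinuousLinearMap.id ℝ E := by
  have h1 : HasFDerivAt (fun z => hF.curve s (hF.curve t z s) t)
      ((hF.dcurve s (hF.curve t z s) t).comp (hF.dcurve t z s)) z :=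
    HasFDerivAt.comp (g := fun y => hF.curve s y t) z
      (hF.hasFDerivAt_curve s t (hF.curve t z s)) (hF.hasFDerivAt_curve t s z)
  have h2 : (fun z => hF.curve s (hF.curve t z s) t) = id := by
    ext z; rw [hF.curve_curve, hF.curve_self]; rfl
  rw [h2] at h1
  exact h1.unique (hasFDerivAt_id z)

theorem SmoothField.contDiff_curve (t : ℝ) :
    ContDiff ℝ 1 fun p : ℝ × E => hF.curve t p.2 p.1 := by
  refine contDiff_one_of_continuous_partials (f := fun s z => hF.curve t z s)
    (f₁ := fun s z => ContinuousLinearMap.toSpanSingleton ℝ (F s (hF.curve t z s)))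
    (f₂ := fun s z => hF.dcurve t z s)
    (fun s z => (hF.hasDerivAt_curve t z s).hasFDerivAt)
    (fun s z => hF.hasFDerivAt_curve t s z) ?_ (hF.continuous_dcurve t)
  exact (ContinuousLinearMap.toSpanSingletonCLE (𝕜 := ℝ) (E := E)).continuous.comp
    (hF.cont.comp (continuous_fst.prodMk (hF.continuous_curve t)))

/-- The map `(t, z) ↦ (t, Y(t, z))` that straightens the characteristics, `Y(·, z)` being the
curve with initial value `z` at time `s`. -/
noncomputable def SmoothField.straighten (s : ℝ) : ℝ × E ≃ ℝ × E where
  toFun p := (p.1, hF.curve s p.2 p.1)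
  invFun p := (p.1, hF.curve p.1 p.2 s)
  left_inv p := by simp only [hF.curve_curve, hF.curve_self]
  right_inv p := by simp only [hF.curve_curve, hF.curve_self]

/-- The derivative of `straighten`. -/
noncomputable def SmoothField.dstraighten (s : ℝ) (p : ℝ × E) : (ℝ × E) ≃L[ℝ] (ℝ × E) :=
  ContinuousLinearEquiv.equivOfInverse
    ((ContinuousLinearMap.fst ℝ ℝ E).prod
      ((ContinuousLinearMap.toSpanSingleton ℝ (F p.1 (hF.curve s p.2 p.1))).coprod
        (hF.dcurve s p.2 p.1)))
    ((ContinuousLinearMap.fst ℝ ℝ E).prod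
      ((hF.dcurve p.1 (hF.curve s p.2 p.1) s).comp
        (ContinuousLinearMap.snd ℝ ℝ E - (ContinuousLinearMap.toSpanSingleton ℝ
          (F p.1 (hF.curve s p.2 p.1))).comp (ContinuousLinearMap.fst ℝ ℝ E))))
    (fun q => by
      have := DFunLike.congr_fun (hF.dcurve_comp_dcurve s p.1 p.2) q.2
      simp only [ContinuousLinearMap.comp_apply, ContinuousLinearMap.id_apply] at this
      ext
      · simp
      · simp [this])
    (fun q => by
      have := hF.dcurve_comp_dcurve p.1 s (hF.curve s p.2 p.1)
      rw [hF.curve_curve, hF.curve_self] at this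
      have := DFunLike.congr_fun this (q.2 - q.1 • F p.1 (hF.curve s p.2 p.1))
      simp only [ContinuousLinearMap.comp_apply, ContinuousLinearMap.id_apply] at this
      ext
      · simp
      · simp only [ContinuousLinearMap.prod_apply, ContinuousLinearMap.coprod_apply,
          ContinuousLinearMap.comp_apply, sub_apply,
          ContinuousLinearMap.coe_fst', ContinuousLinearMap.coe_snd',
          ContinuousLinearMap.toSpanSingleton_apply, this, add_sub_cancel])

theorem SmoothField.hasStrictFDerivAt_straighten (s : ℝ) (p : ℝ × E) :
    HasStrictFDerivAt (hF.straighten s) (hF.dstraighten s p : ℝ × E →L[ℝ] ℝ × E) p :=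
  (hasStrictFDerivAt_fst (𝕜 := ℝ) (p := p)).prodMk (hF.hasStrictFDerivAt_curve s p)

/-- Smoothness in the base time comes from inversion: `(t, z) ↦ (t, curve t z s)` is the inverse of
the straightening map, a C¹ bijection with everywhere invertible derivative. -/
theorem SmoothField.contDiff_curve_base (s : ℝ) :
    ContDiff ℝ 1 fun p : ℝ × E => hF.curve p.1 p.2 s := by
  have hc : ContDiff ℝ 1 (hF.straighten s) := contDiff_fst.prodMk (hF.contDiff_curve s)
  let Ψ := (hF.straighten s).toHomeomorphOfContinuousOpen hc.continuous
    (isOpenMap_of_hasStrictFDerivAt_equiv (hF.hasStrictFDerivAt_straighten s))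
  have := Ψ.contDiff_symm (f₀' := hF.dstraighten s)
    (fun p => (hF.hasStrictFDerivAt_straighten s p).hasFDerivAt) hc
  exact contDiff_snd.comp this

/-- The solution `f₀(Z(0,t,z)) + ∫₀ᵗ S(s, Z(s,t,z)) ds` of the transport equation with initial
value `f₀` and right-hand side `S`. -/
noncomputable def SmoothField.duhamel (f₀ : E → ℝ) (S : ℝ → E → ℝ) (t : ℝ) (z : E) : ℝ :=
  f₀ (hF.curve t z 0) + ∫ s in (0 : ℝ)..t, S s (hF.curve t z s)

variable {f₀ : E → ℝ} {S : ℝ → E → ℝ} {S' : ℝ → E → E →L[ℝ] ℝ}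

/-- By the flow property `curve t z s = curve 0 (curve t z 0) s`. Thus only curves based at time `0`
appear under the integral, and the dependence on the base time sits in the C¹ map `(t, z) ↦ curve t
z 0`. -/
theorem SmoothField.contDiff_duhamel (hf₀ : ContDiff ℝ 1 f₀)
    (hd : ∀ s z, HasFDerivAt (S s) (S' s z) z) (hS : Continuous fun p : ℝ × E => S p.1 p.2)
    (hS' : Continuous fun p : ℝ × E => S' p.1 p.2) :
    ContDiff ℝ 1 fun p : ℝ × E => hF.duhamel f₀ S p.1 p.2 := by
  have hY : Continuous fun p : ℝ × E => (p.1, hF.curve 0 p.2 p.1) :=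
    continuous_fst.prodMk (hF.continuous_curve 0)
  have h1 : ContDiff ℝ 1 fun p : ℝ × E => ∫ s in (0 : ℝ)..p.1, S s (hF.curve 0 p.2 s) :=
    contDiff_intervalIntegral (g := fun s z => S s (hF.curve 0 z s))
      (g' := fun s z => (S' s (hF.curve 0 z s)).comp (hF.dcurve 0 z s))
      (fun s z => (hd s _).comp z (hF.hasFDerivAt_curve 0 s z)) (hS.comp hY)
      ((hS'.comp hY).clm_comp (hF.continuous_dcurve 0)) 0
  have h2 : ContDiff ℝ 1 fun p : ℝ × E => (p.1, hF.curve p.1 p.2 0) :=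
    contDiff_fst.prodMk (hF.contDiff_curve_base 0)
  have h3 := (hf₀.comp (hF.contDiff_curve_base 0)).add (h1.comp h2)
  convert h3 using 1
  ext p
  simp only [SmoothField.duhamel, Function.comp_apply, hF.curve_curve]

theorem SmoothField.duhamel_curve (t z s) :
    hF.duhamel f₀ S s (hF.curve t z s)
      = f₀ (hF.curve t z 0) + ∫ r in (0 : ℝ)..s, S r (hF.curve t z r) := by
  simp only [SmoothField.duhamel, hF.curve_curve]

/-- Along the characteristic through `(t, z)` the formula is a constant plus a primitive of the
source; the chain rule identifies its derivative with the one in direction `(1, F t z)`. -/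
theorem SmoothField.fderiv_duhamel (hf₀ : ContDiff ℝ 1 f₀)
    (hd : ∀ s z, HasFDerivAt (S s) (S' s z) z) (hS : Continuous fun p : ℝ × E => S p.1 p.2)
    (hS' : Continuous fun p : ℝ × E => S' p.1 p.2) (t : ℝ) (z : E) :
    fderiv ℝ (fun p : ℝ × E => hF.duhamel f₀ S p.1 p.2) (t, z) (1, F t z) = S t z := by
  have h1 : HasDerivAt (fun s => (s, hF.curve t z s)) ((1 : ℝ), F t z) t := by
    have := (hasDerivAt_id t).prodMk (hF.hasDerivAt_curve t z t)
    rwa [hF.curve_self] at this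
  have h2 : HasFDerivAt (fun p : ℝ × E => hF.duhamel f₀ S p.1 p.2)
      (fderiv ℝ (fun p : ℝ × E => hF.duhamel f₀ S p.1 p.2) (t, z)) (t, hF.curve t z t) := by
    rw [hF.curve_self]
    exact ((hF.contDiff_duhamel hf₀ hd hS hS').differentiable one_ne_zero _).hasFDerivAt
  have h3 := h2.comp_hasDerivAt t h1
  have hc : Continuous fun s => S s (hF.curve t z s) :=
    hS.comp (continuous_id.prodMk (hF.isIntegralCurve_curve t z).continuous)
  have h4 : HasDerivAt (fun s => hF.duhamel f₀ S s (hF.curve t z s)) (S t z) t := by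
    simp only [hF.duhamel_curve]
    have := intervalIntegral.integral_hasDerivAt_right (hc.intervalIntegrable 0 t)
      (hc.stronglyMeasurableAtFilter _ _) hc.continuousAt
    rw [hF.curve_self] at this
    exact this.const_add _
  exact h3.unique h4

/-- A classical solution of a transport equation satisfies Duhamel's formula. -/
theorem SmoothField.eq_duhamel {T : ℝ} (hT : 0 < T) {f : ℝ → E → ℝ}
    (hf : ContDiffOn ℝ 1 (fun p : ℝ × E => f p.1 p.2) (Icc 0 T ×ˢ univ))
    (hS : ∀ s ∈ Icc 0 T, ∀ z,
      fderivWithin ℝ (fun p : ℝ × E => f p.1 p.2) (Icc 0 T ×ˢ univ) (s, z) (1, F s z) = S s z)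
    {t : ℝ} (ht : t ∈ Icc 0 T) (z : E) : f t z = hF.duhamel (f 0) S t z := by
  have hU : UniqueDiffOn ℝ (Icc 0 T ×ˢ (univ : Set E)) :=
    (uniqueDiffOn_Icc hT).prod uniqueDiffOn_univ
  have hc : Continuous (hF.curve t z) := (hF.isIntegralCurve_curve t z).continuous
  have hmap : MapsTo (fun s => (s, hF.curve t z s)) (Icc 0 T) (Icc 0 T ×ˢ univ) :=
    fun s hs => ⟨hs, mem_univ _⟩
  have hder : ∀ s ∈ Icc 0 T, HasDerivWithinAt (fun s => f s (hF.curve t z s))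
      (S s (hF.curve t z s)) (Icc 0 T) s := by
    intro s hs
    have h1 : HasDerivWithinAt (fun s => (s, hF.curve t z s))
        ((1 : ℝ), F s (hF.curve t z s)) (Icc 0 T) s :=
      ((hasDerivAt_id s).prodMk (hF.hasDerivAt_curve t z s)).hasDerivWithinAt
    rw [← hS s hs]
    exact ((hf.differentiableOn one_ne_zero _ (hmap hs)).hasFDerivWithinAt).comp_hasDerivWithinAt
      (f := fun s => (s, hF.curve t z s)) s h1 hmap
  -- Continuity of `S` is not assumed; along the curve it is inherited from the derivative of `f`.
  have hint : ContinuousOn (fun s => S s (hF.curve t z s)) (Icc 0 T) := by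
    have h1 : ContinuousOn (fun s => fderivWithin ℝ (fun p : ℝ × E => f p.1 p.2)
        (Icc 0 T ×ˢ univ) (s, hF.curve t z s) (1, F s (hF.curve t z s))) (Icc 0 T) := by
      refine ContinuousOn.clm_apply ((hf.continuousOn_fderivWithin hU le_rfl).comp
        (continuous_id.prodMk hc).continuousOn hmap) ?_
      exact (continuous_const.prodMk (hF.cont.comp (continuous_id.prodMk hc))).continuousOn
    exact h1.congr fun s hs => (hS s hs _).symm
  have hsub : Icc 0 t ⊆ Icc 0 T := Icc_subset_Icc_right ht.2
  have key := intervalIntegral.integral_eq_sub_of_hasDerivAt_of_le (a := 0) (b := t)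
    (f := fun s => f s (hF.curve t z s)) (f' := fun s => S s (hF.curve t z s)) ht.1
    (fun s hs => ((hder s (hsub hs)).continuousWithinAt).mono hsub)
    (fun s hs => (hder s (hsub (Ioo_subset_Icc_self hs))).hasDerivAt
      (Icc_mem_nhds hs.1 (hs.2.trans_le ht.2)))
    ((hint.mono hsub).intervalIntegrable_of_Icc ht.1)
  rw [SmoothField.duhamel, key, hF.curve_self]
  ring

end Transport

/-! ### Phase space coordinates, partial gradients, and the vector product. -/

section Geometry

@[simp] theorem xpart_pt (x v : E3) : xpart (pt x v) = x := rfl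

@[simp] theorem vpart_pt (x v : E3) : vpart (pt x v) = v := rfl

@[simp] theorem pt_xpart_vpart (z : Phase) : pt (xpart z) (vpart z) = z := by
  ext i
  rcases i with i | i <;> rfl

theorem pt_add (x x' v v' : E3) : pt (x + x') (v + v') = pt x v + pt x' v' := by
  ext i
  rcases i with i | i <;> rfl

theorem pt_smul (c : ℝ) (x v : E3) : pt (c • x) (c • v) = c • pt x v := by
  ext i
  rcases i with i | i <;> rfl

theorem inner_phase (z w : Phase) :
    inner ℝ z w = inner ℝ (xpart z) (xpart w) + inner ℝ (vpart z) (vpart w) := by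
  simp only [PiLp.inner_apply, Fintype.sum_sum_type]
  rfl

theorem norm_sq_phase (z : Phase) : ‖z‖ ^ 2 = ‖xpart z‖ ^ 2 + ‖vpart z‖ ^ 2 := by
  simp only [← real_inner_self_eq_norm_sq, inner_phase]

theorem norm_xpart_le (z : Phase) : ‖xpart z‖ ≤ ‖z‖ := by
  nlinarith [norm_sq_phase z, norm_nonneg z, norm_nonneg (xpart z), sq_nonneg ‖vpart z‖]

theorem norm_vpart_le (z : Phase) : ‖vpart z‖ ≤ ‖z‖ := by
  nlinarith [norm_sq_phase z, norm_nonneg z, norm_nonneg (vpart z), sq_nonneg ‖xpart z‖]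

theorem norm_pt_le (x v : E3) : ‖pt x v‖ ≤ ‖x‖ + ‖v‖ := by
  have := norm_sq_phase (pt x v)
  rw [xpart_pt, vpart_pt] at this
  nlinarith [norm_nonneg x, norm_nonneg v, norm_nonneg (pt x v)]

/-- The position as a continuous linear map. -/
noncomputable def xL : Phase →L[ℝ] E3 :=
  LinearMap.mkContinuous ⟨⟨xpart, fun _ _ => rfl⟩, fun _ _ => rfl⟩ 1
    fun z => by rw [one_mul]; exact norm_xpart_le z

/-- The velocity as a continuous linear map. -/
noncomputable def vL : Phase →L[ℝ] E3 :=
  LinearMap.mkContinuous ⟨⟨vpart, fun _ _ => rfl⟩, fun _ _ => rfl⟩ 1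
    fun z => by rw [one_mul]; exact norm_vpart_le z

/-- The inclusion `x ↦ (x, 0)`. -/
noncomputable def inX : E3 →L[ℝ] Phase :=
  LinearMap.mkContinuous
    ⟨⟨fun x => pt x 0, fun x y => by rw [← pt_add, add_zero]⟩, fun c x => by
      simp [← pt_smul]⟩ 1
    fun x => by rw [one_mul]; simpa using norm_pt_le x 0

/-- The inclusion `v ↦ (0, v)`. -/
noncomputable def inV : E3 →L[ℝ] Phase :=
  LinearMap.mkContinuous
    ⟨⟨fun v => pt 0 v, fun x y => by rw [← pt_add, add_zero]⟩, fun c x => by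
      simp [← pt_smul]⟩ 1
    fun x => by rw [one_mul]; simpa using norm_pt_le 0 x

@[simp] theorem inX_apply (x : E3) : inX x = pt x 0 := rfl
@[simp] theorem inV_apply (v : E3) : inV v = pt 0 v := rfl

theorem norm_xL_le : ‖xL‖ ≤ 1 := LinearMap.mkContinuous_norm_le _ zero_le_one _
theorem norm_inX_le : ‖inX‖ ≤ 1 := LinearMap.mkContinuous_norm_le _ zero_le_one _
theorem norm_inV_le : ‖inV‖ ≤ 1 := LinearMap.mkContinuous_norm_le _ zero_le_one _

theorem pt_eq (x v : E3) : pt x v = inX x + inV v := by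
  rw [inX_apply, inV_apply, ← pt_add, add_zero, zero_add]

theorem continuous_xpart : Continuous xpart := xL.continuous
theorem continuous_vpart : Continuous vpart := vL.continuous

theorem continuous_pt : Continuous fun p : E3 × E3 => pt p.1 p.2 := by
  simp only [pt_eq]
  fun_prop

/-- The vector product as a continuous bilinear map. -/
noncomputable def crossL : E3 →L[ℝ] E3 →L[ℝ] E3 :=
  LinearMap.toContinuousLinearMap
    { toFun := fun v => LinearMap.toContinuousLinearMap
        { toFun := fun w => cross v w
          map_add' := fun w w' => by simp [cross]
          map_smul' := fun c w => by simp [cross] }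
      map_add' := fun v v' => by ext1 w; simp [cross]
      map_smul' := fun c v => by ext1 w; simp [cross] }

/-- The magnetic force does no work: this removes `B` from the growth estimate of the
characteristics. -/
theorem inner_cross_self (v w : E3) : inner ℝ v (cross v w) = 0 := by
  have := dot_self_cross v.ofLp w.ofLp
  rw [dotProduct_comm] at this
  simpa [cross, EuclideanSpace.inner_eq_star_dotProduct] using this

theorem inner_gradX {g : Phase → ℝ} {z : Phase} (hg : DifferentiableAt ℝ g z) (h : E3) :
    inner ℝ (gradX g z) h = fderiv ℝ g z (pt h 0) := by
  have h1 : HasFDerivAt (fun x => pt x (vpart z)) inX (xpart z) := by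
    simp only [pt_eq]
    exact inX.hasFDerivAt.add_const _
  have h2 : HasFDerivAt (fun x => g (pt x (vpart z))) ((fderiv ℝ g z).comp inX) (xpart z) := by
    refine HasFDerivAt.comp (xpart z) ?_ h1
    rw [pt_xpart_vpart]
    exact hg.hasFDerivAt
  rw [gradX, gradient, InnerProductSpace.toDual_symm_apply, h2.fderiv]
  rfl

theorem inner_gradV {g : Phase → ℝ} {z : Phase} (hg : DifferentiableAt ℝ g z) (h : E3) :
    inner ℝ (gradV g z) h = fderiv ℝ g z (pt 0 h) := by
  have h1 : HasFDerivAt (fun v => pt (xpart z) v) inV (vpart z) := by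
    simp only [pt_eq]
    exact inV.hasFDerivAt.const_add _
  have h2 : HasFDerivAt (fun v => g (pt (xpart z) v)) ((fderiv ℝ g z).comp inV) (vpart z) := by
    refine HasFDerivAt.comp (vpart z) ?_ h1
    rw [pt_xpart_vpart]
    exact hg.hasFDerivAt
  rw [gradV, gradient, InnerProductSpace.toDual_symm_apply, h2.fderiv]
  rfl

end Geometry

/-! ### The characteristic vector field is smooth and tame. -/

section Lorentz

/-- The vector field of the characteristic system. -/
noncomputable def lorentz (A B : ℝ → E3 → E3) (t : ℝ) (z : Phase) : Phase :=
  pt (vpart z) (A t (xpart z) + cross (vpart z) (B t (xpart z)))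

/-- The space derivative of `lorentz A B`. -/
noncomputable def dlorentz (A B : ℝ → E3 → E3) (t : ℝ) (z : Phase) : Phase →L[ℝ] Phase :=
  inX.comp vL + inV.comp ((fderiv ℝ (A t) (xpart z)).comp xL +
    ((crossL (vpart z)).comp ((fderiv ℝ (B t) (xpart z)).comp xL)
      + (crossL.flip (B t (xpart z))).comp vL))

/-- A time-dependent function, continuous together with its space derivative. -/
structure ContC1 {E F : Type*} [NormedAddCommGroup E] [NormedSpace ℝ E] [NormedAddCommGroup F]
    [NormedSpace ℝ F] (u : ℝ → E → F) : Prop where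
  differentiable : ∀ t, Differentiable ℝ (u t)
  cont : Continuous fun p : ℝ × E => u p.1 p.2
  cont' : Continuous fun p : ℝ × E => fderiv ℝ (u p.1) p.2

variable {A B : ℝ → E3 → E3} {M : ℝ}

theorem norm_lorentz_le (hA : ∀ t x, ‖A t x‖ ≤ M) (hB : ∀ t x, ‖B t x‖ ≤ M) (t : ℝ) (z : Phase) :
    ‖lorentz A B t z‖ ≤ (1 + M + ‖crossL‖ * M) * ‖z‖ + (1 + M + ‖crossL‖ * M) := by
  have hM : 0 ≤ M := (norm_nonneg _).trans (hA 0 0)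
  have h1 : ‖cross (vpart z) (B t (xpart z))‖ ≤ ‖crossL‖ * ‖z‖ * M :=
    (crossL.le_opNorm₂ _ _).trans (by gcongr; exacts [norm_vpart_le z, hB _ _])
  have h2 : ‖A t (xpart z) + cross (vpart z) (B t (xpart z))‖ ≤ M + ‖crossL‖ * ‖z‖ * M :=
    (norm_add_le _ _).trans (add_le_add (hA _ _) h1)
  have h3 := norm_pt_le (vpart z) (A t (xpart z) + cross (vpart z) (B t (xpart z)))
  have h4 : 0 ≤ ‖crossL‖ * M := mul_nonneg (norm_nonneg crossL) hM
  rw [lorentz]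
  nlinarith [norm_vpart_le z, norm_nonneg z, mul_nonneg hM (norm_nonneg z)]

theorem hasFDerivAt_lorentz (hA : ContC1 A) (hB : ContC1 B) (t : ℝ) (z : Phase) :
    HasFDerivAt (lorentz A B t) (dlorentz A B t z) z := by
  have hx : HasFDerivAt xpart xL z := xL.hasFDerivAt
  have hv : HasFDerivAt vpart vL z := vL.hasFDerivAt
  have h1 : HasFDerivAt (fun z => A t (xpart z)) ((fderiv ℝ (A t) (xpart z)).comp xL) z :=
    ((hA.differentiable t _).hasFDerivAt).comp z hx
  have h2 : HasFDerivAt (fun z => B t (xpart z)) ((fderiv ℝ (B t) (xpart z)).comp xL) z :=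
    ((hB.differentiable t _).hasFDerivAt).comp z hx
  have h3 := crossL.hasFDerivAt_of_bilinear hv h2
  have h4 := (inX.hasFDerivAt.comp z hv).add (inV.hasFDerivAt.comp z (h1.add h3))
  refine HasFDerivAt.congr_fderiv (h4.congr_of_eventuallyEq (Eventually.of_forall fun w => ?_)) ?_
  · simp only [lorentz, pt_eq (vpart w)]
    rfl
  · ext1 w
    simp [dlorentz, ContinuousLinearMap.precompR, ContinuousLinearMap.precompL]

theorem continuous_dlorentz (hA : ContC1 A) (hB : ContC1 B) :
    Continuous fun p : ℝ × Phase => dlorentz A B p.1 p.2 := by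
  have hx : Continuous fun p : ℝ × Phase => (p.1, xpart p.2) :=
    continuous_fst.prodMk (continuous_xpart.comp continuous_snd)
  have h1 := hA.cont'.comp hx
  have h2 := hB.cont'.comp hx
  have h3 : Continuous fun p : ℝ × Phase => crossL (vpart p.2) :=
    crossL.continuous.comp (continuous_vpart.comp continuous_snd)
  have h4 := crossL.flip.continuous.comp (hB.cont.comp hx)
  exact continuous_const.add (continuous_const.clm_comp ((h1.clm_comp continuous_const).add
    ((h3.clm_comp (h2.clm_comp continuous_const)).add (h4.clm_comp continuous_const))))

theorem norm_dlorentz_le (hA : ∀ t x, ‖fderiv ℝ (A t) x‖ ≤ M) (hB : ∀ t x, ‖B t x‖ ≤ M)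
    (hB' : ∀ t x, ‖fderiv ℝ (B t) x‖ ≤ M) (t : ℝ) (z : Phase) :
    ‖dlorentz A B t z‖ ≤ 1 + (M + (‖crossL‖ * ‖z‖ * M + ‖crossL‖ * M)) := by
  have hM : 0 ≤ M := (norm_nonneg _).trans (hB 0 0)
  refine ContinuousLinearMap.opNorm_le_bound _ (by positivity) fun h => ?_
  have e : dlorentz A B t z h = pt (vpart h) (fderiv ℝ (A t) (xpart z) (xpart h)
      + (crossL (vpart z) (fderiv ℝ (B t) (xpart z) (xpart h))
        + crossL (vpart h) (B t (xpart z)))) := by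
    rw [pt_eq]; rfl
  have b1 : ‖fderiv ℝ (A t) (xpart z) (xpart h)‖ ≤ M * ‖h‖ :=
    (ContinuousLinearMap.le_opNorm _ _).trans
      (mul_le_mul (hA _ _) (norm_xpart_le h) (norm_nonneg _) hM)
  have b2 : ‖fderiv ℝ (B t) (xpart z) (xpart h)‖ ≤ M * ‖h‖ :=
    (ContinuousLinearMap.le_opNorm _ _).trans
      (mul_le_mul (hB' _ _) (norm_xpart_le h) (norm_nonneg _) hM)
  have b3 : ‖crossL (vpart z) (fderiv ℝ (B t) (xpart z) (xpart h))‖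
      ≤ ‖crossL‖ * ‖z‖ * (M * ‖h‖) :=
    (crossL.le_opNorm₂ _ _).trans (by gcongr; exact norm_vpart_le z)
  have b4 : ‖crossL (vpart h) (B t (xpart z))‖ ≤ ‖crossL‖ * ‖h‖ * M :=
    (crossL.le_opNorm₂ _ _).trans (by gcongr; exacts [norm_vpart_le h, hB _ _])
  rw [e]
  calc _ ≤ ‖h‖ + (M * ‖h‖ + (‖crossL‖ * ‖z‖ * (M * ‖h‖) + ‖crossL‖ * ‖h‖ * M)) :=
        (norm_pt_le _ _).trans (add_le_add (norm_vpart_le h) ((norm_add_le _ _).trans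
          (add_le_add b1 ((norm_add_le _ _).trans (add_le_add b3 b4)))))
    _ = _ := by ring

theorem lipschitzOnWith_lorentz (hA : ContC1 A) (hB : ContC1 B)
    (hA' : ∀ t x, ‖fderiv ℝ (A t) x‖ ≤ M) (hBM : ∀ t x, ‖B t x‖ ≤ M)
    (hB' : ∀ t x, ‖fderiv ℝ (B t) x‖ ≤ M) (t R : ℝ) :
    LipschitzOnWith (1 + (M + (‖crossL‖ * R * M + ‖crossL‖ * M))).toNNReal (lorentz A B t)
      (Metric.closedBall 0 R) := by
  have hM : 0 ≤ M := (norm_nonneg _).trans (hBM 0 0)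
  refine (convex_closedBall _ _).lipschitzOnWith_of_nnnorm_hasFDerivWithin_le
    (fun z _ => (hasFDerivAt_lorentz hA hB t z).hasFDerivWithinAt) fun z hz => ?_
  rw [← NNReal.coe_le_coe, coe_nnnorm]
  refine (norm_dlorentz_le hA' hBM hB' t z).trans (le_trans ?_ (Real.le_coe_toNNReal _))
  gcongr
  simpa using hz

theorem smoothField_lorentz (hA : ContC1 A) (hB : ContC1 B) (hAM : ∀ t x, ‖A t x‖ ≤ M)
    (hA' : ∀ t x, ‖fderiv ℝ (A t) x‖ ≤ M) (hBM : ∀ t x, ‖B t x‖ ≤ M)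
    (hB' : ∀ t x, ‖fderiv ℝ (B t) x‖ ≤ M) : SmoothField (lorentz A B) (dlorentz A B) where
  cont := by
    have hx : Continuous fun p : ℝ × Phase => (p.1, xpart p.2) :=
      continuous_fst.prodMk (continuous_xpart.comp continuous_snd)
    have hv : Continuous fun p : ℝ × Phase => vpart p.2 := continuous_vpart.comp continuous_snd
    exact continuous_pt.comp (hv.prodMk ((hA.cont.comp hx).add
      ((crossL.continuous.comp hv).clm_apply (hB.cont.comp hx))))
  lip _ R := ⟨_, fun t _ => lipschitzOnWith_lorentz hA hB hA' hBM hB' t R⟩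
  growth _ := ⟨1 + M + ‖crossL‖ * M,
    by have := (norm_nonneg _).trans (hAM 0 0); positivity,
    fun t _ z => norm_lorentz_le hAM hBM t z⟩
  hasFDerivAt := hasFDerivAt_lorentz hA hB
  cont' := continuous_dlorentz hA hB

end Lorentz

/-! ### The Coulomb kernel and the gradient of the Newtonian potential. -/

section Kernel

/-- The kernel `x / |x|³`. -/
noncomputable def coulomb (x : E3) : E3 := (‖x‖ ^ 3)⁻¹ • x

theorem norm_coulomb (x : E3) : ‖coulomb x‖ = (‖x‖ ^ 2)⁻¹ := by
  rw [coulomb, norm_smul, norm_inv, norm_pow, norm_norm]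
  rcases eq_or_ne ‖x‖ 0 with h | h
  · simp [h]
  · field_simp

theorem measurable_coulomb : Measurable coulomb := by
  unfold coulomb; fun_prop

/-- Polar coordinates in dimension three, with weight `y ^ 2`; it covers both `1/|x|` and `x/|x|³`.
-/
theorem locallyIntegrable_of_radial {F : Type*} [NormedAddCommGroup F] {k : E3 → F} {f : ℝ → ℝ}
    (hm : AEStronglyMeasurable k volume) (hk : ∀ x, ‖k x‖ = f ‖x‖)
    (hf : ∀ r, IntegrableOn (fun y => y ^ 2 • f y) (Ioo 0 r)) : LocallyIntegrable k := by
  refine (locallyIntegrable_iff).2 fun S hS => ?_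
  obtain ⟨r, hr⟩ := hS.isBounded.subset_ball 0
  refine IntegrableOn.mono_set ?_ hr
  have h1 := (integrableOn_fun_norm_addHaar (E := E3) volume (f := f) (r := r)).2
    (by simpa using hf r)
  refine (integrable_norm_iff hm.restrict).1 ?_
  simp only [hk]
  exact h1

theorem locallyIntegrable_coulomb : LocallyIntegrable coulomb := by
  refine locallyIntegrable_of_radial (f := fun r => (r ^ 2)⁻¹)
    measurable_coulomb.aestronglyMeasurable norm_coulomb fun r => ?_
  have : IntegrableOn (fun _ : ℝ => (1 : ℝ)) (Ioo 0 r) := by simp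
  refine this.congr_fun (fun y hy => ?_) measurableSet_Ioo
  have := hy.1.ne'
  simp only [smul_eq_mul]; field_simp

theorem locallyIntegrable_norm_coulomb : LocallyIntegrable fun x => ‖coulomb x‖ :=
  locallyIntegrable_iff.2 fun _ hS =>
    Integrable.norm (locallyIntegrable_coulomb.integrableOn_isCompact hS)

theorem locallyIntegrable_inv_norm : LocallyIntegrable fun x : E3 => ‖x‖⁻¹ := by
  refine locallyIntegrable_of_radial (f := fun r => r⁻¹) (by fun_prop) (by simp) fun r => ?_
  have : IntegrableOn (fun y : ℝ => y) (Ioo 0 r) :=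
    (continuous_id.continuousOn.integrableOn_Icc (a := 0) (b := r)).mono_set Ioo_subset_Icc_self
  refine this.congr_fun (fun y hy => ?_) measurableSet_Ioo
  have := hy.1.ne'
  simp only [smul_eq_mul]; field_simp

open scoped Convolution

/-- Convolutions with the kernel `x / |x|³` are bounded by the supremum of the density. -/
theorem norm_coulomb_convolution_le (R : ℝ) : ∃ κ : ℝ, 0 ≤ κ ∧
    ∀ {V W : Type} [NormedAddCommGroup V] [NormedSpace ℝ V] [NormedAddCommGroup W]
      [NormedSpace ℝ W] (L : E3 →L[ℝ] V →L[ℝ] W) (g : E3 → V) (m : ℝ), (∀ x, ‖g x‖ ≤ m) →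
      (∀ x, R < ‖x‖ → g x = 0) → ∀ x, ‖(coulomb ⋆[L, volume] g) x‖ ≤ ‖L‖ * κ * m := by
  have hI1 : Integrable ((Metric.closedBall (0 : E3) 1).indicator fun u => ‖coulomb u‖) :=
    IntegrableOn.integrable_indicator
      (locallyIntegrable_coulomb.integrableOn_isCompact (isCompact_closedBall 0 1)).norm
      Metric.isClosed_closedBall.measurableSet
  have hI2 : ∀ x : E3, Integrable ((Metric.closedBall x R).indicator fun _ => (1 : ℝ)) := fun x =>
    (integrableOn_const (isCompact_closedBall x R).measure_ne_top).integrable_indicator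
      Metric.isClosed_closedBall.measurableSet
  -- Inside the unit ball the kernel is integrable. Outside it the kernel is at most 1, and `g (x -
  -- u)` lives on the ball of radius `R` around `x`.
  refine ⟨(∫ u, (Metric.closedBall (0 : E3) 1).indicator (fun u => ‖coulomb u‖) u)
    + ∫ u, (Metric.closedBall (0 : E3) R).indicator (fun _ => (1 : ℝ)) u,
    add_nonneg (integral_nonneg fun u => indicator_nonneg (fun _ _ => norm_nonneg _) u)
      (integral_nonneg fun u => indicator_nonneg (fun _ _ => zero_le_one) u), ?_⟩
  intro V W _ _ _ _ L g m hg hs x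
  have hm : 0 ≤ m := (norm_nonneg _).trans (hg 0)
  -- Translation invariance makes the constant independent of `x`.
  have e : ∫ u, (Metric.closedBall (0 : E3) R).indicator (fun _ => (1 : ℝ)) u
      = ∫ u, (Metric.closedBall x R).indicator (fun _ => (1 : ℝ)) u := by
    rw [← integral_sub_left_eq_self _ volume x]
    refine integral_congr_ae (Eventually.of_forall fun u => ?_)
    simp [indicator, norm_sub_rev, dist_eq_norm]
  rw [e, ← integral_add hI1 (hI2 x), mul_assoc, mul_comm _ m, ← mul_assoc, ← integral_const_mul]
  refine norm_integral_le_of_norm_le ((hI1.add (hI2 x)).const_mul _)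
    (Eventually.of_forall fun u => ?_)
  by_cases hu : u ∈ Metric.closedBall x R
  · have h1 : ‖L (coulomb u) (g (x - u))‖ ≤ ‖L‖ * ‖coulomb u‖ * m :=
      (L.le_opNorm₂ _ _).trans (by gcongr; exact hg _)
    refine h1.trans ?_
    rw [indicator_of_mem hu, mul_right_comm]
    refine mul_le_mul_of_nonneg_left ?_ (mul_nonneg (norm_nonneg L) hm)
    by_cases hu1 : u ∈ Metric.closedBall (0 : E3) 1
    · rw [indicator_of_mem hu1]; linarith
    · rw [indicator_of_notMem hu1, zero_add, norm_coulomb]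
      rw [mem_closedBall_zero_iff, not_le] at hu1
      exact inv_le_one_of_one_le₀ (one_le_pow₀ hu1.le)
  · rw [Metric.mem_closedBall, not_le, dist_comm, dist_eq_norm] at hu
    rw [hs _ hu, map_zero, norm_zero]
    exact mul_nonneg (mul_nonneg (norm_nonneg L) hm)
      (add_nonneg (indicator_nonneg (fun _ _ => norm_nonneg _) _)
        (indicator_nonneg (fun _ _ => zero_le_one) _))

theorem hasFDerivAt_inv_sqrt_norm_sq_add {δ : ℝ} (hδ : 0 < δ) (u : E3) :
    HasFDerivAt (fun u : E3 => (√(‖u‖ ^ 2 + δ))⁻¹)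
      (-((√(‖u‖ ^ 2 + δ)) ^ 3)⁻¹ • innerSL ℝ u) u := by
  have hpos : 0 < ‖u‖ ^ 2 + δ := by positivity
  have hs : 0 < √(‖u‖ ^ 2 + δ) := Real.sqrt_pos.2 hpos
  have h1 : HasFDerivAt (fun u : E3 => ‖u‖ ^ 2 + δ) (2 • innerSL ℝ u) u :=
    ((hasStrictFDerivAt_norm_sq u).hasFDerivAt).add_const δ
  have h2 : HasDerivAt (fun t : ℝ => (√t)⁻¹)
      (-(1 / (2 * √(‖u‖ ^ 2 + δ))) / √(‖u‖ ^ 2 + δ) ^ 2) (‖u‖ ^ 2 + δ) :=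
    (Real.hasDerivAt_sqrt hpos.ne').fun_inv hs.ne'
  refine (h2.comp_hasFDerivAt u h1).congr_fderiv ?_
  ext e
  simp only [smul_apply, smul_eq_mul, nsmul_eq_mul, Nat.cast_ofNat]
  field_simp

/-- Integration by parts is legitimate for the smooth kernel `(|u|² + δ)^(-1/2)`. Both sides are
dominated by their integrable singular counterparts, up to the factor `‖e‖` on the right, so `δ → 0`
may be taken under the integrals. -/
theorem integral_inv_norm_mul_fderiv {ρ : E3 → ℝ} (hρ : ContDiff ℝ 1 ρ)
    (hc : HasCompactSupport ρ) (x e : E3) :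
    ∫ u : E3, ‖u‖⁻¹ * fderiv ℝ ρ (x - u) e = -∫ u, inner ℝ (coulomb u) e * ρ (x - u) := by
  have hρ' : Continuous fun y => fderiv ℝ ρ y e :=
    (hρ.continuous_fderiv one_ne_zero).clm_apply continuous_const
  have hc' : HasCompactSupport fun y => fderiv ℝ ρ y e :=
    (hc.fderiv ℝ).comp_left (g := fun L : E3 →L[ℝ] ℝ => L e) rfl
  have hsub : Continuous fun u : E3 => x - u := by fun_prop
  have hcomp : ∀ {g : E3 → ℝ}, HasCompactSupport g → HasCompactSupport fun u => g (x - u) :=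
    fun h => h.comp_homeomorph (Homeomorph.subLeft x)
  have hI1 : Integrable fun u : E3 => ‖u‖⁻¹ * fderiv ℝ ρ (x - u) e :=
    (hc'.convolutionExists_right (ContinuousLinearMap.mul ℝ ℝ) locallyIntegrable_inv_norm hρ' x)
  have hI2 : Integrable fun u : E3 => ‖coulomb u‖ * ρ (x - u) :=
    (hc.convolutionExists_right (ContinuousLinearMap.mul ℝ ℝ)
      locallyIntegrable_norm_coulomb hρ.continuous x)
  set δ : ℕ → ℝ := fun n => 1 / ((n : ℝ) + 1) with hδdef
  have hδ : ∀ n, 0 < δ n := fun n => Nat.one_div_pos_of_nat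
  have hδlim : Tendsto δ atTop (𝓝 0) := tendsto_one_div_add_atTop_nhds_zero_nat
  have hs : ∀ n (u : E3), 0 < √(‖u‖ ^ 2 + δ n) := fun n u =>
    Real.sqrt_pos.2 (by have := hδ n; positivity)
  have hsle : ∀ n (u : E3), ‖u‖ ≤ √(‖u‖ ^ 2 + δ n) := fun n u =>
    Real.le_sqrt_of_sq_le (by linarith [hδ n])
  have hcs : ∀ n, Continuous fun u : E3 => √(‖u‖ ^ 2 + δ n) := fun n => by fun_prop
  have hslim : ∀ u : E3, Tendsto (fun n => √(‖u‖ ^ 2 + δ n)) atTop (𝓝 ‖u‖) := by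
    intro u
    have := ((Real.continuous_sqrt.tendsto _).comp (hδlim.const_add (‖u‖ ^ 2)))
    simpa [Function.comp_def, Real.sqrt_sq (norm_nonneg u)] using this
  have hibp : ∀ n, ∫ u : E3, (√(‖u‖ ^ 2 + δ n))⁻¹ * fderiv ℝ ρ (x - u) e
      = -∫ u : E3, ((√(‖u‖ ^ 2 + δ n)) ^ 3)⁻¹ * inner ℝ u e * ρ (x - u) := by
    intro n
    have hd : ∀ u : E3, HasFDerivAt (fun u => ρ (x - u)) (-fderiv ℝ ρ (x - u)) u := by
      intro u
      have h1 : HasFDerivAt (fun u : E3 => x - u) (-ContinuousLinearMap.id ℝ E3) u :=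
        (hasFDerivAt_id u).const_sub x
      have h2 := ((hρ.differentiable one_ne_zero (x - u)).hasFDerivAt).comp u h1
      refine h2.congr_fderiv ?_
      ext; simp
    have hk : ∀ u : E3, HasFDerivAt (fun u : E3 => (√(‖u‖ ^ 2 + δ n))⁻¹) _ u :=
      hasFDerivAt_inv_sqrt_norm_sq_add (hδ n)
    have hkc : Continuous fun u : E3 => (√(‖u‖ ^ 2 + δ n))⁻¹ :=
      (hcs n).inv₀ fun u => (hs n u).ne'
    have key := integral_bilinear_hasFDerivAt_right_eq_neg_left_of_integrable (v := e)
      (μ := (volume : Measure E3)) (B := ContinuousLinearMap.mul ℝ ℝ)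
      (f := fun u : E3 => (√(‖u‖ ^ 2 + δ n))⁻¹) (g := fun u => ρ (x - u))
      (f' := fun u => -((√(‖u‖ ^ 2 + δ n)) ^ 3)⁻¹ • innerSL ℝ u)
      (g' := fun u => -fderiv ℝ ρ (x - u)) ?_ ?_ ?_ (fun u _ => hk u) (fun u _ => hd u)
    · simp only [ContinuousLinearMap.mul_apply', smul_apply, smul_eq_mul,
        innerSL_apply_apply, neg_apply, mul_neg, neg_mul, integral_neg] at key
      rw [← neg_eq_iff_eq_neg.2 key]
      simp
    · refine Continuous.integrable_of_hasCompactSupport ?_ ((hcomp hc).mul_left)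
      have : Continuous fun u : E3 => ((√(‖u‖ ^ 2 + δ n)) ^ 3)⁻¹ :=
        ((hcs n).pow 3).inv₀ fun u => (pow_pos (hs n u) 3).ne'
      simp only [ContinuousLinearMap.mul_apply', smul_apply, smul_eq_mul,
        innerSL_apply_apply]
      exact (this.neg.mul (by fun_prop)).mul (hρ.continuous.comp hsub)
    · refine Continuous.integrable_of_hasCompactSupport ?_ (((hcomp hc').neg).mul_left)
      exact hkc.mul (hρ'.comp hsub).neg
    · exact Continuous.integrable_of_hasCompactSupport (hkc.mul (hρ.continuous.comp hsub))
        ((hcomp hc).mul_left)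
  have hne : ∀ᵐ u : E3, u ≠ 0 := by
    simp [ae_iff, measure_singleton]
  have lim1 : Tendsto (fun n => ∫ u : E3, (√(‖u‖ ^ 2 + δ n))⁻¹ * fderiv ℝ ρ (x - u) e) atTop
      (𝓝 (∫ u : E3, ‖u‖⁻¹ * fderiv ℝ ρ (x - u) e)) := by
    refine tendsto_integral_of_dominated_convergence _ (fun n => ?_) hI1.norm (fun n => ?_) ?_
    · exact (((hcs n).inv₀ fun u => (hs n u).ne').mul (hρ'.comp hsub)).aestronglyMeasurable
    · filter_upwards [hne] with u hu
      rw [norm_mul, norm_mul, norm_inv, norm_inv, norm_norm, Real.norm_of_nonneg (hs n u).le]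
      have := norm_pos_iff.2 hu
      gcongr
      exact hsle n u
    · filter_upwards [hne] with u hu
      exact ((hslim u).inv₀ (norm_ne_zero_iff.2 hu)).mul_const _
  have lim2 : Tendsto (fun n => ∫ u : E3, ((√(‖u‖ ^ 2 + δ n)) ^ 3)⁻¹ * inner ℝ u e * ρ (x - u))
      atTop (𝓝 (∫ u, inner ℝ (coulomb u) e * ρ (x - u))) := by
    refine tendsto_integral_of_dominated_convergence
      (fun u => ‖e‖ * ‖‖coulomb u‖ * ρ (x - u)‖) (fun n => ?_) (hI2.norm.const_mul _)
      (fun n => ?_) ?_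
    · exact (((((hcs n).pow 3).inv₀ fun u => (pow_pos (hs n u) 3).ne').mul
        (by fun_prop)).mul (hρ.continuous.comp hsub)).aestronglyMeasurable
    · filter_upwards [hne] with u hu
      have hu0 := norm_pos_iff.2 hu
      rw [norm_mul, norm_mul, norm_mul, norm_norm, norm_inv, norm_pow,
        Real.norm_of_nonneg (hs n u).le, norm_coulomb]
      calc _ ≤ (‖u‖ ^ 3)⁻¹ * (‖u‖ * ‖e‖) * ‖ρ (x - u)‖ := by
            gcongr
            · exact hsle n u
            · exact norm_inner_le_norm u e
        _ = _ := by field_simp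
    · filter_upwards [hne] with u hu
      have h1 := ((hslim u).pow 3).inv₀ (pow_ne_zero 3 (norm_ne_zero_iff.2 hu))
      have h2 := (h1.mul_const (inner ℝ u e)).mul_const (ρ (x - u))
      rwa [coulomb, real_inner_smul_left]
  exact tendsto_nhds_unique lim1 ((lim2.neg).congr fun n => (hibp n).symm)

/-- Differentiating the convolution with `1/|x|` puts the derivative on `ρ`; integration by parts
then moves it back to the kernel. -/
theorem gradient_potential {ρ : E3 → ℝ} (hρ : ContDiff ℝ 1 ρ) (hc : HasCompactSupport ρ) (x : E3) :
    gradient (fun x => ∫ y, ρ y / ‖x - y‖) x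
      = -(coulomb ⋆[(ContinuousLinearMap.lsmul ℝ ℝ : ℝ →L[ℝ] E3 →L[ℝ] E3).flip, volume] ρ) x := by
  have e1 : (fun x => ∫ y, ρ y / ‖x - y‖)
      = (fun u : E3 => ‖u‖⁻¹) ⋆[ContinuousLinearMap.mul ℝ ℝ, volume] ρ := by
    ext x
    rw [convolution_def, ← integral_sub_left_eq_self _ volume x]
    refine integral_congr_ae (Eventually.of_forall fun u => ?_)
    simp [div_eq_mul_inv, mul_comm]
  have h1 := hc.hasFDerivAt_convolution_right (ContinuousLinearMap.mul ℝ ℝ)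
    locallyIntegrable_inv_norm hρ x
  have hI : Integrable fun u : E3 => ρ (x - u) • coulomb u :=
    hc.convolutionExists_right (ContinuousLinearMap.lsmul ℝ ℝ : ℝ →L[ℝ] E3 →L[ℝ] E3).flip
      locallyIntegrable_coulomb hρ.continuous x
  refine ext_inner_right ℝ fun e => ?_
  rw [gradient, InnerProductSpace.toDual_symm_apply, e1, h1.fderiv,
    convolution_precompR_apply _ locallyIntegrable_inv_norm (hc.fderiv ℝ)
      (hρ.continuous_fderiv one_ne_zero), convolution_def]
  simp only [ContinuousLinearMap.mul_apply']
  rw [integral_inv_norm_mul_fderiv hρ hc, inner_neg_left, convolution_def, real_inner_comm]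
  simp only [ContinuousLinearMap.flip_apply, ContinuousLinearMap.lsmul_apply]
  rw [← integral_inner hI]
  congr 1
  refine integral_congr_ae (Eventually.of_forall fun u => ?_)
  simp only [real_inner_smul_right, real_inner_comm]
  ring

end Kernel

/-! ### Velocity averages and their regularity in position. -/

section Averages

open scoped Convolution

theorem fderiv_eq_zero_of_lt_norm {E F : Type*} [NormedAddCommGroup E] [NormedSpace ℝ E]
    [NormedAddCommGroup F] [NormedSpace ℝ F] {g : E → F} {R : ℝ}
    (hg : ∀ z, R < ‖z‖ → g z = 0) {z : E} (hz : R < ‖z‖) : fderiv ℝ g z = 0 := by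
  have : g =ᶠ[𝓝 z] fun _ => 0 := by
    filter_upwards [(continuous_norm.tendsto z).eventually (lt_mem_nhds hz)] with y hy using hg y hy
  rw [this.fderiv_eq, fderiv_fun_const]; rfl

theorem hasCompactSupport_of_lt_norm {E F : Type*} [NormedAddCommGroup E] [ProperSpace E]
    [Zero F] {g : E → F} {R : ℝ} (hg : ∀ z, R < ‖z‖ → g z = 0) : HasCompactSupport g :=
  HasCompactSupport.intro (isCompact_closedBall 0 R) fun z hz =>
    hg z (by simpa using hz)

theorem ContC1.contDiff {E F : Type*} [NormedAddCommGroup E] [NormedSpace ℝ E]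
    [NormedAddCommGroup F] [NormedSpace ℝ F] {u : ℝ → E → F} (h : ContC1 u) (t : ℝ) :
    ContDiff ℝ 1 (u t) :=
  contDiff_one_iff_fderiv.2 ⟨h.differentiable t,
    h.cont'.comp (by fun_prop : Continuous fun x : E => (t, x))⟩

theorem contC1_of_hasFDerivAt {E F : Type*} [NormedAddCommGroup E] [NormedSpace ℝ E]
    [NormedAddCommGroup F] [NormedSpace ℝ F] {u : ℝ → E → F} {u' : ℝ → E → E →L[ℝ] F}
    (hd : ∀ t x, HasFDerivAt (u t) (u' t x) x) (hc : Continuous fun p : ℝ × E => u p.1 p.2)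
    (hc' : Continuous fun p : ℝ × E => u' p.1 p.2) : ContC1 u where
  differentiable t x := (hd t x).differentiableAt
  cont := hc
  cont' := by simpa only [(hd _ _).fderiv] using hc'

/-- Convolution with `x / |x|³` preserves regularity. -/
theorem hasFDerivAt_coulomb_convolution {V W : Type} [NormedAddCommGroup V] [NormedSpace ℝ V]
    [NormedAddCommGroup W] [NormedSpace ℝ W] (L : E3 →L[ℝ] V →L[ℝ] W) {g : ℝ → E3 → V} {R : ℝ}
    (hg : ContC1 g) (hs : ∀ t x, R < ‖x‖ → g t x = 0) (t : ℝ) (x : E3) :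
    HasFDerivAt (coulomb ⋆[L, volume] g t)
      ((coulomb ⋆[L.precompR E3, volume] fderiv ℝ (g t)) x) x :=
  (hasCompactSupport_of_lt_norm (hs t)).hasFDerivAt_convolution_right L
    locallyIntegrable_coulomb (hg.contDiff t) x

/-- All derivatives fall on `g`, so local integrability of the kernel suffices. The common support
ball gives continuity in time and space jointly. -/
theorem contC1_coulomb_convolution {V W : Type} [NormedAddCommGroup V] [NormedSpace ℝ V]
    [NormedAddCommGroup W] [NormedSpace ℝ W] (L : E3 →L[ℝ] V →L[ℝ] W) {g : ℝ → E3 → V} {R : ℝ}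
    (hg : ContC1 g) (hs : ∀ t x, R < ‖x‖ → g t x = 0) :
    ContC1 fun t => coulomb ⋆[L, volume] g t := by
  refine contC1_of_hasFDerivAt (hasFDerivAt_coulomb_convolution L hg hs) ?_ ?_
  · have := continuousOn_convolution_right_with_param (s := univ) L
      (isCompact_closedBall (0 : E3) R) (fun t x _ hx => hs t x (by simpa using hx))
      locallyIntegrable_coulomb hg.cont.continuousOn
    simpa only [univ_prod_univ, continuousOn_univ] using this
  · have := continuousOn_convolution_right_with_param (s := univ) (L.precompR E3)
      (g := fun t x => fderiv ℝ (g t) x)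
      (isCompact_closedBall (0 : E3) R)
      (fun t x _ hx => fderiv_eq_zero_of_lt_norm (hs t) (by simpa using hx))
      locallyIntegrable_coulomb hg.cont'.continuousOn
    simpa only [univ_prod_univ, continuousOn_univ] using this

theorem lt_norm_pt_left {R : ℝ} {x : E3} (v : E3) (h : R < ‖x‖) :
    R < ‖pt x v‖ :=
  h.trans_le (norm_xpart_le (pt x v))

theorem lt_norm_pt_right {R : ℝ} (x : E3) {v : E3} (h : R < ‖v‖) : R < ‖pt x v‖ :=
  h.trans_le (norm_vpart_le (pt x v))

theorem norm_integral_le_of_lt_norm {V : Type*} [NormedAddCommGroup V] [NormedSpace ℝ V]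
    {h : E3 → V} {R b : ℝ} (hb : ∀ w, ‖h w‖ ≤ b) (hs : ∀ w, R < ‖w‖ → h w = 0) :
    ‖∫ w, h w‖ ≤ volume.real (Metric.closedBall (0 : E3) R) * b := by
  have hI : Integrable ((Metric.closedBall (0 : E3) R).indicator fun _ => b) :=
    IntegrableOn.integrable_indicator
      (integrableOn_const (isCompact_closedBall _ R).measure_ne_top)
      Metric.isClosed_closedBall.measurableSet
  refine (norm_integral_le_of_norm_le hI (Eventually.of_forall fun w => ?_)).trans_eq ?_
  · by_cases hw : w ∈ Metric.closedBall (0 : E3) R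
    · rw [indicator_of_mem hw]; exact hb w
    · rw [indicator_of_notMem hw, hs w (by simpa using hw), norm_zero]
  · rw [integral_indicator_const _ Metric.isClosed_closedBall.measurableSet, smul_eq_mul]

theorem continuous_integral_pt {V : Type*} [NormedAddCommGroup V] [NormedSpace ℝ V]
    {h : ℝ → Phase → V} {R : ℝ} (hc : Continuous fun p : ℝ × Phase => h p.1 p.2)
    (hs : ∀ t z, R < ‖z‖ → h t z = 0) :
    Continuous fun p : ℝ × E3 => ∫ v, h p.1 (pt p.2 v) := by
  have := continuousOn_integral_of_compact_support (μ := (volume : Measure E3)) (s := univ)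
    (f := fun (p : ℝ × E3) v => h p.1 (pt p.2 v)) (isCompact_closedBall (0 : E3) R) ?_
    (fun _ _ _ hv => hs _ _ (lt_norm_pt_right _ (by simpa using hv)))
  · simpa only [continuousOn_univ] using this
  · refine Continuous.continuousOn (hc.comp (continuous_fst.fst.prodMk ?_))
    exact continuous_pt.comp (continuous_fst.snd.prodMk continuous_snd)

theorem continuous_slice {V : Type*} [TopologicalSpace V] {h : Phase → V} (hc : Continuous h)
    (x : E3) : Continuous fun v => h (pt x v) :=
  hc.comp (continuous_pt.comp (by fun_prop : Continuous fun v : E3 => (x, v)))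

theorem integrable_slice {V : Type*} [NormedAddCommGroup V] {h : Phase → V} {R : ℝ}
    (hc : Continuous h) (hs : ∀ z, R < ‖z‖ → h z = 0) (x : E3) :
    Integrable fun v => h (pt x v) :=
  (continuous_slice hc x).integrable_of_hasCompactSupport
    (hasCompactSupport_of_lt_norm fun _ hv => hs _ (lt_norm_pt_right x hv))

theorem hasFDerivAt_slice {V : Type*} [NormedAddCommGroup V] [NormedSpace ℝ V] {g : Phase → V}
    (hg : Differentiable ℝ g) (x v : E3) :
    HasFDerivAt (fun x => g (pt x v)) ((fderiv ℝ g (pt x v)).comp inX) x := by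
  have h1 : HasFDerivAt (fun x => pt x v) inX x := by
    simp only [pt_eq]
    exact inX.hasFDerivAt.add_const _
  exact (hg _).hasFDerivAt.comp x h1

theorem norm_comp_inX_le {V : Type*} [NormedAddCommGroup V] [NormedSpace ℝ V]
    (l : Phase →L[ℝ] V) : ‖l.comp inX‖ ≤ ‖l‖ :=
  (ContinuousLinearMap.opNorm_comp_le _ _).trans
    (mul_le_of_le_one_right (norm_nonneg _) norm_inX_le)

theorem hasFDerivAt_integral_slice {g : Phase → ℝ} {R m : ℝ} (hg : ContDiff ℝ 1 g)
    (hs : ∀ z, R < ‖z‖ → g z = 0) (hm : ∀ z, ‖fderiv ℝ g z‖ ≤ m) (x : E3) :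
    HasFDerivAt (fun x => ∫ v, g (pt x v)) (∫ v, (fderiv ℝ g (pt x v)).comp inX) x := by
  have hI : Integrable ((Metric.closedBall (0 : E3) R).indicator fun _ => m) :=
    IntegrableOn.integrable_indicator
      (integrableOn_const (isCompact_closedBall _ R).measure_ne_top)
      Metric.isClosed_closedBall.measurableSet
  refine hasFDerivAt_integral_of_dominated_of_fderiv_le (s := univ)
    (F' := fun x v => (fderiv ℝ g (pt x v)).comp inX) univ_mem
    (Eventually.of_forall fun y => (continuous_slice hg.continuous y).aestronglyMeasurable)
    (integrable_slice hg.continuous hs x)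
    ((continuous_slice (hg.continuous_fderiv one_ne_zero) x).clm_comp
      continuous_const).aestronglyMeasurable
    (Eventually.of_forall fun v y _ => ?_) hI
    (Eventually.of_forall fun v y _ => hasFDerivAt_slice (hg.differentiable one_ne_zero) y v)
  by_cases hv : v ∈ Metric.closedBall (0 : E3) R
  · rw [indicator_of_mem hv]
    exact (norm_comp_inX_le _).trans (hm _)
  · rw [indicator_of_notMem hv, fderiv_eq_zero_of_lt_norm hs
      (lt_norm_pt_right y (by simpa using hv)), ContinuousLinearMap.zero_comp, norm_zero]

/-- The velocity gradient as a linear function of the derivative. -/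
noncomputable def gradVL : (Phase →L[ℝ] ℝ) →L[ℝ] E3 :=
  LinearMap.mkContinuous
    ⟨⟨fun l => (InnerProductSpace.toDual ℝ E3).symm (l.comp inV), fun l l' => by
      rw [ContinuousLinearMap.add_comp, map_add]⟩, fun c l =>
      ext_inner_right ℝ fun h => by
        rw [RingHom.id_apply, real_inner_smul_left, InnerProductSpace.toDual_symm_apply,
          InnerProductSpace.toDual_symm_apply]
        rfl⟩ 1
    fun l => by
      rw [one_mul]
      refine ((InnerProductSpace.toDual ℝ E3).symm.norm_map (l.comp inV)).trans_le ?_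
      exact (ContinuousLinearMap.opNorm_comp_le _ _).trans
        (mul_le_of_le_one_right (norm_nonneg _) norm_inV_le)

theorem norm_gradVL_le (l : Phase →L[ℝ] ℝ) : ‖gradVL l‖ ≤ ‖l‖ := by
  have h : ‖gradVL‖ ≤ 1 := LinearMap.mkContinuous_norm_le _ zero_le_one _
  exact (gradVL.le_opNorm l).trans (mul_le_of_le_one_left (norm_nonneg _) h)

theorem inner_gradVL (l : Phase →L[ℝ] ℝ) (h : E3) : inner ℝ (gradVL l) h = l (pt 0 h) :=
  InnerProductSpace.toDual_symm_apply

theorem gradV_eq {g : Phase → ℝ} {z : Phase} (hg : DifferentiableAt ℝ g z) :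
    gradV g z = gradVL (fderiv ℝ g z) :=
  ext_inner_right ℝ fun h => by rw [inner_gradV hg, inner_gradVL]

/-- The force moment `∫ f ∂ᵥa dw`. -/
noncomputable def moment (a f : Phase → ℝ) (y : E3) : E3 :=
  ∫ w, f (pt y w) • gradVL (fderiv ℝ a (pt y w))

/-- The integrand of the derivative of `moment a f`. -/
noncomputable def dmoment (a f : Phase → ℝ) (z : Phase) : E3 →L[ℝ] E3 :=
  ((fderiv ℝ f z).comp inX).smulRight (gradVL (fderiv ℝ a z))
    - ((fderiv ℝ a z).comp inX).smulRight (gradVL (fderiv ℝ f z))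

/-- A product rule in which `g` is merely continuous: since `u x = 0`, the error `u y • (g y - g x)`
is `O(‖y - x‖) · o(1)`. It replaces the missing second derivative of `a` below. -/
theorem hasFDerivAt_smul_of_eq_zero {E V : Type*} [NormedAddCommGroup E] [NormedSpace ℝ E]
    [NormedAddCommGroup V] [NormedSpace ℝ V] {u : E → ℝ} {u' : E →L[ℝ] ℝ} {g : E → V} {x : E}
    (hu : HasFDerivAt u u' x) (h0 : u x = 0) (hg : ContinuousAt g x) :
    HasFDerivAt (fun y => u y • g y) (u'.smulRight (g x)) x := by
  have h1 : HasFDerivAt (fun y => u y • g x) (u'.smulRight (g x)) x := hu.smul_const (g x)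
  have h2 : HasFDerivAt (fun y => u y • (g y - g x)) (0 : E →L[ℝ] V) x := by
    rw [hasFDerivAt_iff_isLittleO]
    have hO : (fun y => u y) =O[𝓝 x] fun y => y - x := by
      have := hu.isBigO_sub
      simpa [h0] using this
    have ho : (fun y => g y - g x) =o[𝓝 x] fun _ => (1 : ℝ) := by
      rw [Asymptotics.isLittleO_one_iff]
      rw [← sub_self (g x)]
      exact Tendsto.sub hg tendsto_const_nhds
    have h3 := hO.norm_right.smul_isLittleO ho
    simp only [smul_eq_mul, mul_one] at h3
    simpa [h0] using h3.of_norm_right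
  have := h1.add h2
  rw [add_zero] at this
  refine this.congr_of_eventuallyEq (Eventually.of_forall fun y => ?_)
  simp [smul_sub]

theorem continuous_smulRight {X : Type*} [TopologicalSpace X] {l : X → E3 →L[ℝ] ℝ} {v : X → E3}
    (hl : Continuous l) (hv : Continuous v) : Continuous fun x => (l x).smulRight (v x) :=
  ((ContinuousLinearMap.smulRightL ℝ E3 E3).continuous.comp hl).clm_apply hv

/-- Integration by parts in the velocity, with the boundary terms removed by the support of `f`. The
two positions are independent, so that increments of `a` in position can be treated with `f` frozen.
-/
theorem integral_smul_gradVL {f a : Phase → ℝ} {R : ℝ} (hf : ContDiff ℝ 1 f)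
    (hs : ∀ z, R < ‖z‖ → f z = 0) (ha : ContDiff ℝ 1 a) (x y : E3) :
    ∫ w, f (pt x w) • gradVL (fderiv ℝ a (pt y w))
      = -∫ w, a (pt y w) • gradVL (fderiv ℝ f (pt x w)) := by
  have hcf : Continuous fun w => f (pt x w) := continuous_slice hf.continuous x
  have hca : Continuous fun w => a (pt y w) := continuous_slice ha.continuous y
  have hcf' : Continuous fun w => fderiv ℝ f (pt x w) :=
    continuous_slice (hf.continuous_fderiv one_ne_zero) x
  have hca' : Continuous fun w => fderiv ℝ a (pt y w) :=
    continuous_slice (ha.continuous_fderiv one_ne_zero) y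
  have hsf : HasCompactSupport fun w => f (pt x w) :=
    hasCompactSupport_of_lt_norm fun v hv => hs _ (lt_norm_pt_right x hv)
  have hsf' : HasCompactSupport fun w => fderiv ℝ f (pt x w) :=
    hasCompactSupport_of_lt_norm fun v hv =>
      fderiv_eq_zero_of_lt_norm hs (lt_norm_pt_right x hv)
  have hd : ∀ {g : Phase → ℝ}, ContDiff ℝ 1 g → ∀ (x w : E3),
      HasFDerivAt (fun w => g (pt x w)) ((fderiv ℝ g (pt x w)).comp inV) w := by
    intro g hg x w
    have h1 : HasFDerivAt (fun v => pt x v) inV w := by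
      simp only [pt_eq]
      exact inV.hasFDerivAt.const_add _
    exact (hg.differentiable one_ne_zero _).hasFDerivAt.comp w h1
  have hI1 : Integrable fun w => f (pt x w) • gradVL (fderiv ℝ a (pt y w)) :=
    (hcf.smul (gradVL.continuous.comp hca')).integrable_of_hasCompactSupport hsf.smul_right
  have hI2 : Integrable fun w => a (pt y w) • gradVL (fderiv ℝ f (pt x w)) :=
    (hca.smul (gradVL.continuous.comp hcf')).integrable_of_hasCompactSupport
      (HasCompactSupport.smul_left (hsf'.comp_left (g := gradVL) (map_zero _)))
  refine ext_inner_left ℝ fun e => ?_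
  rw [inner_neg_right, ← integral_inner hI1, ← integral_inner hI2]
  simp only [real_inner_smul_right, real_inner_comm (gradVL _), inner_gradVL]
  have key := integral_bilinear_hasFDerivAt_right_eq_neg_left_of_integrable (v := e)
      (μ := (volume : Measure E3)) (B := ContinuousLinearMap.mul ℝ ℝ)
      (f := fun w => f (pt x w)) (g := fun w => a (pt y w))
      (f' := fun w => (fderiv ℝ f (pt x w)).comp inV)
      (g' := fun w => (fderiv ℝ a (pt y w)).comp inV) ?_ ?_ ?_
      (fun w _ => hd hf x w) (fun w _ => hd ha y w)
  · simpa [mul_comm] using key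
  · refine Continuous.integrable_of_hasCompactSupport
      (((hcf'.clm_comp continuous_const).clm_apply continuous_const).mul hca) ?_
    exact HasCompactSupport.mul_right
      (hsf'.comp_left (g := fun l : Phase →L[ℝ] ℝ => l.comp inV e) (by simp))
  · exact Continuous.integrable_of_hasCompactSupport
      (hcf.mul ((hca'.clm_comp continuous_const).clm_apply continuous_const)) hsf.mul_right
  · exact Continuous.integrable_of_hasCompactSupport (hcf.mul hca) hsf.mul_right

/-- Although `∂ᵥa` is merely continuous, the moment `∫ f ∂ᵥa dw` is differentiable. -/
theorem hasFDerivAt_moment {f a : Phase → ℝ} {R m M : ℝ} (hf : ContDiff ℝ 1 f)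
    (hs : ∀ z, R < ‖z‖ → f z = 0) (hm : ∀ z, ‖fderiv ℝ f z‖ ≤ m) (ha : ContDiff ℝ 1 a)
    (hM : ∀ z, ‖fderiv ℝ a z‖ ≤ M) (y₀ : E3) :
    HasFDerivAt (moment a f) (∫ w, dmoment a f (pt y₀ w)) y₀ := by
  have hm0 : 0 ≤ m := (norm_nonneg _).trans (hm 0)
  have hM0 : 0 ≤ M := (norm_nonneg _).trans (hM 0)
  have hfd := hf.differentiable one_ne_zero
  have had := ha.differentiable one_ne_zero
  have hcf' := hf.continuous_fderiv one_ne_zero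
  have hca' := ha.continuous_fderiv one_ne_zero
  have hslice : ∀ {g : Phase → ℝ} {b : ℝ}, Differentiable ℝ g → (∀ z, ‖fderiv ℝ g z‖ ≤ b) →
      ∀ y w : E3, ‖g (pt y w) - g (pt y₀ w)‖ ≤ b * ‖y - y₀‖ := by
    intro g b hg hb y w
    exact convex_univ.norm_image_sub_le_of_norm_hasFDerivWithin_le
      (fun x _ => (hasFDerivAt_slice hg x w).hasFDerivWithinAt)
      (fun x _ => (norm_comp_inX_le _).trans (hb _)) (mem_univ _) (mem_univ _)
  have hs1 : ∀ y w : E3, R < ‖w‖ → f (pt y w) = 0 := fun y w hw => hs _ (lt_norm_pt_right y hw)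
  have hs2 : ∀ y w : E3, R < ‖w‖ → fderiv ℝ f (pt y w) = 0 := fun y w hw =>
    fderiv_eq_zero_of_lt_norm hs (lt_norm_pt_right y hw)
  -- The integrand of the increment of the moment, after writing it as `(f(y) - f(y₀)) ∂ᵥa(y) +
  -- f(y₀) ∂ᵥ(a(y) - a(y₀))` and integrating the second term by parts. Every velocity gradient now
  -- multiplies an increment that vanishes at `y₀`.
  set G : E3 → E3 → E3 := fun y w =>
    (f (pt y w) - f (pt y₀ w)) • gradVL (fderiv ℝ a (pt y w))
      - (a (pt y w) - a (pt y₀ w)) • gradVL (fderiv ℝ f (pt y₀ w)) with hG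
  have hGc : ∀ y, Continuous (G y) := fun y =>
    (((continuous_slice hf.continuous y).sub (continuous_slice hf.continuous y₀)).smul
      (gradVL.continuous.comp (continuous_slice hca' y))).sub
    (((continuous_slice ha.continuous y).sub (continuous_slice ha.continuous y₀)).smul
      (gradVL.continuous.comp (continuous_slice hcf' y₀)))
  have hG0 : ∀ y w, R < ‖w‖ → G y w = 0 := fun y w hw => by
    simp [hG, hs1 _ _ hw, hs2 _ _ hw]
  have hGI : ∀ y, Integrable (G y) := fun y =>
    (hGc y).integrable_of_hasCompactSupport (hasCompactSupport_of_lt_norm (hG0 y))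
  have hI : Integrable ((Metric.closedBall (0 : E3) R).indicator fun _ => m * M + M * m) :=
    IntegrableOn.integrable_indicator
      (integrableOn_const (isCompact_closedBall _ R).measure_ne_top)
      Metric.isClosed_closedBall.measurableSet
  have hGy₀ : ∀ w, G y₀ w = 0 := fun w => by simp [hG]
  -- Differentiation under the integral at the single point `y₀`, with a Lipschitz bound as
  -- domination: `m * M` from the increment of `f`, `M * m` from that of `a`.
  have hmain : HasFDerivAt (fun y => ∫ w, G y w) (∫ w, dmoment a f (pt y₀ w)) y₀ := by
    refine (hasFDerivAt_integral_of_dominated_loc_of_lip' (s := univ) univ_mem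
      (fun y _ => (hGc y).aestronglyMeasurable) (hGI y₀) ?_
      (Eventually.of_forall fun w y _ => ?_) hI (Eventually.of_forall fun w => ?_)).2
    · refine Continuous.aestronglyMeasurable (continuous_slice ?_ y₀)
      have hl : Continuous fun z => (fderiv ℝ f z).comp inX := hcf'.clm_comp continuous_const
      have hl' : Continuous fun z => (fderiv ℝ a z).comp inX := hca'.clm_comp continuous_const
      exact (continuous_smulRight hl (gradVL.continuous.comp hca')).sub
        (continuous_smulRight hl' (gradVL.continuous.comp hcf'))
    · rw [hGy₀, sub_zero]
      by_cases hw : w ∈ Metric.closedBall (0 : E3) R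
      · rw [indicator_of_mem hw, add_mul]
        refine (norm_sub_le _ _).trans (add_le_add ?_ ?_)
        · rw [norm_smul, mul_right_comm]
          exact mul_le_mul (hslice hfd hm y w) ((norm_gradVL_le _).trans (hM _))
            (norm_nonneg _) (by positivity)
        · rw [norm_smul, mul_right_comm]
          exact mul_le_mul (hslice had hM y w) ((norm_gradVL_le _).trans (hm _))
            (norm_nonneg _) (by positivity)
      · rw [indicator_of_notMem hw, zero_mul, hG0 y w (by simpa using hw), norm_zero]
    · refine HasFDerivAt.sub ?_ ?_
      · refine hasFDerivAt_smul_of_eq_zero (g := fun y => gradVL (fderiv ℝ a (pt y w)))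
          ((hasFDerivAt_slice hfd y₀ w).sub_const _) (sub_self _) ?_
        exact (gradVL.continuous.comp (hca'.comp (continuous_pt.comp
          (by fun_prop : Continuous fun y : E3 => (y, w))))).continuousAt
      · exact ((hasFDerivAt_slice had y₀ w).sub_const _).smul_const _
  refine (hmain.add_const (moment a f y₀)).congr_of_eventuallyEq (Eventually.of_forall fun y => ?_)
  have hI1 : ∀ x y, Integrable fun w => f (pt x w) • gradVL (fderiv ℝ a (pt y w)) := fun x y =>
    ((continuous_slice hf.continuous x).smul
      (gradVL.continuous.comp (continuous_slice hca' y))).integrable_of_hasCompactSupport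
      (hasCompactSupport_of_lt_norm (R := R) fun w hw => by simp [hs1 _ _ hw])
  have hI2 : ∀ x y, Integrable fun w => a (pt y w) • gradVL (fderiv ℝ f (pt x w)) := fun x y =>
    ((continuous_slice ha.continuous y).smul
      (gradVL.continuous.comp (continuous_slice hcf' x))).integrable_of_hasCompactSupport
      (hasCompactSupport_of_lt_norm (R := R) fun w hw => by simp [hs2 _ _ hw])
  have e : ∫ w, G y w = ((∫ w, f (pt y w) • gradVL (fderiv ℝ a (pt y w)))
      - ∫ w, f (pt y₀ w) • gradVL (fderiv ℝ a (pt y w)))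
      - ((∫ w, a (pt y w) • gradVL (fderiv ℝ f (pt y₀ w)))
        - ∫ w, a (pt y₀ w) • gradVL (fderiv ℝ f (pt y₀ w))) := by
    have h := integral_sub ((hI1 y y).sub (hI1 y₀ y)) ((hI2 y₀ y).sub (hI2 y₀ y₀))
    simp only [Pi.sub_apply] at h
    rw [← integral_sub (hI1 _ _) (hI1 _ _), ← integral_sub (hI2 _ _) (hI2 _ _), ← h]
    simp only [hG, sub_smul]
  show moment a f y = (∫ w, G y w) + moment a f y₀
  rw [e, integral_smul_gradVL hf hs ha y₀ y, moment, moment,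
    integral_smul_gradVL hf hs ha y₀ y₀]
  abel

end Averages

/-! ### C¹ bounds and regularity under sums and bilinear maps. -/

section Calculus

variable {E F G H : Type*} [NormedAddCommGroup E] [NormedSpace ℝ E]
  [NormedAddCommGroup F] [NormedSpace ℝ F] [NormedAddCommGroup G] [NormedSpace ℝ G]
  [NormedAddCommGroup H] [NormedSpace ℝ H]

/-- `|g| ≤ m` and `|Dg| ≤ m`. -/
structure C1Bound (m : ℝ) (g : E → F) : Prop where
  val : ∀ z, ‖g z‖ ≤ m
  der : ∀ z, ‖fderiv ℝ g z‖ ≤ m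

theorem C1Bound.nonneg {m : ℝ} {g : E → F} (h : C1Bound m g) : 0 ≤ m :=
  (norm_nonneg _).trans (h.val 0)

theorem C1Bound.mono {m m' : ℝ} {g : E → F} (h : C1Bound m g) (hm : m ≤ m') : C1Bound m' g :=
  ⟨fun z => (h.val z).trans hm, fun z => (h.der z).trans hm⟩

theorem C1Bound.comp_clm {m : ℝ} {g : E → F} (h : C1Bound m g) (hg : Differentiable ℝ g)
    {l : G →L[ℝ] E} (hl : ‖l‖ ≤ 1) : C1Bound m fun z => g (l z) := by
  refine ⟨fun z => h.val _, fun z => ?_⟩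
  have : HasFDerivAt (fun z => g (l z)) ((fderiv ℝ g (l z)).comp l) z :=
    (hg _).hasFDerivAt.comp z l.hasFDerivAt
  rw [this.fderiv]
  exact (ContinuousLinearMap.opNorm_comp_le _ _).trans
    ((mul_le_of_le_one_right (norm_nonneg _) hl).trans (h.der _))

theorem C1Bound.neg {m : ℝ} {g : E → F} (h : C1Bound m g) : C1Bound m fun z => -g z :=
  ⟨fun z => by rw [norm_neg]; exact h.val z, fun z => by
    rw [fderiv_fun_neg, norm_neg]; exact h.der z⟩

theorem C1Bound.add {m m' : ℝ} {g g' : E → F} (h : C1Bound m g) (h' : C1Bound m' g')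
    (hg : Differentiable ℝ g) (hg' : Differentiable ℝ g') :
    C1Bound (m + m') fun z => g z + g' z :=
  ⟨fun z => (norm_add_le _ _).trans (add_le_add (h.val z) (h'.val z)), fun z => by
    rw [fderiv_fun_add (hg z) (hg' z)]
    exact (norm_add_le _ _).trans (add_le_add (h.der z) (h'.der z))⟩

theorem C1Bound.bilinear {m m' : ℝ} {g : E → F} {g' : E → G} (h : C1Bound m g)
    (h' : C1Bound m' g') (hg : Differentiable ℝ g) (hg' : Differentiable ℝ g')
    (B : F →L[ℝ] G →L[ℝ] H) : C1Bound (2 * ‖B‖ * m * m') fun z => B (g z) (g' z) := by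
  have hm := h.nonneg
  have hm' := h'.nonneg
  have key : ∀ (x : F) (y : G), ‖x‖ ≤ m → ‖y‖ ≤ m' → ‖B x y‖ ≤ ‖B‖ * m * m' := fun x y hx hy =>
    (B.le_opNorm₂ x y).trans (by gcongr)
  refine ⟨fun z => (key _ _ (h.val z) (h'.val z)).trans ?_, fun z => ?_⟩
  · have : 0 ≤ ‖B‖ * m * m' := by positivity
    linarith
  · rw [(B.hasFDerivAt_of_bilinear (hg z).hasFDerivAt (hg' z).hasFDerivAt).fderiv]
    refine ContinuousLinearMap.opNorm_le_bound _ (by positivity) fun e => ?_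
    have e1 : ‖B (g z) (fderiv ℝ g' z e)‖ ≤ ‖B‖ * m * (m' * ‖e‖) :=
      (B.le_opNorm₂ _ _).trans (by
        gcongr
        · exact h.val z
        · exact ((fderiv ℝ g' z).le_opNorm e).trans (by gcongr; exact h'.der z))
    have e2 : ‖B (fderiv ℝ g z e) (g' z)‖ ≤ ‖B‖ * (m * ‖e‖) * m' :=
      (B.le_opNorm₂ _ _).trans (by
        gcongr
        · exact ((fderiv ℝ g z).le_opNorm e).trans (by gcongr; exact h.der z)
        · exact h'.val z)
    refine (norm_add_le _ _).trans ((add_le_add e1 e2).trans_eq ?_)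
    ring

theorem ContC1.continuous_fderiv {u : ℝ → E → F} (h : ContC1 u) {X : Type*} [TopologicalSpace X]
    {s : X → ℝ} {y : X → E} (hs : Continuous s) (hy : Continuous y) :
    Continuous fun x => fderiv ℝ (u (s x)) (y x) :=
  h.cont'.comp (hs.prodMk hy)

theorem ContC1.continuous {u : ℝ → E → F} (h : ContC1 u) {X : Type*} [TopologicalSpace X]
    {s : X → ℝ} {y : X → E} (hs : Continuous s) (hy : Continuous y) :
    Continuous fun x => u (s x) (y x) :=
  h.cont.comp (hs.prodMk hy)

theorem contC1_const {g : E → F} (hg : ContDiff ℝ 1 g) : ContC1 fun _ : ℝ => g :=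
  ⟨fun _ => hg.differentiable one_ne_zero, hg.continuous.comp continuous_snd,
    (hg.continuous_fderiv one_ne_zero).comp continuous_snd⟩

theorem ContC1.comp_clm {u : ℝ → E → F} (h : ContC1 u) (l : G →L[ℝ] E) :
    ContC1 fun t z => u t (l z) :=
  contC1_of_hasFDerivAt (u' := fun t z => (fderiv ℝ (u t) (l z)).comp l)
    (fun t z => (h.differentiable t _).hasFDerivAt.comp z l.hasFDerivAt)
    (h.continuous continuous_fst (l.continuous.comp continuous_snd))
    ((h.continuous_fderiv continuous_fst (l.continuous.comp continuous_snd)).clm_comp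
      continuous_const)

theorem ContC1.add {u v : ℝ → E → F} (hu : ContC1 u) (hv : ContC1 v) :
    ContC1 fun t z => u t z + v t z :=
  contC1_of_hasFDerivAt (fun t z => (hu.differentiable t z).hasFDerivAt.add
    (hv.differentiable t z).hasFDerivAt) (hu.cont.add hv.cont) (hu.cont'.add hv.cont')

theorem ContC1.neg {u : ℝ → E → F} (hu : ContC1 u) : ContC1 fun t z => -u t z :=
  contC1_of_hasFDerivAt (fun t z => (hu.differentiable t z).hasFDerivAt.neg) hu.cont.neg
    hu.cont'.neg

theorem ContC1.bilinear {u : ℝ → E → F} {v : ℝ → E → G} (hu : ContC1 u) (hv : ContC1 v)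
    (B : F →L[ℝ] G →L[ℝ] H) : ContC1 fun t z => B (u t z) (v t z) := by
  refine contC1_of_hasFDerivAt (fun t z => B.hasFDerivAt_of_bilinear
    (hu.differentiable t z).hasFDerivAt (hv.differentiable t z).hasFDerivAt)
    ((B.continuous.comp hu.cont).clm_apply hv.cont) ?_
  exact (((B.precompR E).continuous.comp hu.cont).clm_apply hv.cont').add
    (((B.precompL E).continuous.comp hu.cont').clm_apply hv.cont)

end Calculus

/-! ### Regularity and C¹ estimates of the linear part of the source. -/

section Source

open scoped Convolution

/-- The part of the source that is linear in the solution, at a fixed time. -/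
noncomputable def linSource (a : Phase → ℝ) (C : Phase → E3) (χ f : Phase → ℝ) (z : Phase) : ℝ :=
  inner ℝ (gradient (fun x => ∫ y, (∫ v, f (pt y v)) / ‖x - y‖) (xpart z)) (C z)
    + χ z * -∫ y, ∫ w,
      inner ℝ ((‖xpart z - y‖ ^ 3)⁻¹ • (xpart z - y)) (gradV a (pt y w)) * f (pt y w)

theorem source_eq_linSource (D : Coefficients) (f : ℝ → Phase → ℝ) (t : ℝ) (z : Phase) :
    D.source f t z = linSource (D.a t) (D.C t) D.χ (f t) z + D.b t z := rfl

/-- The bilinear map `(x, c) ↦ c x`. -/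
noncomputable def smulFlip : E3 →L[ℝ] ℝ →L[ℝ] E3 :=
  (ContinuousLinearMap.lsmul ℝ ℝ : ℝ →L[ℝ] E3 →L[ℝ] E3).flip

/-- The field `-∂ₓψ_f` generated by the phase space density `f`. -/
noncomputable def eField (f : Phase → ℝ) : E3 → E3 :=
  coulomb ⋆[smulFlip, volume] fun x => ∫ v, f (pt x v)

/-- The function `-Φ_{a,f}`. -/
noncomputable def phiField (a f : Phase → ℝ) : E3 → ℝ :=
  coulomb ⋆[innerSL ℝ, volume] moment a f

theorem moment_eq_zero {a f : Phase → ℝ} {R : ℝ} (hs : ∀ z, R < ‖z‖ → f z = 0) {x : E3}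
    (hx : R < ‖x‖) : moment a f x = 0 := by
  simp [moment, hs _ (lt_norm_pt_left _ hx)]

theorem density_eq_zero {f : Phase → ℝ} {R : ℝ} (hs : ∀ z, R < ‖z‖ → f z = 0) {x : E3}
    (hx : R < ‖x‖) : ∫ v, f (pt x v) = 0 := by
  simp [hs _ (lt_norm_pt_left _ hx)]

theorem exists_C1Bound {f : Phase → ℝ} {R : ℝ} (hf : ContDiff ℝ 1 f)
    (hs : ∀ z, R < ‖z‖ → f z = 0) : ∃ m, C1Bound m f := by
  obtain ⟨m₁, h₁⟩ := (hasCompactSupport_of_lt_norm hs).exists_bound_of_continuous hf.continuous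
  obtain ⟨m₂, h₂⟩ := (hasCompactSupport_of_lt_norm fun z hz =>
    fderiv_eq_zero_of_lt_norm hs hz).exists_bound_of_continuous (hf.continuous_fderiv one_ne_zero)
  exact ⟨max m₁ m₂, fun z => (h₁ z).trans (le_max_left _ _),
    fun z => (h₂ z).trans (le_max_right _ _)⟩

/-- Both terms become Coulomb convolutions with C¹ densities, the charge density and the force
moment, for which regularity and bounds are available. The inner product with the kernel is pulled
out of the velocity integral. -/
theorem linSource_eq {a : Phase → ℝ} {C : Phase → E3} {χ f : Phase → ℝ} {R : ℝ}
    (ha : ContDiff ℝ 1 a) (hf : ContDiff ℝ 1 f) (hs : ∀ z, R < ‖z‖ → f z = 0) (z : Phase) :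
    linSource a C χ f z
      = -inner ℝ (eField f (xpart z)) (C z) + -(χ z * phiField a f (xpart z)) := by
  obtain ⟨m, hm⟩ := exists_C1Bound hf hs
  have hd := hasFDerivAt_integral_slice hf hs hm.der
  have hρ : ContDiff ℝ 1 fun x => ∫ v, f (pt x v) := by
    refine contDiff_one_iff_hasFDerivAt.2 ⟨_, ?_, hd⟩
    have := continuous_integral_pt (R := R) (h := fun _ z => (fderiv ℝ f z).comp inX)
      (((hf.continuous_fderiv one_ne_zero).comp continuous_snd).clm_comp continuous_const)
      (fun _ z hz => by rw [fderiv_eq_zero_of_lt_norm hs hz, ContinuousLinearMap.zero_comp])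
    exact this.comp (by fun_prop : Continuous fun x : E3 => ((0 : ℝ), x))
  have h1 := gradient_potential hρ
    (hasCompactSupport_of_lt_norm (R := R) fun x hx => density_eq_zero hs hx) (xpart z)
  rw [linSource, h1, inner_neg_left, ← mul_neg]
  congr 2
  rw [phiField, convolution_def, ← integral_sub_left_eq_self _ volume (xpart z)]
  congr 1
  refine integral_congr_ae (Eventually.of_forall fun y => ?_)
  have hI : ∀ y, Integrable fun w => f (pt y w) • gradVL (fderiv ℝ a (pt y w)) := fun y =>
    ((continuous_slice hf.continuous y).smul (gradVL.continuous.comp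
      (continuous_slice (ha.continuous_fderiv one_ne_zero) y))).integrable_of_hasCompactSupport
      (hasCompactSupport_of_lt_norm (R := R) fun w hw => by simp [hs _ (lt_norm_pt_right y hw)])
  simp only [sub_sub_cancel, moment]
  change _ = inner ℝ (coulomb _) _
  rw [← integral_inner (hI _)]
  refine integral_congr_ae (Eventually.of_forall fun w => ?_)
  simp only [gradV_eq (ha.differentiable one_ne_zero _), real_inner_smul_right, coulomb]
  ring

/-- Additivity needs convergence of all the integrals, hence the restriction to C¹ functions with
bounded support. -/
theorem linSource_add {a : Phase → ℝ} {C : Phase → E3} {χ f g : Phase → ℝ} {R : ℝ}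
    (ha : ContDiff ℝ 1 a) (hf : ContDiff ℝ 1 f) (hs : ∀ z, R < ‖z‖ → f z = 0)
    (hg : ContDiff ℝ 1 g) (hgs : ∀ z, R < ‖z‖ → g z = 0) (z : Phase) :
    linSource a C χ (fun z => f z + g z) z = linSource a C χ f z + linSource a C χ g z := by
  have hfg : ∀ z, R < ‖z‖ → f z + g z = 0 := fun z hz => by rw [hs z hz, hgs z hz, add_zero]
  rw [linSource_eq ha hf hs, linSource_eq ha hg hgs, linSource_eq ha (hf.add hg) hfg]
  have hcρ : ∀ {f : Phase → ℝ}, ContDiff ℝ 1 f → (∀ z, R < ‖z‖ → f z = 0) →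
      Continuous fun x => ∫ v, f (pt x v) := fun {f} hf hs =>
    (continuous_integral_pt (R := R) (h := fun _ z => f z) (hf.continuous.comp continuous_snd)
      (fun _ => hs)).comp (by fun_prop : Continuous fun x : E3 => ((0 : ℝ), x))
  have hcm : ∀ {f : Phase → ℝ}, ContDiff ℝ 1 f → (∀ z, R < ‖z‖ → f z = 0) →
      Continuous (moment a f) := fun {f} hf hs =>
    (continuous_integral_pt (R := R) (h := fun _ z => f z • gradVL (fderiv ℝ a z))
      ((hf.continuous.comp continuous_snd).smul (gradVL.continuous.comp
        ((ha.continuous_fderiv one_ne_zero).comp continuous_snd)))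
      (fun _ z hz => by rw [hs z hz, zero_smul])).comp
      (by fun_prop : Continuous fun x : E3 => ((0 : ℝ), x))
  have e1 : eField (fun z => f z + g z) (xpart z) = eField f (xpart z) + eField g (xpart z) := by
    rw [eField, eField, eField, ← ConvolutionExistsAt.distrib_add
      ((hasCompactSupport_of_lt_norm (R := R) fun x hx =>
        density_eq_zero hs hx).convolutionExists_right _ locallyIntegrable_coulomb (hcρ hf hs) _)
      ((hasCompactSupport_of_lt_norm (R := R) fun x hx =>
        density_eq_zero hgs hx).convolutionExists_right _ locallyIntegrable_coulomb (hcρ hg hgs) _)]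
    congr 1
    ext x
    exact integral_add (integrable_slice hf.continuous hs x) (integrable_slice hg.continuous hgs x)
  have hIm : ∀ {f : Phase → ℝ}, ContDiff ℝ 1 f → (∀ z, R < ‖z‖ → f z = 0) → ∀ y,
      Integrable fun w => f (pt y w) • gradVL (fderiv ℝ a (pt y w)) := fun hf hs y =>
    ((continuous_slice hf.continuous y).smul (gradVL.continuous.comp
      (continuous_slice (ha.continuous_fderiv one_ne_zero) y))).integrable_of_hasCompactSupport
      (hasCompactSupport_of_lt_norm (R := R) fun w hw => by simp [hs _ (lt_norm_pt_right y hw)])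
  have e2 : phiField a (fun z => f z + g z) (xpart z)
      = phiField a f (xpart z) + phiField a g (xpart z) := by
    rw [phiField, phiField, phiField, ← ConvolutionExistsAt.distrib_add
      ((hasCompactSupport_of_lt_norm (R := R) fun x hx =>
        moment_eq_zero hs hx).convolutionExists_right _ locallyIntegrable_coulomb (hcm hf hs) _)
      ((hasCompactSupport_of_lt_norm (R := R) fun x hx =>
        moment_eq_zero hgs hx).convolutionExists_right _ locallyIntegrable_coulomb (hcm hg hgs) _)]
    congr 1
    ext1 x
    rw [Pi.add_apply, moment, moment, moment, ← integral_add (hIm hf hs x) (hIm hg hgs x)]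
    simp only [add_smul]
  rw [e1, e2, inner_add_left]
  ring

theorem norm_dmoment_le {a f : Phase → ℝ} {m M : ℝ} (hf : C1Bound m f) (ha : C1Bound M a)
    (z : Phase) : ‖dmoment a f z‖ ≤ 2 * (m * M) := by
  have hm := hf.nonneg
  have hM := ha.nonneg
  refine (norm_sub_le _ _).trans ?_
  rw [ContinuousLinearMap.norm_smulRight_apply, ContinuousLinearMap.norm_smulRight_apply]
  have h1 := mul_le_mul ((norm_comp_inX_le _).trans (hf.der z))
    ((norm_gradVL_le _).trans (ha.der z)) (norm_nonneg _) hm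
  have h2 := mul_le_mul ((norm_comp_inX_le _).trans (ha.der z))
    ((norm_gradVL_le _).trans (hf.der z)) (norm_nonneg _) hM
  linarith

variable {a : ℝ → Phase → ℝ} {f : ℝ → Phase → ℝ} {C : ℝ → Phase → E3} {χ : Phase → ℝ} {R M : ℝ}

theorem contC1_density (hf : ContC1 f) (hs : ∀ t z, R < ‖z‖ → f t z = 0) :
    ContC1 fun t x => ∫ v, f t (pt x v) := by
  refine contC1_of_hasFDerivAt (u' := fun t x => ∫ v, (fderiv ℝ (f t) (pt x v)).comp inX)
    (fun t x => ?_) (continuous_integral_pt hf.cont hs)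
    (continuous_integral_pt (h := fun t z => (fderiv ℝ (f t) z).comp inX) (R := R)
      (hf.cont'.clm_comp continuous_const) fun t z hz => by
        rw [fderiv_eq_zero_of_lt_norm (hs t) hz, ContinuousLinearMap.zero_comp])
  obtain ⟨m, hm⟩ := exists_C1Bound (hf.contDiff t) (hs t)
  exact hasFDerivAt_integral_slice (hf.contDiff t) (hs t) hm.der x

theorem contC1_moment (ha : ContC1 a) (hM : ∀ t z, ‖fderiv ℝ (a t) z‖ ≤ M) (hf : ContC1 f)
    (hs : ∀ t z, R < ‖z‖ → f t z = 0) : ContC1 fun t => moment (a t) (f t) := by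
  refine contC1_of_hasFDerivAt (u' := fun t x => ∫ w, dmoment (a t) (f t) (pt x w))
    (fun t x => ?_)
    (continuous_integral_pt (h := fun t z => f t z • gradVL (fderiv ℝ (a t) z)) (R := R)
      (hf.cont.smul (gradVL.continuous.comp ha.cont')) fun t z hz => by rw [hs t z hz, zero_smul])
    (continuous_integral_pt (h := fun t z => dmoment (a t) (f t) z) (R := R) ?_ fun t z hz => ?_)
  · obtain ⟨m, hm⟩ := exists_C1Bound (hf.contDiff t) (hs t)
    exact hasFDerivAt_moment (hf.contDiff t) (hs t) hm.der (ha.contDiff t) (hM t) x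
  · exact (continuous_smulRight (hf.cont'.clm_comp continuous_const)
      (gradVL.continuous.comp ha.cont')).sub (continuous_smulRight
      (ha.cont'.clm_comp continuous_const) (gradVL.continuous.comp hf.cont'))
  · ext e
    simp [dmoment, fderiv_eq_zero_of_lt_norm (hs t) hz]

theorem contC1_linSource (ha : ContC1 a) (hM : ∀ t z, ‖fderiv ℝ (a t) z‖ ≤ M) (hC : ContC1 C)
    (hχ : ContDiff ℝ 1 χ) (hf : ContC1 f) (hs : ∀ t z, R < ‖z‖ → f t z = 0) :
    ContC1 fun t => linSource (a t) (C t) χ (f t) := by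
  have h1 : ContC1 fun t => eField (f t) :=
    contC1_coulomb_convolution smulFlip (contC1_density hf hs)
      fun t x hx => density_eq_zero (hs t) hx
  have h2 : ContC1 fun t => phiField (a t) (f t) :=
    contC1_coulomb_convolution (innerSL ℝ) (contC1_moment ha hM hf hs)
      fun t x hx => moment_eq_zero (hs t) hx
  have h3 := (((h1.comp_clm xL).bilinear hC (innerSL ℝ)).neg).add
    (((contC1_const hχ).bilinear (h2.comp_clm xL) (ContinuousLinearMap.mul ℝ ℝ)).neg)
  have e : (fun t => linSource (a t) (C t) χ (f t)) = fun t z =>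
      -innerSL ℝ (eField (f t) (xL z)) (C t z)
        + -(ContinuousLinearMap.mul ℝ ℝ (χ z) (phiField (a t) (f t) (xL z))) := by
    ext t z
    exact linSource_eq (ha.contDiff t) (hf.contDiff t) (hs t) z
  rw [e]
  exact h3

/-- The linear part of the source is bounded in `C¹` by the solution. -/
theorem exists_C1Bound_linSource (R M : ℝ) : ∃ c : ℝ, 0 ≤ c ∧
    ∀ (a : Phase → ℝ) (C : Phase → E3) (χ f : Phase → ℝ) (m : ℝ),
      ContDiff ℝ 1 a → ContDiff ℝ 1 C → ContDiff ℝ 1 χ → ContDiff ℝ 1 f →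
      C1Bound M a → C1Bound M C → C1Bound M χ → (∀ z, R < ‖z‖ → f z = 0) → C1Bound m f →
      C1Bound (c * m) (linSource a C χ f) := by
  obtain ⟨κ, hκ, hconv⟩ := norm_coulomb_convolution_le R
  set ν := volume.real (Metric.closedBall (0 : E3) R) with hν
  have hν0 : 0 ≤ ν := measureReal_nonneg
  -- The summands bound the two terms of the source. The factor `ν` is the cost of integrating out
  -- the velocity, `2 * M` that of the derivative of the moment, and the outer factors 2 come from
  -- the product rule. The maximum covers negative `M`.
  refine ⟨max 0 (2 * ‖(innerSL ℝ : E3 →L[ℝ] E3 →L[ℝ] ℝ)‖ * (‖smulFlip‖ * κ * ν) * M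
    + 2 * ‖ContinuousLinearMap.mul ℝ ℝ‖ * M
      * (‖(innerSL ℝ : E3 →L[ℝ] E3 →L[ℝ] ℝ)‖ * κ * (ν * (2 * M)))), le_max_left _ _, ?_⟩
  intro a C χ f m ha hC hχ hf hMa hMC hMχ hs hm
  have hm0 := hm.nonneg
  have hM0 := hMa.nonneg
  have ha' : ContC1 fun _ : ℝ => a := contC1_const ha
  have hf' : ContC1 fun _ : ℝ => f := contC1_const hf
  have hconv' : ∀ {V W : Type} [NormedAddCommGroup V] [NormedSpace ℝ V] [NormedAddCommGroup W]
      [NormedSpace ℝ W] (L : E3 →L[ℝ] V →L[ℝ] W) {g : E3 → V} {b : ℝ}, ContDiff ℝ 1 g →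
      (∀ x, R < ‖x‖ → g x = 0) → C1Bound b g →
      C1Bound (‖L‖ * κ * b) (coulomb ⋆[L, volume] g) := by
    intro V W _ _ _ _ L g b hg hgs hb
    refine ⟨hconv L g b hb.val hgs, fun x => ?_⟩
    rw [(hasFDerivAt_coulomb_convolution L (contC1_const hg) (fun _ => hgs) 0 x).fderiv]
    refine (hconv (L.precompR E3) (fderiv ℝ g) b hb.der
      (fun x hx => fderiv_eq_zero_of_lt_norm hgs hx) x).trans ?_
    have := hb.nonneg
    gcongr
    exact ContinuousLinearMap.norm_precompR_le E3 L
  have hρ : C1Bound (ν * m) fun x => ∫ v, f (pt x v) := by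
    refine ⟨fun x => norm_integral_le_of_lt_norm (fun w => hm.val _)
      fun w hw => hs _ (lt_norm_pt_right x hw), fun x => ?_⟩
    rw [(hasFDerivAt_integral_slice hf hs hm.der x).fderiv]
    exact norm_integral_le_of_lt_norm (fun w => (norm_comp_inX_le _).trans (hm.der _))
      fun w hw => by
        rw [fderiv_eq_zero_of_lt_norm hs (lt_norm_pt_right x hw), ContinuousLinearMap.zero_comp]
  have hP : C1Bound (ν * (2 * (m * M))) (moment a f) := by
    refine ⟨fun x => norm_integral_le_of_lt_norm (fun w => ?_)
      fun w hw => by rw [hs _ (lt_norm_pt_right x hw), zero_smul], fun x => ?_⟩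
    · rw [norm_smul]
      have := mul_le_mul (hm.val (pt x w)) ((norm_gradVL_le _).trans (hMa.der (pt x w)))
        (norm_nonneg _) hm0
      nlinarith
    · rw [(hasFDerivAt_moment hf hs hm.der ha hMa.der x).fderiv]
      refine norm_integral_le_of_lt_norm (fun w => norm_dmoment_le hm hMa _) fun w hw => ?_
      ext e
      simp [dmoment, fderiv_eq_zero_of_lt_norm hs (lt_norm_pt_right x hw)]
  have hdρ := contC1_density hf' fun _ => hs
  have hdP := contC1_moment ha' (fun _ => hMa.der) hf' fun _ => hs
  have hE : C1Bound _ (eField f) := hconv' smulFlip (hdρ.contDiff 0)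
    (fun x hx => density_eq_zero hs hx) hρ
  have hΦ : C1Bound _ (phiField a f) := hconv' (innerSL ℝ) (hdP.contDiff 0)
    (fun x hx => moment_eq_zero hs hx) hP
  have hE' : Differentiable ℝ (eField f) :=
    (contC1_coulomb_convolution smulFlip hdρ fun t x hx => density_eq_zero hs hx).differentiable 0
  have hΦ' : Differentiable ℝ (phiField a f) :=
    (contC1_coulomb_convolution (innerSL ℝ) hdP
      fun t x hx => moment_eq_zero hs hx).differentiable 0
  have hEx : Differentiable ℝ fun z => eField f (xL z) := hE'.comp xL.differentiable
  have hΦx : Differentiable ℝ fun z => phiField a f (xL z) := hΦ'.comp xL.differentiable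
  have hCd := hC.differentiable one_ne_zero
  have hχd := hχ.differentiable one_ne_zero
  have h1 := (hE.comp_clm hE' norm_xL_le).bilinear hMC hEx hCd (innerSL ℝ)
  have h2 := hMχ.bilinear (hΦ.comp_clm hΦ' norm_xL_le) hχd hΦx (ContinuousLinearMap.mul ℝ ℝ)
  have d1 : Differentiable ℝ fun z => innerSL ℝ (eField f (xL z)) (C z) :=
    (((hE'.comp xL.differentiable).inner ℝ hCd))
  have d2 : Differentiable ℝ fun z => ContinuousLinearMap.mul ℝ ℝ (χ z) (phiField a f (xL z)) :=
    hχd.mul hΦx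
  have h3 := h1.neg.add h2.neg d1.neg d2.neg
  have e : linSource a C χ f = fun z => -innerSL ℝ (eField f (xL z)) (C z)
        + -(ContinuousLinearMap.mul ℝ ℝ (χ z) (phiField a f (xL z))) := by
    ext z
    exact linSource_eq ha hf hs z
  rw [e]
  refine h3.mono (le_trans (le_of_eq ?_) (mul_le_mul_of_nonneg_right (le_max_right _ _) hm0))
  ring

end Source

/-! ### Freezing the coefficients outside the time interval. -/

section Clamp

/-- The projection of `ℝ` onto `[0,T]`. -/
noncomputable def timeClamp (T t : ℝ) : ℝ := max 0 (min t T)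

theorem continuous_clamp (T : ℝ) : Continuous (timeClamp T) := by
  unfold timeClamp
  fun_prop

theorem clamp_mem {T : ℝ} (hT : 0 ≤ T) (t : ℝ) : timeClamp T t ∈ Icc 0 T :=
  ⟨le_max_left _ _, max_le hT (min_le_right _ _)⟩

theorem clamp_of_mem {T t : ℝ} (ht : t ∈ Icc 0 T) : timeClamp T t = t := by
  rw [timeClamp, min_eq_left ht.2, max_eq_right ht.1]

variable {E F : Type*} [NormedAddCommGroup E] [NormedSpace ℝ E]
  [NormedAddCommGroup F] [NormedSpace ℝ F]

theorem enorm_le_c1bNorm (g : E → F) (x : E) : ‖g x‖ₑ ≤ c1bNorm g :=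
  (le_iSup (fun x => ‖g x‖ₑ) x).trans le_self_add

theorem enorm_fderiv_le_c1bNorm (g : E → F) (x : E) : ‖fderiv ℝ g x‖ₑ ≤ c1bNorm g :=
  (le_iSup (fun x => ‖fderiv ℝ g x‖ₑ) x).trans le_add_self

theorem C1Bound.of_c1bNorm_le {g : E → F} {M : ℝ≥0} (h : c1bNorm g ≤ M) : C1Bound M g where
  val x := by
    have := (enorm_le_c1bNorm g x).trans h
    rwa [enorm_le_coe, ← NNReal.coe_le_coe, coe_nnnorm] at this
  der x := by
    have := (enorm_fderiv_le_c1bNorm g x).trans h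
    rwa [enorm_le_coe, ← NNReal.coe_le_coe, coe_nnnorm] at this

theorem c1bNorm_le_c1HolderNorm (γ : ℝ≥0) (g : E → F) : c1bNorm g ≤ c1HolderNorm γ g :=
  le_self_add

theorem MemCTC1Holder.memCTC1b {T : ℝ} {γ : ℝ≥0} {u : ℝ → E → F} (h : MemCTC1Holder T γ u) :
    MemCTC1b T u :=
  ⟨fun t ht => ⟨(h.1 t ht).1, (c1bNorm_le_c1HolderNorm γ _).trans_lt (h.1 t ht).2⟩, fun t ht =>
    tendsto_of_tendsto_of_tendsto_of_le_of_le tendsto_const_nhds (h.2 t ht)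
      (fun _ => zero_le) fun _ => c1bNorm_le_c1HolderNorm γ _⟩

theorem C1Bound.of_timeSupNorm_le {T : ℝ} {u : ℝ → E → F} {N : (E → F) → ℝ≥0∞} {M : ℝ≥0}
    (hN : ∀ g, c1bNorm g ≤ N g) (h : timeSupNorm T N u ≤ M) {t : ℝ} (ht : t ∈ Icc 0 T) :
    C1Bound M (u t) :=
  C1Bound.of_c1bNorm_le ((hN _).trans ((le_iSup₂ (f := fun t _ => N (u t)) t ht).trans h))

theorem c1bNorm_add_le {g h : E → F} (hg : Differentiable ℝ g) (hh : Differentiable ℝ h) :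
    c1bNorm (g + h) ≤ c1bNorm g + c1bNorm h := by
  have h1 : ⨆ x, ‖(g + h) x‖ₑ ≤ (⨆ x, ‖g x‖ₑ) + ⨆ x, ‖h x‖ₑ := iSup_le fun x =>
    (enorm_add_le _ _).trans (add_le_add (le_iSup (fun x => ‖g x‖ₑ) x)
      (le_iSup (fun x => ‖h x‖ₑ) x))
  have h2 : ⨆ x, ‖fderiv ℝ (g + h) x‖ₑ ≤ (⨆ x, ‖fderiv ℝ g x‖ₑ) + ⨆ x, ‖fderiv ℝ h x‖ₑ :=
    iSup_le fun x => by
      rw [fderiv_add (hg x) (hh x)]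
      have e1 := le_iSup (fun x => ‖fderiv ℝ g x‖ₑ) x
      have e2 := le_iSup (fun x => ‖fderiv ℝ h x‖ₑ) x
      exact (enorm_add_le (E := E →L[ℝ] F) _ _).trans (add_le_add e1 e2)
  refine (add_le_add h1 h2).trans_eq ?_
  unfold c1bNorm
  abel

/-- Near each time `t` the norm is at most `1` plus its value at `t`, and `[0,T]` is compact. -/
theorem MemCTC1b.exists_bound {T : ℝ} {u : ℝ → E → F} (h : MemCTC1b T u) :
    ∃ M : ℝ≥0, timeSupNorm T c1bNorm u ≤ M := by
  have key : ∃ M : ℝ≥0, ∀ t ∈ Icc 0 T, c1bNorm (u t) ≤ M := by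
    refine isCompact_Icc.induction_on
      (p := fun s => ∃ M : ℝ≥0, ∀ t ∈ s ∩ Icc 0 T, c1bNorm (u t) ≤ M)
      ⟨0, by simp⟩ (fun s t hst ⟨M, hM⟩ => ⟨M, fun x hx => hM x ⟨hst hx.1, hx.2⟩⟩) ?_ ?_
      |>.imp fun M hM t ht => hM t ⟨ht, ht⟩
    · rintro s t ⟨M, hM⟩ ⟨M', hM'⟩
      refine ⟨max M M', ?_⟩
      rintro x ⟨hx | hx, hx'⟩
      · exact (hM x ⟨hx, hx'⟩).trans (by exact_mod_cast le_max_left _ _)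
      · exact (hM' x ⟨hx, hx'⟩).trans (by exact_mod_cast le_max_right _ _)
    · intro t ht
      have h1 := (h.2 t ht).eventually (ge_mem_nhds (zero_lt_one (α := ℝ≥0∞)))
      refine ⟨_, h1, 1 + (c1bNorm (u t)).toNNReal, fun s hs => ?_⟩
      have e : u s = (u s - u t) + u t := by simp
      have ds := (h.1 s hs.2).1.differentiable one_ne_zero
      have dt := (h.1 t ht).1.differentiable one_ne_zero
      rw [e]
      refine (c1bNorm_add_le (ds.sub dt) dt).trans ?_
      rw [ENNReal.coe_add, ENNReal.coe_toNNReal (h.1 t ht).2.ne]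
      exact add_le_add hs.1 le_rfl
  obtain ⟨M, hM⟩ := key
  exact ⟨M, iSup₂_le hM⟩

/-- Continuity in time uniformly in space, together with continuity in space at each time, gives
joint continuity. Clamping extends this to all times; it is applied to the coefficients and to their
derivatives. -/
theorem continuous_of_tendsto_edist {X : Type*} [TopologicalSpace X] {T : ℝ} (hT : 0 ≤ T)
    {G : Type*} [NormedAddCommGroup G] {v : ℝ → X → G} (hv : ∀ t ∈ Icc 0 T, Continuous (v t))
    {N : ℝ → ℝ → ℝ≥0∞} (hN : ∀ t ∈ Icc 0 T, Tendsto (fun s => N s t) (𝓝[Icc 0 T] t) (𝓝 0))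
    (h : ∀ s ∈ Icc 0 T, ∀ t ∈ Icc 0 T, ∀ x, ‖v s x - v t x‖ₑ ≤ N s t) :
    Continuous fun p : ℝ × X => v (timeClamp T p.1) p.2 := by
  refine continuous_iff_continuousAt.2 fun ⟨t, x⟩ => ?_
  have ht := clamp_mem hT t
  have h1 : Tendsto (fun p : ℝ × X => N (timeClamp T p.1) (timeClamp T t)) (𝓝 (t, x)) (𝓝 0) := by
    refine (hN _ ht).comp (tendsto_nhdsWithin_iff.2 ⟨?_, Eventually.of_forall fun p =>
      clamp_mem hT p.1⟩)
    exact ((continuous_clamp T).comp continuous_fst).tendsto (t, x)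
  have h2 : Tendsto (fun p : ℝ × X => ‖v (timeClamp T t) p.2 - v (timeClamp T t) x‖ₑ)
      (𝓝 (t, x)) (𝓝 0) := by
    have : Continuous fun p : ℝ × X => ‖v (timeClamp T t) p.2 - v (timeClamp T t) x‖ₑ :=
      (((hv _ ht).comp continuous_snd).sub continuous_const).enorm
    have := this.tendsto (t, x)
    simpa using this
  rw [ContinuousAt, tendsto_iff_edist_tendsto_0]
  refine tendsto_of_tendsto_of_tendsto_of_le_of_le tendsto_const_nhds
    (by simpa using h1.add h2) (fun _ => zero_le) fun p => ?_
  simp only [edist_eq_enorm_sub]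
  have e : v (timeClamp T p.1) p.2 - v (timeClamp T t) x
      = (v (timeClamp T p.1) p.2 - v (timeClamp T t) p.2)
      + (v (timeClamp T t) p.2 - v (timeClamp T t) x) := by abel
  rw [e]
  exact (enorm_add_le _ _).trans (add_le_add (h _ (clamp_mem hT _) _ ht _) le_rfl)

theorem MemCTC1b.contC1 {T : ℝ} (hT : 0 ≤ T) {u : ℝ → E → F} (h : MemCTC1b T u) :
    ContC1 fun t => u (timeClamp T t) where
  differentiable t := (h.1 _ (clamp_mem hT t)).1.differentiable one_ne_zero
  cont := continuous_of_tendsto_edist hT (fun t ht => (h.1 t ht).1.continuous) h.2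
    fun s _ t _ x => enorm_le_c1bNorm (u s - u t) x
  cont' := continuous_of_tendsto_edist hT (v := fun t => fderiv ℝ (u t))
    (fun t ht => (h.1 t ht).1.continuous_fderiv one_ne_zero) h.2 fun s hs t ht x => by
      have := enorm_fderiv_le_c1bNorm (u s - u t) x
      rwa [fderiv_sub ((h.1 s hs).1.differentiable one_ne_zero x)
        ((h.1 t ht).1.differentiable one_ne_zero x)] at this

end Clamp

/-! ### Coefficients regular for all times, and equivalence with the frozen problem. -/

section Tame

/-- Coefficients that are regular for all times: the right-hand side, the cutoff and the initial
value vanish at distance `r` from the origin, and all coefficients are bounded by `M` in `C¹`. -/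
structure Coefficients.Tame (D : Coefficients) (r M : ℝ) : Prop where
  a : ContC1 D.a
  b : ContC1 D.b
  A : ContC1 D.A
  B : ContC1 D.B
  C : ContC1 D.C
  f₀ : ContDiff ℝ 1 D.f₀
  χ : ContDiff ℝ 1 D.χ
  a_le : ∀ t, C1Bound M (D.a t)
  b_le : ∀ t, C1Bound M (D.b t)
  A_le : ∀ t, C1Bound M (D.A t)
  B_le : ∀ t, C1Bound M (D.B t)
  C_le : ∀ t, C1Bound M (D.C t)
  f₀_le : C1Bound M D.f₀
  χ_le : C1Bound M D.χ
  b_zero : ∀ t z, r ≤ ‖z‖ → D.b t z = 0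
  C_zero : ∀ t z, r ≤ ‖z‖ → D.C t z = 0
  f₀_zero : ∀ z, r ≤ ‖z‖ → D.f₀ z = 0
  χ_zero : ∀ z, r ≤ ‖z‖ → D.χ z = 0

/-- The coefficients, frozen outside the time interval `[0,T]`. -/
noncomputable def Coefficients.clamp (D : Coefficients) (T : ℝ) : Coefficients where
  a t := D.a (timeClamp T t)
  b t := D.b (timeClamp T t)
  f₀ := D.f₀
  A t := D.A (timeClamp T t)
  B t := D.B (timeClamp T t)
  C t := D.C (timeClamp T t)
  χ := D.χ

theorem eq_zero_of_tsupport_subset_ball {F : Type*} [Zero F] {g : Phase → F} {r r' : ℝ}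
    (h : tsupport g ⊆ Metric.ball 0 r) (hr : r ≤ r') {z : Phase} (hz : r' ≤ ‖z‖) : g z = 0 := by
  by_contra hne
  have := h (subset_tsupport g hne)
  rw [mem_ball_zero_iff] at this
  linarith

theorem Coefficients.tame_clamp {D : Coefficients} {T r₀ r₁ r₂ : ℝ} {γ M : ℝ≥0} (hT : 0 ≤ T)
    (hD : D.Regular T γ) (hS : D.Supported T r₀ r₁ r₂)
    (ha : timeSupNorm T c1bNorm D.a ≤ M) (hb : timeSupNorm T c1bNorm D.b ≤ M)
    (hA : timeSupNorm T c1bNorm D.A ≤ M) (hB : timeSupNorm T c1bNorm D.B ≤ M)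
    (hC : timeSupNorm T c1bNorm D.C ≤ M) (hf₀ : C1Bound M D.f₀) (hχ : C1Bound M D.χ) :
    (D.clamp T).Tame (max r₀ r₂) M where
  a := hD.a_mem.contC1 hT
  b := hD.b_mem.contC1 hT
  A := hD.A_mem.memCTC1b.contC1 hT
  B := hD.B_mem.memCTC1b.contC1 hT
  C := hD.C_mem.contC1 hT
  f₀ := hD.f₀_contDiff.of_le one_le_two
  χ := hD.χ_contDiff
  a_le t := C1Bound.of_timeSupNorm_le (fun _ => le_rfl) ha (clamp_mem hT t)
  b_le t := C1Bound.of_timeSupNorm_le (fun _ => le_rfl) hb (clamp_mem hT t)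
  A_le t := C1Bound.of_timeSupNorm_le (fun _ => le_rfl) hA (clamp_mem hT t)
  B_le t := C1Bound.of_timeSupNorm_le (fun _ => le_rfl) hB (clamp_mem hT t)
  C_le t := C1Bound.of_timeSupNorm_le (fun _ => le_rfl) hC (clamp_mem hT t)
  f₀_le := hf₀
  χ_le := hχ
  b_zero t _ hz := eq_zero_of_tsupport_subset_ball (hS.b_supp _ (clamp_mem hT t))
    (le_max_left _ _) hz
  C_zero t _ hz := eq_zero_of_tsupport_subset_ball (hS.C_supp _ (clamp_mem hT t))
    (le_max_left _ _) hz
  f₀_zero _ hz := eq_zero_of_tsupport_subset_ball hS.f₀_supp (le_max_left _ _) hz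
  χ_zero _ hz := eq_zero_of_tsupport_subset_ball hS.χ_supp (le_max_right _ _) hz

theorem Coefficients.Regular.exists_tame {D : Coefficients} {T r₀ r₁ r₂ : ℝ} {γ : ℝ≥0} (hT : 0 ≤ T)
    (hD : D.Regular T γ) (hS : D.Supported T r₀ r₁ r₂) :
    ∃ M : ℝ≥0, (D.clamp T).Tame (max r₀ r₂) M := by
  obtain ⟨m₁, h₁⟩ := hD.a_mem.exists_bound
  obtain ⟨m₂, h₂⟩ := hD.b_mem.exists_bound
  obtain ⟨m₃, h₃⟩ := hD.A_mem.memCTC1b.exists_bound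
  obtain ⟨m₄, h₄⟩ := hD.B_mem.memCTC1b.exists_bound
  obtain ⟨m₅, h₅⟩ := hD.C_mem.exists_bound
  obtain ⟨m₆, h₆⟩ := exists_C1Bound (R := r₀) (hD.f₀_contDiff.of_le one_le_two)
    fun z hz => eq_zero_of_tsupport_subset_ball hS.f₀_supp le_rfl hz.le
  obtain ⟨m₇, h₇⟩ := exists_C1Bound (R := r₂) hD.χ_contDiff
    fun z hz => eq_zero_of_tsupport_subset_ball hS.χ_supp le_rfl hz.le
  obtain ⟨n₆, rfl⟩ : ∃ n : ℝ≥0, m₆ = n := ⟨⟨m₆, h₆.nonneg⟩, rfl⟩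
  obtain ⟨n₇, rfl⟩ : ∃ n : ℝ≥0, m₇ = n := ⟨⟨m₇, h₇.nonneg⟩, rfl⟩
  refine ⟨m₁ + m₂ + m₃ + m₄ + m₅ + n₆ + n₇, D.tame_clamp hT hD hS (h₁.trans ?_) (h₂.trans ?_)
    (h₃.trans ?_) (h₄.trans ?_) (h₅.trans ?_) (h₆.mono ?_) (h₇.mono ?_)⟩
  all_goals norm_cast
  all_goals rw [← NNReal.coe_le_coe]; push_cast
  all_goals linarith [m₁.2, m₂.2, m₃.2, m₄.2, m₅.2, n₆.2, n₇.2]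

theorem Coefficients.NormsLE.tame {D : Coefficients} {T r₀ r₁ r₂ : ℝ} {γ M : ℝ≥0} (hT : 0 ≤ T)
    (hD : D.Regular T γ) (hS : D.Supported T r₀ r₁ r₂) (h : D.NormsLE T γ M) :
    (D.clamp T).Tame (max r₀ r₂) M := by
  have hH : ∀ u : ℝ → E3 → E3, timeSupNorm T (c1HolderNorm γ) u ≤ M →
      timeSupNorm T c1bNorm u ≤ M := fun u hu =>
    (iSup₂_mono fun t _ => c1bNorm_le_c1HolderNorm γ (u t)).trans hu
  exact D.tame_clamp hT hD hS h.a_le h.b_le (hH _ h.A_le) (hH _ h.B_le) h.C_le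
    (C1Bound.of_c1bNorm_le (le_self_add.trans h.f₀_le)) (C1Bound.of_c1bNorm_le h.χ_le)

variable {D : Coefficients} {T : ℝ}

theorem Coefficients.source_clamp {t : ℝ} (ht : t ∈ Icc 0 T) (f : ℝ → Phase → ℝ) (z : Phase) :
    (D.clamp T).source f t z = D.source f t z := by
  simp only [source_eq_linSource, Coefficients.clamp, clamp_of_mem ht]

theorem Coefficients.isClassicalSolution_clamp {f : ℝ → Phase → ℝ} :
    (D.clamp T).IsClassicalSolution T f ↔ D.IsClassicalSolution T f := by
  constructor
  · refine fun h => ⟨h.contDiffOn, fun t ht z => ?_, h.initial⟩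
    have := h.equation t ht z
    rw [source_clamp ht] at this
    simpa only [Coefficients.clamp, clamp_of_mem ht] using this
  · refine fun h => ⟨h.contDiffOn, fun t ht z => ?_, h.initial⟩
    rw [source_clamp ht]
    simpa only [Coefficients.clamp, clamp_of_mem ht] using h.equation t ht z

theorem Coefficients.isCharacteristicFlow_clamp {Z : ℝ → ℝ → Phase → Phase} :
    (D.clamp T).IsCharacteristicFlow T Z ↔ D.IsCharacteristicFlow T Z := by
  constructor
  · refine fun h => ⟨h.initial, fun t ht z s hs => ?_⟩
    simpa only [Coefficients.clamp, clamp_of_mem hs] using h.ode t ht z s hs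
  · refine fun h => ⟨h.initial, fun t ht z s hs => ?_⟩
    simpa only [Coefficients.clamp, clamp_of_mem hs] using h.ode t ht z s hs

theorem Coefficients.Tame.smoothField {r M : ℝ} (h : D.Tame r M) :
    SmoothField (lorentz D.A D.B) (dlorentz D.A D.B) :=
  smoothField_lorentz h.A h.B (fun t => (h.A_le t).val) (fun t => (h.A_le t).der)
    (fun t => (h.B_le t).val) fun t => (h.B_le t).der

/-- Far from the origin the factors `C` and `χ` vanish, so no assumption on `f`, not even
convergence of the integrals, is needed. This localises the source of an arbitrary solution. -/
theorem Coefficients.linSource_eq_zero {r M : ℝ} (h : D.Tame r M) (f : Phase → ℝ) (t : ℝ)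
    {z : Phase} (hz : r ≤ ‖z‖) : linSource (D.a t) (D.C t) D.χ f z = 0 := by
  simp [linSource, h.C_zero t z hz, h.χ_zero z hz]

end Tame

/-! ### Growth of the characteristics and propagation of supports. -/

section Support

variable {D : Coefficients} {r M T : ℝ}

/-- Growth of the characteristics, in terms of a bound of `A`. -/
theorem norm_integralCurve_lorentz_le {A B : ℝ → E3 → E3} {α : ℝ → ℝ} (hα : Continuous α)
    (hA : ∀ t x, ‖A t x‖ ≤ α t) {γ : ℝ → Phase} (hγ : IsIntegralCurve γ (lorentz A B)) {s t : ℝ}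
    (hst : s ≤ t) : ‖γ t‖ ≤ Real.exp (t - s) * (‖γ s‖ + ∫ τ in s..t, α τ) := by
  have hα0 : ∀ τ, 0 ≤ α τ := fun τ => (norm_nonneg _).trans (hA τ 0)
  have key : ∀ ε > 0, ‖γ t‖ ≤ Real.exp (t - s) * (‖γ s‖ + ε + ∫ τ in s..t, α τ) := by
    intro ε hε
    -- A regularised norm, differentiable also where the curve passes through the origin; `ε` is
    -- sent to zero at the end.
    set w : ℝ → ℝ := fun τ => √(‖γ τ‖ ^ 2 + ε ^ 2) with hw
    have hpos : ∀ τ, 0 < ‖γ τ‖ ^ 2 + ε ^ 2 := fun τ => by positivity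
    have hwpos : ∀ τ, 0 < w τ := fun τ => Real.sqrt_pos.2 (hpos τ)
    have hwsq : ∀ τ, w τ ^ 2 = ‖γ τ‖ ^ 2 + ε ^ 2 := fun τ => Real.sq_sqrt (hpos τ).le
    have hle : ∀ τ, ‖γ τ‖ ≤ w τ := fun τ => by
      refine Real.le_sqrt_of_sq_le ?_
      nlinarith
    have hd : ∀ τ, HasDerivAt w (inner ℝ (γ τ) (lorentz A B τ (γ τ)) / w τ) τ := by
      intro τ
      have h1 := ((hγ τ).norm_sq.add_const (ε ^ 2)).sqrt (hpos τ).ne'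
      exact h1.congr_deriv (mul_div_mul_left _ _ two_ne_zero)
    -- The magnetic term drops out, `x · v ≤ |z|²` by Young's inequality, and `v · A ≤ w α`.
    have hbound : ∀ τ, inner ℝ (γ τ) (lorentz A B τ (γ τ)) / w τ ≤ w τ + α τ := by
      intro τ
      rw [div_le_iff₀ (hwpos τ), inner_phase, lorentz, xpart_pt, vpart_pt, inner_add_right,
        inner_cross_self, add_zero]
      have e1 := real_inner_le_norm (xpart (γ τ)) (vpart (γ τ))
      have e2 := (real_inner_le_norm (vpart (γ τ)) (A τ (xpart (γ τ)))).trans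
        (mul_le_mul ((norm_vpart_le _).trans (hle τ)) (hA τ _) (norm_nonneg _) (hwpos τ).le)
      have e3 := norm_sq_phase (γ τ)
      have e4 := hwsq τ
      nlinarith [sq_nonneg (‖xpart (γ τ)‖ - ‖vpart (γ τ)‖), sq_nonneg ‖γ τ‖, sq_nonneg ε]
    -- Integrating factor for `w' ≤ w + α`. Since `exp (s - τ) ≤ 1` and `α ≥ 0`, the forcing may be
    -- subtracted without the exponential.
    set h : ℝ → ℝ := fun τ => Real.exp (s - τ) * w τ - ∫ σ in s..τ, α σ with hh
    have hhd : ∀ τ, HasDerivAt h (Real.exp (s - τ) * (-1) * w τ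
        + Real.exp (s - τ) * (inner ℝ (γ τ) (lorentz A B τ (γ τ)) / w τ) - α τ) τ := by
      intro τ
      have h1 : HasDerivAt (fun τ => Real.exp (s - τ)) (Real.exp (s - τ) * (-1)) τ :=
        ((hasDerivAt_id τ).const_sub s).exp
      exact (h1.mul (hd τ)).sub (intervalIntegral.integral_hasDerivAt_right
        (hα.intervalIntegrable _ _) (hα.stronglyMeasurableAtFilter _ _) hα.continuousAt)
    have hanti : AntitoneOn h (Icc s t) := by
      refine antitoneOn_of_deriv_nonpos (convex_Icc s t)
        (fun τ _ => (hhd τ).continuousAt.continuousWithinAt)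
        (fun τ _ => (hhd τ).differentiableAt.differentiableWithinAt) fun τ hτ => ?_
      rw [(hhd τ).deriv]
      rw [interior_Icc] at hτ
      have e1 : Real.exp (s - τ) ≤ 1 := Real.exp_le_one_iff.2 (by linarith [hτ.1])
      have e2 := Real.exp_pos (s - τ)
      nlinarith [mul_le_mul_of_nonneg_left (hbound τ) e2.le, hα0 τ,
        mul_le_mul_of_nonneg_right e1 (hα0 τ)]
    have h1 := hanti (left_mem_Icc.2 hst) (right_mem_Icc.2 hst) hst
    simp only [hh, sub_self, Real.exp_zero, one_mul, intervalIntegral.integral_same, sub_zero] at h1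
    have h2 : w s ≤ ‖γ s‖ + ε := by
      refine Real.sqrt_le_iff.2 ⟨by positivity, ?_⟩
      nlinarith [norm_nonneg (γ s)]
    have h3 : Real.exp (t - s) * Real.exp (s - t) = 1 := by
      rw [← Real.exp_add, sub_add_sub_cancel, sub_self, Real.exp_zero]
    calc ‖γ t‖ ≤ w t := hle t
      _ = Real.exp (t - s) * (Real.exp (s - t) * w t) := by rw [← mul_assoc, h3, one_mul]
      _ ≤ _ := by
        gcongr
        linarith
  have hlim : Tendsto (fun ε : ℝ => Real.exp (t - s) * (‖γ s‖ + ε + ∫ τ in s..t, α τ)) (𝓝[>] 0)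
      (𝓝 (Real.exp (t - s) * (‖γ s‖ + 0 + ∫ τ in s..t, α τ))) := by
    refine Tendsto.mono_left (Continuous.tendsto ?_ 0) nhdsWithin_le_nhds
    fun_prop
  rw [add_zero] at hlim
  exact ge_of_tendsto hlim (eventually_mem_nhdsWithin.mono fun ε hε => key ε hε)

variable (hD : D.Tame r M)
include hD

/-- By contraposition: a characteristic inside the ball of radius `r` at time `s` cannot travel
beyond the stated radius by time `t`. Hence those ending far away never meet the data. -/
theorem Coefficients.Tame.curve_far {α : ℝ → ℝ} (hα : Continuous α)
    (hA : ∀ t x, ‖D.A t x‖ ≤ α t) {s t : ℝ} (hs : s ∈ Icc 0 t) (ht : t ≤ T) {z : Phase}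
    (hz : Real.exp T * (r + ∫ τ in (0 : ℝ)..T, α τ) < ‖z‖) :
    r ≤ ‖hD.smoothField.curve t z s‖ := by
  have hα0 : ∀ τ, 0 ≤ α τ := fun τ => (norm_nonneg _).trans (hA τ 0)
  by_contra! hlt
  have h1 := norm_integralCurve_lorentz_le hα hA (hD.smoothField.isIntegralCurve_curve t z) hs.2
  rw [hD.smoothField.curve_self] at h1
  have h2 : ∫ τ in s..t, α τ ≤ ∫ τ in (0 : ℝ)..T, α τ :=
    intervalIntegral.integral_mono_interval hs.1 hs.2 ht (Eventually.of_forall hα0)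
      (hα.intervalIntegrable _ _)
  have h3 : 0 ≤ ∫ τ in s..t, α τ := intervalIntegral.integral_nonneg hs.2 fun τ _ => hα0 τ
  have h4 : Real.exp (t - s) ≤ Real.exp T := Real.exp_le_exp.2 (by linarith [hs.1])
  have h5 : Real.exp (t - s) * (‖hD.smoothField.curve t z s‖ + ∫ τ in s..t, α τ)
      ≤ Real.exp T * (r + ∫ τ in (0 : ℝ)..T, α τ) := by
    gcongr
  linarith

theorem Coefficients.Tame.duhamel_eq_zero {α : ℝ → ℝ} (hα : Continuous α)
    (hA : ∀ t x, ‖D.A t x‖ ≤ α t) {f₀ : Phase → ℝ} {S : ℝ → Phase → ℝ}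
    (hf₀ : ∀ z, r ≤ ‖z‖ → f₀ z = 0) (hS : ∀ t z, r ≤ ‖z‖ → S t z = 0) {t : ℝ}
    (ht : t ∈ Icc 0 T) {z : Phase} (hz : Real.exp T * (r + ∫ τ in (0 : ℝ)..T, α τ) < ‖z‖) :
    hD.smoothField.duhamel f₀ S t z = 0 := by
  rw [SmoothField.duhamel, hf₀ _ (hD.curve_far hα hA (left_mem_Icc.2 ht.1) ht.2 hz), zero_add]
  refine intervalIntegral.integral_zero_ae (Eventually.of_forall fun s hs => ?_)
  rw [uIoc_of_le ht.1] at hs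
  exact hS _ _ (hD.curve_far hα hA (Ioc_subset_Icc_self hs) ht.2 hz)

end Support

/-! ### C¹ estimate for the transport equation. -/

section Estimate

/-- The radius of a ball that contains the supports of all solutions on `[0,T]`. -/
noncomputable def suppRadius (T r M : ℝ) : ℝ := Real.exp T * (r + T * M)

/-- The bound `M` of `A` serves as `α`. The resulting radius depends on `T`, `r`, `M` only, as
uniform constants require; the sharper integral of the norm of `A` is kept for the support statement
of the theorem. -/
theorem Coefficients.Tame.duhamel_eq_zero_of_suppRadius {D : Coefficients} {r M T : ℝ}
    (hD : D.Tame r M) {f₀ : Phase → ℝ} {S : ℝ → Phase → ℝ} (hf₀ : ∀ z, r ≤ ‖z‖ → f₀ z = 0)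
    (hS : ∀ t z, r ≤ ‖z‖ → S t z = 0) {t : ℝ} (ht : t ∈ Icc 0 T) {z : Phase}
    (hz : suppRadius T r M < ‖z‖) : hD.smoothField.duhamel f₀ S t z = 0 := by
  refine hD.duhamel_eq_zero (T := T) (α := fun _ => M) continuous_const (fun t => (hD.A_le t).val)
    hf₀ hS ht ?_
  rw [intervalIntegral.integral_const, sub_zero, smul_eq_mul]
  exact hz

theorem C1Bound.norm_sub_le {E F : Type*} [NormedAddCommGroup E] [NormedSpace ℝ E]
    [NormedAddCommGroup F] [NormedSpace ℝ F] {m : ℝ} {g : E → F} (h : C1Bound m g)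
    (hg : Differentiable ℝ g) (z z' : E) : ‖g z - g z'‖ ≤ m * ‖z - z'‖ :=
  convex_univ.norm_image_sub_le_of_norm_fderiv_le (fun _ _ => hg _) (fun x _ => h.der x)
    (mem_univ z') (mem_univ z)

/-- The Lipschitz constant of the characteristics with data in a ball depends only on the bound
of the coefficients. -/
theorem exists_lipschitz_curve (T r M R : ℝ) (hT : 0 ≤ T) : ∃ L : ℝ, 1 ≤ L ∧
    ∀ (D : Coefficients) (hD : D.Tame r M), ∀ t ∈ Icc 0 T, ∀ s ∈ Icc 0 T,
      ∀ z ∈ Metric.closedBall (0 : Phase) R, ∀ z' ∈ Metric.closedBall (0 : Phase) R,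
      ‖hD.smoothField.curve t z s - hD.smoothField.curve t z' s‖ ≤ L * ‖z - z'‖ := by
  -- The constants come in a chain: `c` governs the growth of the field, `R'` confines curves
  -- starting in the ball of radius `R`, and `K` is the Lipschitz constant of the field on that
  -- larger ball.
  set c := 1 + M + ‖crossL‖ * M with hc
  set R' := gronwallBound R c c T with hR'
  set K := (1 + (M + (‖crossL‖ * R' * M + ‖crossL‖ * M))).toNNReal with hK
  refine ⟨Real.exp (K * T), Real.one_le_exp (by positivity), fun D hD t ht s hs z hz z' hz' => ?_⟩
  have hM : 0 ≤ M := hD.f₀_le.nonneg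
  have hc0 : 0 ≤ c := by positivity
  have hb : ∀ z ∈ Metric.closedBall (0 : Phase) R, ∀ τ ∈ Icc 0 T,
      hD.smoothField.curve t z τ ∈ Metric.closedBall (0 : Phase) R' := by
    intro z hz τ hτ
    rw [mem_closedBall_zero_iff] at hz ⊢
    have h1 := norm_curve_le (S := T) (fun τ _ => norm_lorentz_le (fun t => (hD.A_le t).val)
      (fun t => (hD.B_le t).val) τ _) hc0
      ((hD.smoothField.isIntegralCurve_curve t z).isIntegralCurveOn (Icc 0 T)) ht (by linarith) τ hτ
    rw [hD.smoothField.curve_self] at h1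
    refine h1.trans ?_
    have : gronwallBound ‖z‖ c c T ≤ gronwallBound R c c T := by
      unfold gronwallBound
      split_ifs <;> gcongr
    exact this
  have h1 := dist_curve_le (S := T) (fun τ _ => lipschitzOnWith_lorentz hD.A hD.B
      (fun t => (hD.A_le t).der) (fun t => (hD.B_le t).val) (fun t => (hD.B_le t).der) τ R')
    ((hD.smoothField.isIntegralCurve_curve t z).isIntegralCurveOn (Icc 0 T)) (hb z hz)
    ((hD.smoothField.isIntegralCurve_curve t z').isIntegralCurveOn (Icc 0 T)) (hb z' hz') ht
    (by linarith) s hs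
  rw [hD.smoothField.curve_self, hD.smoothField.curve_self] at h1
  rwa [mul_comm] at h1

/-- The solution of the transport equation is bounded in `C¹` by the data. -/
theorem exists_C1Bound_duhamel (T r M : ℝ) (hT : 0 ≤ T) : ∃ L : ℝ, 1 ≤ L ∧
    ∀ (D : Coefficients) (hD : D.Tame r M) (f₀ : Phase → ℝ) (S : ℝ → Phase → ℝ) (β : ℝ)
      (σ : ℝ → ℝ), ContDiff ℝ 1 f₀ → (∀ z, r ≤ ‖z‖ → f₀ z = 0) → C1Bound β f₀ →
      ContC1 S → (∀ t z, r ≤ ‖z‖ → S t z = 0) → Continuous σ →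
      (∀ t ∈ Icc 0 T, C1Bound (σ t) (S t)) → ∀ t ∈ Icc 0 T,
        C1Bound (L * (β + ∫ s in (0 : ℝ)..t, σ s)) (hD.smoothField.duhamel f₀ S t) := by
  -- The radius is enlarged by one so that every point of the support ball has a neighbourhood in
  -- which the Lipschitz bound holds.
  obtain ⟨L, hL, h⟩ := exists_lipschitz_curve T r M (suppRadius T r M + 1) hT
  refine ⟨L, hL, fun D hD f₀ S β σ hf₀ hf₀s hβ hS hSs hσ hSσ t ht => ?_⟩
  have hint0 : 0 ≤ ∫ s in (0 : ℝ)..t, σ s := intervalIntegral.integral_nonneg ht.1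
    fun s hs => (hSσ s ⟨hs.1, hs.2.trans ht.2⟩).nonneg
  have hβ0 := hβ.nonneg
  have hcont : ∀ z, Continuous fun s => S s (hD.smoothField.curve t z s) := fun z =>
    hS.continuous continuous_id (hD.smoothField.isIntegralCurve_curve t z).continuous
  refine ⟨fun z => ?_, fun z => ?_⟩
  · rw [SmoothField.duhamel]
    refine (norm_add_le _ _).trans ((add_le_add (hβ.val _) ?_).trans
      (le_mul_of_one_le_left (by positivity) hL))
    refine intervalIntegral.norm_integral_le_of_norm_le ht.1 (Eventually.of_forall fun s hs => ?_)
      (hσ.intervalIntegrable _ _)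
    exact (hSσ s ⟨hs.1.le, hs.2.trans ht.2⟩).val _
  · by_cases hz : suppRadius T r M < ‖z‖
    · rw [fderiv_eq_zero_of_lt_norm (fun z hz =>
        hD.duhamel_eq_zero_of_suppRadius hf₀s hSs ht hz) hz, norm_zero]
      positivity
    -- The derivative is controlled through difference quotients. A bound on a ball is enough, since
    -- outside the support the derivative vanishes.
    have hLip : LipschitzOnWith (L * (β + ∫ s in (0 : ℝ)..t, σ s)).toNNReal
        (hD.smoothField.duhamel f₀ S t) (Metric.closedBall 0 (suppRadius T r M + 1)) := by
      refine LipschitzOnWith.of_dist_le_mul fun y hy y' hy' => ?_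
      rw [dist_eq_norm, dist_eq_norm, Real.coe_toNNReal _ (by positivity)]
      have e : hD.smoothField.duhamel f₀ S t y - hD.smoothField.duhamel f₀ S t y'
          = (f₀ (hD.smoothField.curve t y 0) - f₀ (hD.smoothField.curve t y' 0))
            + ∫ s in (0 : ℝ)..t, (S s (hD.smoothField.curve t y s)
              - S s (hD.smoothField.curve t y' s)) := by
        rw [intervalIntegral.integral_sub ((hcont y).intervalIntegrable _ _)
          ((hcont y').intervalIntegrable _ _), SmoothField.duhamel, SmoothField.duhamel]
        ring
      have h1 : ‖f₀ (hD.smoothField.curve t y 0) - f₀ (hD.smoothField.curve t y' 0)‖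
          ≤ β * (L * ‖y - y'‖) :=
        (hβ.norm_sub_le (hf₀.differentiable one_ne_zero) _ _).trans
          (mul_le_mul_of_nonneg_left (h D hD t ht 0 ⟨le_rfl, hT⟩ y hy y' hy') hβ0)
      have h2 : ‖∫ s in (0 : ℝ)..t, (S s (hD.smoothField.curve t y s)
              - S s (hD.smoothField.curve t y' s))‖
          ≤ ∫ s in (0 : ℝ)..t, σ s * (L * ‖y - y'‖) := by
        refine intervalIntegral.norm_integral_le_of_norm_le ht.1
          (Eventually.of_forall fun s hs => ?_) ((hσ.mul continuous_const).intervalIntegrable _ _)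
        have hs' : s ∈ Icc 0 T := ⟨hs.1.le, hs.2.trans ht.2⟩
        exact ((hSσ s hs').norm_sub_le (hS.differentiable s) _ _).trans
          (mul_le_mul_of_nonneg_left (h D hD t ht s hs' y hy y' hy') (hSσ s hs').nonneg)
      rw [intervalIntegral.integral_mul_const] at h2
      rw [e]
      refine (norm_add_le _ _).trans ((add_le_add h1 h2).trans_eq ?_)
      ring
    refine (norm_fderiv_le_of_lipschitzOn ℝ (Metric.closedBall_mem_nhds_of_mem
      (mem_ball_zero_iff.2 (by linarith [not_lt.1 hz]))) hLip).trans_eq ?_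
    exact Real.coe_toNNReal _ (by positivity)

end Estimate

/-! ### Contraction in a weighted C¹ norm and the a priori bound. -/

section Contraction

theorem integral_exp_mul_le {l t : ℝ} (hl : 0 < l) :
    ∫ s in (0 : ℝ)..t, Real.exp (l * s) ≤ Real.exp (l * t) / l := by
  have h : ∀ s ∈ uIcc 0 t, HasDerivAt (fun s => Real.exp (l * s) / l) (Real.exp (l * s)) s := by
    intro s _
    have := (((hasDerivAt_id s).const_mul l).exp).div_const l
    refine this.congr_deriv ?_
    simp only [id, mul_one]
    field_simp
  rw [intervalIntegral.integral_eq_sub_of_hasDerivAt h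
    (Continuous.intervalIntegrable (by fun_prop) _ _), mul_zero, Real.exp_zero]
  have : 0 < 1 / l := by positivity
  linarith

/-- The solution operator contracts a weighted norm, up to the contribution of the data. -/
theorem exists_C1Bound_step (T r M : ℝ) (hT : 0 ≤ T) : ∃ c l : ℝ, 0 ≤ c ∧ 0 ≤ l ∧
    ∀ (D : Coefficients) (hD : D.Tame r M) (f₀ : Phase → ℝ) (b w : ℝ → Phase → ℝ) (β m : ℝ),
      ContDiff ℝ 1 f₀ → (∀ z, r ≤ ‖z‖ → f₀ z = 0) → C1Bound β f₀ →
      ContC1 b → (∀ t z, r ≤ ‖z‖ → b t z = 0) → (∀ t, C1Bound β (b t)) →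
      ContC1 w → (∀ t z, suppRadius T r M < ‖z‖ → w t z = 0) →
      (∀ t ∈ Icc 0 T, C1Bound (m * Real.exp (l * t)) (w t)) → ∀ t ∈ Icc 0 T,
        C1Bound ((c * β + m / 2) * Real.exp (l * t)) (hD.smoothField.duhamel f₀
          (fun t z => linSource (D.a t) (D.C t) D.χ (w t) z + b t z) t) := by
  obtain ⟨L, hL, hduh⟩ := exists_C1Bound_duhamel T r M hT
  obtain ⟨k, hk, hlin⟩ := exists_C1Bound_linSource (suppRadius T r M) M
  -- Integrating `exp (l * s)` gains a factor `1 / l`, so `L * k / l ≤ 1 / 2`; the `+1` keeps `l`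
  -- positive when `k = 0`.
  set l := 2 * L * k + 1 with hl
  have hL0 : 0 < L := by linarith
  have hl0 : 0 < l := by positivity
  refine ⟨L * (1 + T), l, by positivity, hl0.le,
    fun D hD f₀ b w β m hf₀ hf₀s hβ hb hbs hbβ hw hws hm t ht => ?_⟩
  have hβ0 := hβ.nonneg
  have hm0 : 0 ≤ m := by
    have := (hm 0 ⟨le_rfl, hT⟩).nonneg
    rwa [mul_zero, Real.exp_zero, mul_one] at this
  have hS := contC1_linSource hD.a (fun t => (hD.a_le t).der) hD.C hD.χ hw hws
  refine (hduh D hD f₀ _ β (fun s => k * m * Real.exp (l * s) + β) hf₀ hf₀s hβ (hS.add hb)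
    (fun t z hz => ?_) (by fun_prop) (fun s hs => ?_) t ht).mono ?_
  · rw [D.linSource_eq_zero hD _ _ hz, hbs t z hz, add_zero]
  · rw [mul_assoc]
    exact (hlin _ _ _ _ _ (hD.a.contDiff s) (hD.C.contDiff s) hD.χ (hw.contDiff s) (hD.a_le s)
      (hD.C_le s) hD.χ_le (hws s) (hm s hs)).add (hbβ s) (hS.differentiable s)
      (hb.differentiable s)
  · rw [intervalIntegral.integral_add (Continuous.intervalIntegrable (by fun_prop) _ _)
      (Continuous.intervalIntegrable (by fun_prop) _ _), intervalIntegral.integral_const_mul,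
      intervalIntegral.integral_const, sub_zero, smul_eq_mul]
    have h1 := mul_le_mul_of_nonneg_left (integral_exp_mul_le (t := t) hl0)
      (by positivity : 0 ≤ L * (k * m))
    have h2 : L * (k * m) * (Real.exp (l * t) / l) ≤ m / 2 * Real.exp (l * t) := by
      have : L * k / l ≤ 1 / 2 := by
        rw [div_le_div_iff₀ hl0 two_pos]
        linarith
      calc _ = L * k / l * (m * Real.exp (l * t)) := by ring
        _ ≤ 1 / 2 * (m * Real.exp (l * t)) := by gcongr
        _ = _ := by ring
    have h3 : 1 ≤ Real.exp (l * t) := Real.one_le_exp (mul_nonneg hl0.le ht.1)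
    have h4 : L * (β + t * β) ≤ L * (1 + T) * β * Real.exp (l * t) := by
      calc L * (β + t * β) = L * (1 + t) * β * 1 := by ring
        _ ≤ _ := by
          gcongr
          exact ht.2
    calc _ = L * (k * m) * (∫ s in (0 : ℝ)..t, Real.exp (l * s)) + L * (β + t * β) := by ring
      _ ≤ m / 2 * Real.exp (l * t) + L * (1 + T) * β * Real.exp (l * t) :=
        add_le_add (h1.trans h2) h4
      _ = _ := by ring

theorem C1Bound.of_tendsto {E F : Type*} [NormedAddCommGroup E] [NormedSpace ℝ E]
    [NormedAddCommGroup F] [NormedSpace ℝ F] {g : E → F} {m : ℕ → ℝ} {m' : ℝ}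
    (h : ∀ n, C1Bound (m n) g) (hm : Tendsto m atTop (𝓝 m')) : C1Bound m' g :=
  ⟨fun z => ge_of_tendsto hm (Eventually.of_forall fun n => (h n).val z),
    fun z => ge_of_tendsto hm (Eventually.of_forall fun n => (h n).der z)⟩

/-- A priori bound for solutions of Duhamel's formula. -/
theorem exists_C1Bound_solution (T r M : ℝ) (hT : 0 ≤ T) : ∃ c : ℝ, 0 ≤ c ∧
    ∀ (D : Coefficients) (hD : D.Tame r M) (f₀ : Phase → ℝ) (b w : ℝ → Phase → ℝ) (β : ℝ),
      ContDiff ℝ 1 f₀ → (∀ z, r ≤ ‖z‖ → f₀ z = 0) → C1Bound β f₀ →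
      ContC1 b → (∀ t z, r ≤ ‖z‖ → b t z = 0) → (∀ t, C1Bound β (b t)) →
      ContC1 w → (∀ t z, suppRadius T r M < ‖z‖ → w t z = 0) →
      (∀ t ∈ Icc 0 T, w t = hD.smoothField.duhamel f₀
          (fun t z => linSource (D.a t) (D.C t) D.χ (w t) z + b t z) t) →
      ∀ t ∈ Icc 0 T, C1Bound (c * β) (w t) := by
  obtain ⟨c, l, hc, hl, hstep⟩ := exists_C1Bound_step T r M hT
  refine ⟨2 * c * Real.exp (l * T), by positivity,
    fun D hD f₀ b w β hf₀ hf₀s hβ hb hbs hbβ hw hws hweq => ?_⟩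
  have hβ0 := hβ.nonneg
  have hK : IsCompact (Icc (0 : ℝ) T ×ˢ Metric.closedBall (0 : Phase) (suppRadius T r M)) :=
    isCompact_Icc.prod (isCompact_closedBall _ _)
  obtain ⟨m₁, h₁⟩ := hK.exists_bound_of_continuousOn hw.cont.continuousOn
  obtain ⟨m₂, h₂⟩ := hK.exists_bound_of_continuousOn hw.cont'.continuousOn
  set m := max 0 (max m₁ m₂) with hm
  have hm0 : 0 ≤ m := le_max_left _ _
  have hbd : ∀ t ∈ Icc 0 T, C1Bound m (w t) := by
    refine fun t ht => ⟨fun z => ?_, fun z => ?_⟩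
    · by_cases hz : suppRadius T r M < ‖z‖
      · rw [hws t z hz, norm_zero]; exact hm0
      · exact (h₁ (t, z) ⟨ht, by simpa using hz⟩).trans
          ((le_max_left _ _).trans (le_max_right _ _))
    · by_cases hz : suppRadius T r M < ‖z‖
      · rw [fderiv_eq_zero_of_lt_norm (hws t) hz, norm_zero]; exact hm0
      · exact (h₂ (t, z) ⟨ht, by simpa using hz⟩).trans
          ((le_max_right _ _).trans (le_max_right _ _))
  -- A solution is unchanged by the step, which maps a weighted bound `x` to `c * β + x / 2`.
  -- Iterating from a crude bound given by compactness drives it to the fixed point `2 * c * β`.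
  have hn : ∀ n : ℕ, ∀ t ∈ Icc 0 T,
      C1Bound ((2 * c * β + m / 2 ^ n) * Real.exp (l * t)) (w t) := by
    intro n
    induction n with
    | zero =>
      refine fun t ht => (hbd t ht).mono ?_
      have := Real.one_le_exp (mul_nonneg hl ht.1)
      have h2 : 0 ≤ 2 * c * β := by positivity
      rw [pow_zero, div_one]
      nlinarith
    | succ n ih =>
      intro t ht
      rw [hweq t ht]
      refine (hstep D hD f₀ b w β _ hf₀ hf₀s hβ hb hbs hbβ hw hws ih t ht).mono (le_of_eq ?_)
      rw [pow_succ]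
      field_simp
      ring
  intro t ht
  have hlim : Tendsto (fun n : ℕ => (2 * c * β + m / 2 ^ n) * Real.exp (l * t)) atTop
      (𝓝 ((2 * c * β + 0) * Real.exp (l * t))) := by
    refine (tendsto_const_nhds.add ?_).mul_const _
    exact tendsto_const_nhds.div_atTop (tendsto_pow_atTop_atTop_of_one_lt one_lt_two)
  refine (C1Bound.of_tendsto (fun n => hn n t ht) hlim).mono ?_
  have : Real.exp (l * t) ≤ Real.exp (l * T) := by gcongr; exact ht.2
  calc _ = 2 * c * β * Real.exp (l * t) := by ring
    _ ≤ 2 * c * β * Real.exp (l * T) := by gcongr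
    _ = _ := by ring

end Contraction

/-! ### Series converging in C¹, uniformly in time. -/

section Series

variable {E F : Type*} [NormedAddCommGroup E] [NormedSpace ℝ E]
  [NormedAddCommGroup F] [NormedSpace ℝ F] [CompleteSpace F]
  {d : ℕ → ℝ → E → F} {m : ℕ → ℝ}

theorem hasFDerivAt_tsum_of_C1Bound (hd : ∀ n, ContC1 (d n))
    (hb : ∀ n t, C1Bound (m n) (d n t)) (hm : Summable m) (t : ℝ) (z : E) :
    HasFDerivAt (fun z => ∑' n, d n t z) (∑' n, fderiv ℝ (d n t) z) z :=
  hasFDerivAt_tsum hm (fun n z => ((hd n).differentiable t z).hasFDerivAt)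
    (fun n z => (hb n t).der z) (x₀ := 0)
    (Summable.of_norm_bounded hm fun n => (hb n t).val 0) z

theorem contC1_tsum (hd : ∀ n, ContC1 (d n)) (hb : ∀ n t, C1Bound (m n) (d n t))
    (hm : Summable m) : ContC1 fun t z => ∑' n, d n t z :=
  contC1_of_hasFDerivAt (hasFDerivAt_tsum_of_C1Bound hd hb hm)
    (continuous_tsum (fun n => (hd n).cont) hm fun n p => (hb n p.1).val p.2)
    (continuous_tsum (fun n => (hd n).cont') hm fun n p => (hb n p.1).der p.2)

theorem C1Bound_tsum (hd : ∀ n, ContC1 (d n)) (hb : ∀ n t, C1Bound (m n) (d n t))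
    (hm : Summable m) (t : ℝ) : C1Bound (∑' n, m n) fun z => ∑' n, d n t z := by
  refine ⟨fun z => tsum_of_norm_bounded hm.hasSum fun n => (hb n t).val z, fun z => ?_⟩
  rw [(hasFDerivAt_tsum_of_C1Bound hd hb hm t z).fderiv]
  exact tsum_of_norm_bounded hm.hasSum fun n => (hb n t).der z

end Series

/-! ### Existence by a Neumann series and uniqueness for Duhamel's formula. -/

section Neumann

theorem C1Bound_zero {E F : Type*} [NormedAddCommGroup E] [NormedSpace ℝ E]
    [NormedAddCommGroup F] [NormedSpace ℝ F] {m : ℝ} (hm : 0 ≤ m) :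
    C1Bound m fun _ : E => (0 : F) :=
  ⟨fun _ => by simpa using hm, fun _ => by simpa using hm⟩

theorem linSource_zero (a : Phase → ℝ) (C : Phase → E3) (χ : Phase → ℝ) (z : Phase) :
    linSource a C χ (fun _ => 0) z = 0 := by
  simp [linSource, gradient]

theorem linSource_sum {a : Phase → ℝ} {C : Phase → E3} {χ : Phase → ℝ} {d : ℕ → Phase → ℝ}
    {R : ℝ} (ha : ContDiff ℝ 1 a) (hd : ∀ n, ContDiff ℝ 1 (d n))
    (hs : ∀ n z, R < ‖z‖ → d n z = 0) (N : ℕ) (z : Phase) :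
    linSource a C χ (fun z => ∑ n ∈ Finset.range N, d n z) z
      = ∑ n ∈ Finset.range N, linSource a C χ (d n) z := by
  induction N with
  | zero => simpa using linSource_zero a C χ z
  | succ N ih =>
    simp only [Finset.sum_range_succ]
    rw [linSource_add ha (ContDiff.sum fun n _ => hd n)
      (fun z hz => Finset.sum_eq_zero fun n _ => hs n z hz) (hd N) (hs N), ih]

/-- Additivity splits off the tail of the series, whose source is bounded by its C¹ norm, hence by
the tail of `∑ m n`. -/
theorem hasSum_linSource {a : Phase → ℝ} {C : Phase → E3} {χ : Phase → ℝ} {d : ℕ → Phase → ℝ}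
    {m : ℕ → ℝ} {R M : ℝ} (ha : ContDiff ℝ 1 a) (hC : ContDiff ℝ 1 C) (hχ : ContDiff ℝ 1 χ)
    (haM : C1Bound M a) (hCM : C1Bound M C) (hχM : C1Bound M χ) (hd : ∀ n, ContDiff ℝ 1 (d n))
    (hs : ∀ n z, R < ‖z‖ → d n z = 0) (hb : ∀ n, C1Bound (m n) (d n)) (hm : Summable m)
    (z : Phase) :
    HasSum (fun n => linSource a C χ (d n) z) (linSource a C χ (fun z => ∑' n, d n z) z) := by
  obtain ⟨k, hk, hlin⟩ := exists_C1Bound_linSource R M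
  have hsum : Summable fun n => linSource a C χ (d n) z :=
    Summable.of_norm_bounded (hm.mul_left k) fun n =>
      (hlin _ _ _ _ _ ha hC hχ (hd n) haM hCM hχM (hs n) (hb n)).val z
  rw [hsum.hasSum_iff_tendsto_nat, tendsto_iff_norm_sub_tendsto_zero]
  have hval : ∀ z, Summable fun n => d n z := fun z =>
    Summable.of_norm_bounded hm fun n => (hb n).val z
  have hz : Tendsto (fun N => k * ∑' n, m (n + N)) atTop (𝓝 0) := by
    simpa using (tendsto_sum_nat_add m).const_mul k
  refine squeeze_zero (fun _ => norm_nonneg _) (fun N => ?_) hz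
  have hmN : Summable fun n => m (n + N) := (summable_nat_add_iff N).2 hm
  have htail := contC1_tsum (d := fun n (_ : ℝ) => d (n + N)) (fun n => contC1_const (hd _))
    (fun n _ => hb (n + N)) hmN
  have htb := C1Bound_tsum (d := fun n (_ : ℝ) => d (n + N)) (fun n => contC1_const (hd _))
    (fun n _ => hb (n + N)) hmN 0
  have hts : ∀ z, R < ‖z‖ → ∑' n, d (n + N) z = 0 := fun z hz => by
    simp only [hs _ z hz, tsum_zero]
  have e : (fun z => ∑' n, d n z)
      = fun z => (∑ n ∈ Finset.range N, d n z) + ∑' n, d (n + N) z := by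
    ext z
    exact ((hval z).sum_add_tsum_nat_add N).symm
  rw [e, linSource_add ha (ContDiff.sum fun n _ => hd n)
      (fun z hz => Finset.sum_eq_zero fun n _ => hs n z hz) (htail.contDiff 0) hts,
    linSource_sum ha hd hs, sub_add_cancel_left, norm_neg]
  exact (hlin _ _ _ _ _ ha hC hχ (htail.contDiff 0) haM hCM hχM hts htb).val z

variable {D : Coefficients} {r M : ℝ} (hD : D.Tame r M) (T : ℝ)

/-- The solution of the linear transport equation with the source given by `w` and `b`, frozen
outside `[0,T]`. -/
noncomputable def Coefficients.Tame.step (f₀ : Phase → ℝ) (b w : ℝ → Phase → ℝ) (t : ℝ) :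
    Phase → ℝ :=
  hD.smoothField.duhamel f₀ (fun t z => linSource (D.a t) (D.C t) D.χ (w t) z + b t z)
    (timeClamp T t)

/-- The terms of the Neumann series of the solution. -/
noncomputable def Coefficients.Tame.neumann : ℕ → ℝ → Phase → ℝ
  | 0 => hD.step T D.f₀ D.b fun _ _ => 0
  | n + 1 => hD.step T (fun _ => 0) (fun _ _ => 0) (neumann n)

/-- Regular in space, and supported in a fixed ball. -/
structure Admissible (R : ℝ) (w : ℝ → Phase → ℝ) : Prop where
  contC1 : ContC1 w
  zero : ∀ t z, R < ‖z‖ → w t z = 0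

variable {T}
include hD

theorem Coefficients.Tame.contC1_source {R : ℝ} {b w : ℝ → Phase → ℝ} (hb : ContC1 b)
    (hw : Admissible R w) :
    ContC1 fun t z => linSource (D.a t) (D.C t) D.χ (w t) z + b t z :=
  (contC1_linSource hD.a (fun t => (hD.a_le t).der) hD.C hD.χ hw.contC1 hw.zero).add hb

theorem Coefficients.Tame.admissible_step {R : ℝ} (hT : 0 ≤ T) {f₀ : Phase → ℝ}
    {b w : ℝ → Phase → ℝ} (hf₀ : ContDiff ℝ 1 f₀) (hf₀s : ∀ z, r ≤ ‖z‖ → f₀ z = 0) (hb : ContC1 b)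
    (hbs : ∀ t z, r ≤ ‖z‖ → b t z = 0) (hw : Admissible R w) :
    Admissible (suppRadius T r M) (hD.step T f₀ b w) := by
  have hS := hD.contC1_source hb hw
  have h1 := hD.smoothField.contDiff_duhamel hf₀
    (fun s z => (hS.differentiable s z).hasFDerivAt) hS.cont hS.cont'
  refine ⟨contC1_of_hasFDerivAt (u' := fun t z => (fderiv ℝ (fun p : ℝ × Phase =>
    hD.smoothField.duhamel f₀ (fun t z => linSource (D.a t) (D.C t) D.χ (w t) z + b t z) p.1 p.2)
    (timeClamp T t, z)).comp (ContinuousLinearMap.inr ℝ ℝ Phase)) (fun t z => ?_) ?_ ?_,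
    fun t z hz => ?_⟩
  · exact ((h1.differentiable one_ne_zero (timeClamp T t, z)).hasFDerivAt).comp z
      (hasFDerivAt_prodMk_right (timeClamp T t) z)
  · exact h1.continuous.comp (((continuous_clamp T).comp continuous_fst).prodMk continuous_snd)
  · exact ((h1.continuous_fderiv one_ne_zero).comp
      (((continuous_clamp T).comp continuous_fst).prodMk continuous_snd)).clm_comp
      continuous_const
  · refine hD.duhamel_eq_zero_of_suppRadius hf₀s (fun t z hz => ?_) (clamp_mem hT t) hz
    rw [D.linSource_eq_zero hD _ _ hz, hbs t z hz, add_zero]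

theorem Coefficients.Tame.admissible_neumann (hT : 0 ≤ T) (n : ℕ) :
    Admissible (suppRadius T r M) (hD.neumann T n) := by
  have h0 : Admissible (suppRadius T r M) fun _ _ => 0 :=
    ⟨contC1_const contDiff_const, fun _ _ _ => rfl⟩
  induction n with
  | zero => exact hD.admissible_step hT hD.f₀ hD.f₀_zero hD.b hD.b_zero h0
  | succ n ih =>
    exact hD.admissible_step hT contDiff_const (fun _ _ => rfl) h0.contC1 (fun _ _ _ => rfl) ih

/-- All terms but the first have zero data, so each step halves the weighted bound. -/
theorem Coefficients.Tame.exists_C1Bound_neumann (hT : 0 ≤ T) : ∃ k : ℝ, 0 ≤ k ∧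
    ∀ n t, C1Bound (k / 2 ^ n) (hD.neumann T n t) := by
  obtain ⟨c, l, hc, hl, hstep⟩ := exists_C1Bound_step T r M hT
  have hM := hD.f₀_le.nonneg
  have h0 : ContC1 fun (_ : ℝ) (_ : Phase) => (0 : ℝ) := contC1_const contDiff_const
  have key : ∀ n, ∀ t ∈ Icc 0 T,
      C1Bound (c * M / 2 ^ n * Real.exp (l * t)) (hD.neumann T n t) := by
    intro n
    induction n with
    | zero =>
      intro t ht
      have := hstep D hD D.f₀ D.b (fun _ _ => 0) M 0 hD.f₀ hD.f₀_zero hD.f₀_le hD.b hD.b_zero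
        hD.b_le h0 (fun _ _ _ => rfl) (fun t _ => C1Bound_zero (by simp)) t ht
      rw [Coefficients.Tame.neumann, Coefficients.Tame.step, clamp_of_mem ht]
      simpa using this
    | succ n ih =>
      intro t ht
      have hn := hD.admissible_neumann hT n
      have := hstep D hD (fun _ => 0) (fun _ _ => 0) (hD.neumann T n) 0 _ contDiff_const
        (fun _ _ => rfl) (C1Bound_zero le_rfl) h0 (fun _ _ _ => rfl) (fun _ => C1Bound_zero le_rfl)
        hn.contC1 hn.zero ih t ht
      rw [Coefficients.Tame.neumann, Coefficients.Tame.step, clamp_of_mem ht]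
      refine this.mono (le_of_eq ?_)
      rw [pow_succ]
      field_simp
      ring
  refine ⟨c * M * Real.exp (l * T), by positivity, fun n t => ?_⟩
  have e : hD.neumann T n t = hD.neumann T n (timeClamp T t) := by
    cases n <;> simp only [Coefficients.Tame.neumann, Coefficients.Tame.step,
      clamp_of_mem (clamp_mem hT t)]
  rw [e]
  refine (key n _ (clamp_mem hT t)).mono ?_
  calc _ ≤ c * M / 2 ^ n * Real.exp (l * T) := by
        gcongr
        exact (clamp_mem hT t).2
    _ = _ := by ring

/-- Existence of a solution of Duhamel's formula. -/
theorem Coefficients.Tame.exists_solution (hT : 0 ≤ T) :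
    ∃ w : ℝ → Phase → ℝ, Admissible (suppRadius T r M) w ∧
      ∀ t ∈ Icc 0 T, w t = hD.smoothField.duhamel D.f₀
        (fun t z => linSource (D.a t) (D.C t) D.χ (w t) z + D.b t z) t := by
  obtain ⟨k, hk, hb⟩ := hD.exists_C1Bound_neumann hT
  have hm : Summable fun n : ℕ => k / 2 ^ n := by
    simpa [div_eq_mul_inv] using (summable_geometric_two).mul_left k
  have hadm := hD.admissible_neumann hT
  have hw : Admissible (suppRadius T r M) fun t z => ∑' n, hD.neumann T n t z :=
    ⟨contC1_tsum (fun n => (hadm n).contC1) hb hm,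
      fun t z hz => by simp only [(hadm _).zero t z hz, tsum_zero]⟩
  refine ⟨_, hw, fun t ht => ?_⟩
  ext z
  obtain ⟨κ, hκ, hlin⟩ := exists_C1Bound_linSource (suppRadius T r M) M
  have hY : Continuous (hD.smoothField.curve t z) :=
    (hD.smoothField.isIntegralCurve_curve t z).continuous
  have hcont : ∀ {w : ℝ → Phase → ℝ}, Admissible (suppRadius T r M) w →
      Continuous fun s => linSource (D.a s) (D.C s) D.χ (w s) (hD.smoothField.curve t z s) :=
    fun {w} hw => (contC1_linSource hD.a (fun t => (hD.a_le t).der) hD.C hD.χ hw.contC1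
      hw.zero).continuous continuous_id hY
  -- Summation commutes with the source and with the time integral. The left-hand terms are the
  -- Neumann terms shifted by one, so summing gives Duhamel's formula.
  have hsum : HasSum (fun n => ∫ s in (0 : ℝ)..t, linSource (D.a s) (D.C s) D.χ
        (hD.neumann T n s) (hD.smoothField.curve t z s))
      (∫ s in (0 : ℝ)..t, linSource (D.a s) (D.C s) D.χ
        (fun z => ∑' n, hD.neumann T n s z) (hD.smoothField.curve t z s)) := by
    refine intervalIntegral.hasSum_integral_of_dominated_convergence
      (bound := fun n _ => κ * (k / 2 ^ n)) (fun n => (hcont (hadm n)).aestronglyMeasurable)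
      (fun n => Eventually.of_forall fun s _ => ?_)
      (Eventually.of_forall fun s _ => hm.mul_left κ) (by simp)
      (Eventually.of_forall fun s _ => ?_)
    · exact (hlin _ _ _ _ _ (hD.a.contDiff s) (hD.C.contDiff s) hD.χ
        ((hadm n).contC1.contDiff s) (hD.a_le s) (hD.C_le s) hD.χ_le ((hadm n).zero s)
        (hb n s)).val _
    · exact hasSum_linSource (hD.a.contDiff s) (hD.C.contDiff s) hD.χ (hD.a_le s) (hD.C_le s)
        hD.χ_le (fun n => (hadm n).contC1.contDiff s) (fun n => (hadm n).zero s)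
        (fun n => hb n s) hm _
  have e0 : hD.neumann T 0 t z = D.f₀ (hD.smoothField.curve t z 0)
      + ∫ s in (0 : ℝ)..t, D.b s (hD.smoothField.curve t z s) := by
    simp only [Coefficients.Tame.neumann, Coefficients.Tame.step, clamp_of_mem ht,
      SmoothField.duhamel, linSource_zero, zero_add]
  have e1 : ∀ n, hD.neumann T (n + 1) t z = ∫ s in (0 : ℝ)..t, linSource (D.a s) (D.C s) D.χ
        (hD.neumann T n s) (hD.smoothField.curve t z s) := fun n => by
    simp only [Coefficients.Tame.neumann, Coefficients.Tame.step, clamp_of_mem ht,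
      SmoothField.duhamel, add_zero, zero_add]
  have hS : Summable fun n => hD.neumann T n t z :=
    Summable.of_norm_bounded hm fun n => (hb n t).val z
  rw [hS.tsum_eq_zero_add, e0]
  simp only [e1]
  have hbc : Continuous fun s => D.b s (hD.smoothField.curve t z s) :=
    hD.b.continuous continuous_id hY
  rw [hsum.tsum_eq, SmoothField.duhamel, intervalIntegral.integral_add
    ((hcont hw).intervalIntegrable _ _)
    (hbc.intervalIntegrable _ _)]
  ring

/-- Uniqueness of the solution of Duhamel's formula. -/
theorem Coefficients.Tame.solution_unique (hT : 0 ≤ T) {w w' : ℝ → Phase → ℝ}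
    (hw : Admissible (suppRadius T r M) w) (hw' : Admissible (suppRadius T r M) w')
    (h : ∀ t ∈ Icc 0 T, w t = hD.smoothField.duhamel D.f₀
        (fun t z => linSource (D.a t) (D.C t) D.χ (w t) z + D.b t z) t)
    (h' : ∀ t ∈ Icc 0 T, w' t = hD.smoothField.duhamel D.f₀
        (fun t z => linSource (D.a t) (D.C t) D.χ (w' t) z + D.b t z) t)
    {t : ℝ} (ht : t ∈ Icc 0 T) : w t = w' t := by
  obtain ⟨c, -, hc⟩ := exists_C1Bound_solution T r M hT
  -- The difference solves Duhamel's formula with zero data, so the a priori bound forces it to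
  -- vanish.
  have hv : Admissible (suppRadius T r M) fun t z => w t z + -w' t z :=
    ⟨hw.contC1.add hw'.contC1.neg, fun t z hz => by rw [hw.zero t z hz, hw'.zero t z hz]; simp⟩
  have hlin : ∀ s z, linSource (D.a s) (D.C s) D.χ (fun z => w s z + -w' s z) z
      = linSource (D.a s) (D.C s) D.χ (w s) z - linSource (D.a s) (D.C s) D.χ (w' s) z := by
    intro s z
    rw [eq_sub_iff_add_eq, ← linSource_add (hD.a.contDiff s) (hv.contC1.contDiff s) (hv.zero s)
      (hw'.contC1.contDiff s) (hw'.zero s)]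
    simp
  have hb := hc D hD (fun _ => 0) (fun _ _ => 0) (fun t z => w t z + -w' t z) 0 contDiff_const
    (fun _ _ => rfl) (C1Bound_zero le_rfl) (contC1_const contDiff_const) (fun _ _ _ => rfl)
    (fun _ => C1Bound_zero le_rfl) hv.contC1 hv.zero (fun t ht => ?_) t ht
  · ext z
    have := hb.val z
    rw [mul_zero, norm_le_zero_iff] at this
    linarith
  · ext z
    have hY : Continuous (hD.smoothField.curve t z) :=
      (hD.smoothField.isIntegralCurve_curve t z).continuous
    have hI : ∀ {w : ℝ → Phase → ℝ}, Admissible (suppRadius T r M) w → IntervalIntegrable (fun s =>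
        linSource (D.a s) (D.C s) D.χ (w s) (hD.smoothField.curve t z s)
          + D.b s (hD.smoothField.curve t z s)) volume 0 t := fun hw =>
      ((hD.contC1_source hD.b hw).continuous continuous_id hY).intervalIntegrable _ _
    rw [h t ht, h' t ht]
    simp only [SmoothField.duhamel, hlin, add_zero, zero_add]
    rw [← sub_eq_add_neg, add_sub_add_left_eq_sub, ← intervalIntegral.integral_sub (hI hw) (hI hw')]
    simp only [add_sub_add_right_eq_sub]

end Neumann

/-! ### Classical solutions versus Duhamel's formula. -/

section Classical

theorem fderiv_lorentz {g : Phase → ℝ} {z : Phase} (hg : DifferentiableAt ℝ g z)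
    (A B : ℝ → E3 → E3) (t : ℝ) :
    fderiv ℝ g z (lorentz A B t z) = inner ℝ (vpart z) (gradX g z)
      + inner ℝ (A t (xpart z)) (gradV g z)
      + inner ℝ (cross (vpart z) (B t (xpart z))) (gradV g z) := by
  rw [real_inner_comm, inner_gradX hg, real_inner_comm, inner_gradV hg, real_inner_comm,
    inner_gradV hg, ← map_add, ← map_add]
  congr 1
  rw [← pt_add, ← pt_add, lorentz, add_zero, add_zero, zero_add]

variable {g : ℝ → Phase → ℝ} {T : ℝ}

theorem hasFDerivAt_slice_of_contDiffOn
    (hg : ContDiffOn ℝ 1 (fun p : ℝ × Phase => g p.1 p.2) (Icc 0 T ×ˢ univ))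
    {t : ℝ} (ht : t ∈ Icc 0 T) (z : Phase) :
    HasFDerivAt (g t) ((fderivWithin ℝ (fun p : ℝ × Phase => g p.1 p.2) (Icc 0 T ×ˢ univ)
      (t, z)).comp (ContinuousLinearMap.inr ℝ ℝ Phase)) z := by
  have h1 := (hg.differentiableOn one_ne_zero (t, z) ⟨ht, mem_univ z⟩).hasFDerivWithinAt
  have h2 := h1.comp (s := univ) z (f := fun z => (t, z))
    (hasFDerivAt_prodMk_right t z).hasFDerivWithinAt fun z _ => ⟨ht, mem_univ z⟩
  exact h2.hasFDerivAt univ_mem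

theorem fderivWithin_eq_derivWithin_add (hT : 0 < T)
    (hg : ContDiffOn ℝ 1 (fun p : ℝ × Phase => g p.1 p.2) (Icc 0 T ×ˢ univ))
    {t : ℝ} (ht : t ∈ Icc 0 T) (z h : Phase) :
    fderivWithin ℝ (fun p : ℝ × Phase => g p.1 p.2) (Icc 0 T ×ˢ univ) (t, z) (1, h)
      = derivWithin (fun τ => g τ z) (Icc 0 T) t + fderiv ℝ (g t) z h := by
  have h1 := (hg.differentiableOn one_ne_zero (t, z) ⟨ht, mem_univ z⟩).hasFDerivWithinAt
  have h2 : HasDerivWithinAt (fun τ => (τ, z)) ((1 : ℝ), (0 : Phase)) (Icc 0 T) t :=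
    ((hasDerivAt_id t).prodMk (hasDerivAt_const t z)).hasDerivWithinAt
  have h3 := h1.comp_hasDerivWithinAt (f := fun τ => (τ, z)) t h2 fun τ hτ => ⟨hτ, mem_univ z⟩
  have h4 := h3.derivWithin (uniqueDiffOn_Icc hT t ht)
  rw [(hasFDerivAt_slice_of_contDiffOn hg ht z).fderiv]
  simp only [Function.comp_def] at h4
  rw [h4, ContinuousLinearMap.comp_apply, ContinuousLinearMap.inr_apply, ← map_add]
  simp

variable {D : Coefficients} {r M : ℝ}

/-- The left-hand side of the equation is the derivative within the strip in the direction `(1,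
lorentz)`, with the one-sided time derivatives included. -/
theorem Coefficients.isClassicalSolution_iff (hT : 0 < T) :
    D.IsClassicalSolution T g ↔
      ContDiffOn ℝ 1 (fun p : ℝ × Phase => g p.1 p.2) (Icc 0 T ×ˢ univ) ∧
      (∀ t ∈ Icc 0 T, ∀ z, fderivWithin ℝ (fun p : ℝ × Phase => g p.1 p.2) (Icc 0 T ×ˢ univ) (t, z)
        (1, lorentz D.A D.B t z) = D.source g t z) ∧ g 0 = D.f₀ := by
  have key : ∀ (_ : ContDiffOn ℝ 1 (fun p : ℝ × Phase => g p.1 p.2) (Icc 0 T ×ˢ univ)),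
      ∀ t ∈ Icc 0 T, ∀ z,
      fderivWithin ℝ (fun p : ℝ × Phase => g p.1 p.2) (Icc 0 T ×ˢ univ) (t, z)
        (1, lorentz D.A D.B t z) = derivWithin (fun τ => g τ z) (Icc (0 : ℝ) T) t
      + inner ℝ (vpart z) (gradX (g t) z) + inner ℝ (D.A t (xpart z)) (gradV (g t) z)
      + inner ℝ (cross (vpart z) (D.B t (xpart z))) (gradV (g t) z) := fun hg t ht z => by
    rw [fderivWithin_eq_derivWithin_add hT hg ht, fderiv_lorentz
      (hasFDerivAt_slice_of_contDiffOn hg ht z).differentiableAt]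
    ring
  constructor
  · exact fun h => ⟨h.contDiffOn, fun t ht z => (key h.contDiffOn t ht z).trans
      (h.equation t ht z), funext h.initial⟩
  · exact fun ⟨h1, h2, h3⟩ => ⟨h1, fun t ht z => (key h1 t ht z).symm.trans (h2 t ht z),
      congr_fun h3⟩

variable (hD : D.Tame r M)
include hD

theorem Coefficients.Tame.eq_duhamel (hT : 0 < T) (hg : D.IsClassicalSolution T g) {t : ℝ}
    (ht : t ∈ Icc 0 T) (z : Phase) :
    g t z = hD.smoothField.duhamel D.f₀ (D.source g) t z := by
  obtain ⟨h1, h2, h3⟩ := (D.isClassicalSolution_iff hT).1 hg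
  rw [← h3]
  exact hD.smoothField.eq_duhamel hT h1 h2 ht z

theorem Coefficients.Tame.source_eq_zero (t : ℝ) {z : Phase} (hz : r ≤ ‖z‖) :
    D.source g t z = 0 := by
  rw [source_eq_linSource, D.linSource_eq_zero hD _ _ hz, hD.b_zero t z hz, add_zero]

/-- Although no support condition is imposed on a solution, Duhamel's formula and the localised
source confine it to a fixed ball, where the linear theory applies. -/
theorem Coefficients.Tame.admissible_of_solution (hT : 0 < T) (hg : D.IsClassicalSolution T g) :
    Admissible (suppRadius T r M) fun t => g (timeClamp T t) := by
  have hc := hg.contDiffOn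
  have hmap : ∀ p : ℝ × Phase, (timeClamp T p.1, p.2) ∈ Icc 0 T ×ˢ univ :=
    fun p => ⟨clamp_mem hT.le _, mem_univ _⟩
  have hcl : Continuous fun p : ℝ × Phase => (timeClamp T p.1, p.2) :=
    ((continuous_clamp T).comp continuous_fst).prodMk continuous_snd
  refine ⟨contC1_of_hasFDerivAt (fun t z => hasFDerivAt_slice_of_contDiffOn hc
    (clamp_mem hT.le t) z) (hc.continuousOn.comp_continuous hcl hmap) ?_, fun t z hz => ?_⟩
  · exact ((hc.continuousOn_fderivWithin ((uniqueDiffOn_Icc hT).prod uniqueDiffOn_univ)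
      le_rfl).comp_continuous hcl hmap).clm_comp continuous_const
  · rw [hD.eq_duhamel hT hg (clamp_mem hT.le t)]
    exact hD.duhamel_eq_zero_of_suppRadius hD.f₀_zero (fun t z hz => hD.source_eq_zero t hz)
      (clamp_mem hT.le t) hz

theorem Coefficients.Tame.solution_eq_duhamel (hT : 0 < T) (hg : D.IsClassicalSolution T g) :
    ∀ t ∈ Icc 0 T, g (timeClamp T t) = hD.smoothField.duhamel D.f₀
      (fun t z => linSource (D.a t) (D.C t) D.χ (g (timeClamp T t)) z + D.b t z) t := by
  intro t ht
  ext z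
  rw [clamp_of_mem ht, hD.eq_duhamel hT hg ht z, SmoothField.duhamel, SmoothField.duhamel]
  congr 1
  refine intervalIntegral.integral_congr fun s hs => ?_
  rw [uIcc_of_le ht.1] at hs
  simp only [clamp_of_mem (⟨hs.1, hs.2.trans ht.2⟩ : s ∈ Icc 0 T), source_eq_linSource]

theorem Coefficients.Tame.classical_unique (hT : 0 < T) {g' : ℝ → Phase → ℝ}
    (hg : D.IsClassicalSolution T g) (hg' : D.IsClassicalSolution T g') {t : ℝ}
    (ht : t ∈ Icc 0 T) : g t = g' t := by
  have := hD.solution_unique hT.le (hD.admissible_of_solution hT hg)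
    (hD.admissible_of_solution hT hg') (hD.solution_eq_duhamel hT hg)
    (hD.solution_eq_duhamel hT hg') ht
  rwa [clamp_of_mem ht] at this

theorem Coefficients.Tame.exists_classical (hT : 0 < T) :
    ∃ f : ℝ → Phase → ℝ, D.IsClassicalSolution T f := by
  obtain ⟨w, hw, hweq⟩ := hD.exists_solution hT.le
  have hS := hD.contC1_source hD.b hw
  have hd := fun s z => (hS.differentiable s z).hasFDerivAt
  have h1 := hD.smoothField.contDiff_duhamel hD.f₀ hd hS.cont hS.cont'
  -- The fixed point `w` is only known to be C¹ in space; its Duhamel representation agrees with it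
  -- on `[0,T]` and is C¹ in time and space jointly.
  refine ⟨fun t z => hD.smoothField.duhamel D.f₀
    (fun t z => linSource (D.a t) (D.C t) D.χ (w t) z + D.b t z) t z,
    (D.isClassicalSolution_iff hT).2 ⟨h1.contDiffOn, fun t ht z => ?_, ?_⟩⟩
  · rw [((h1.differentiable one_ne_zero) _).fderivWithin
      ((uniqueDiffOn_Icc hT).prod uniqueDiffOn_univ _ ⟨ht, mem_univ z⟩),
      hD.smoothField.fderiv_duhamel hD.f₀ hd hS.cont hS.cont', source_eq_linSource]
    simp only [← hweq t ht]
  · ext z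
    simp [SmoothField.duhamel]

omit hD

/-- A priori bound of classical solutions in `C¹`. -/
theorem exists_spaceTimeC1bNorm_le (T r M : ℝ) (hT : 0 < T) : ∃ K : ℝ≥0, 0 < K ∧
    ∀ D : Coefficients, D.Tame r M → ∀ g, D.IsClassicalSolution T g →
      spaceTimeC1bNorm T g ≤ K := by
  obtain ⟨c, hc, hsol⟩ := exists_C1Bound_solution T r M hT.le
  obtain ⟨k, hk, hlin⟩ := exists_C1Bound_linSource (suppRadius T r M) M
  set q := 1 + M + ‖crossL‖ * M with hq
  -- The time derivative is the source minus the transport term. The first summands bound the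
  -- source; the last bounds the derivative of `g` times the field on the support, where `‖z‖` is at
  -- most `suppRadius T r M`.
  set K : ℝ := k * (c * M) + M + c * M * (q * max 0 (suppRadius T r M) + q) with hK
  refine ⟨(c * M).toNNReal + K.toNNReal + (c * M).toNNReal + 1, by positivity,
    fun D hD g hg => ?_⟩
  have hM : 0 ≤ M := hD.f₀_le.nonneg
  have hq0 : 0 ≤ q := by positivity
  have hadm := hD.admissible_of_solution hT hg
  have hb : ∀ t ∈ Icc 0 T, C1Bound (c * M) (g t) := by
    intro t ht
    have := hsol D hD D.f₀ D.b _ M hD.f₀ hD.f₀_zero hD.f₀_le hD.b hD.b_zero hD.b_le hadm.contC1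
      hadm.zero (hD.solution_eq_duhamel hT hg) t ht
    rwa [clamp_of_mem ht] at this
  have hle : ∀ {V : Type} [NormedAddCommGroup V] {x : V} {m : ℝ}, ‖x‖ ≤ m →
      ‖x‖ₑ ≤ (m.toNNReal : ℝ≥0∞) := fun {V} _ {x m} h => by
    rw [enorm_le_coe, ← NNReal.coe_le_coe, coe_nnnorm]
    exact h.trans (Real.le_coe_toNNReal m)
  have htime : ∀ t ∈ Icc 0 T, ∀ z, ‖derivWithin (fun τ => g τ z) (Icc (0 : ℝ) T) t‖ ≤ K := by
    intro t ht z
    have h1 := ((D.isClassicalSolution_iff hT).1 hg).2.1 t ht z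
    rw [fderivWithin_eq_derivWithin_add hT hg.contDiffOn ht] at h1
    have hgt : ContDiff ℝ 1 (g t) := by
      have := hadm.contC1.contDiff t
      rwa [clamp_of_mem ht] at this
    have hgz : ∀ z, suppRadius T r M < ‖z‖ → g t z = 0 := by
      have := hadm.zero t
      rwa [clamp_of_mem ht] at this
    have hs : ‖D.source g t z‖ ≤ k * (c * M) + M := by
      rw [source_eq_linSource]
      exact (norm_add_le _ _).trans (add_le_add ((hlin _ _ _ _ _ (hD.a.contDiff t)
        (hD.C.contDiff t) hD.χ hgt (hD.a_le t) (hD.C_le t) hD.χ_le hgz (hb t ht)).val z)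
        ((hD.b_le t).val z))
    have hf : ‖fderiv ℝ (g t) z (lorentz D.A D.B t z)‖
        ≤ c * M * (q * max 0 (suppRadius T r M) + q) := by
      by_cases hz : suppRadius T r M < ‖z‖
      · rw [fderiv_eq_zero_of_lt_norm hgz hz, zero_apply, norm_zero]
        positivity
      · refine ((fderiv ℝ (g t) z).le_opNorm _).trans (mul_le_mul ((hb t ht).der z) ?_
          (norm_nonneg _) (by positivity))
        refine (norm_lorentz_le (fun t => (hD.A_le t).val) (fun t => (hD.B_le t).val) t z).trans ?_
        gcongr
        exact (not_lt.1 hz).trans (le_max_right _ _)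
    rw [← eq_sub_iff_add_eq] at h1
    rw [h1]
    exact (norm_sub_le _ _).trans (add_le_add hs hf)
  have e1 : (⨆ t ∈ Icc (0 : ℝ) T, ⨆ z, ‖g t z‖ₑ) ≤ ((c * M).toNNReal : ℝ≥0∞) :=
    iSup₂_le fun t ht => iSup_le fun z => hle ((hb t ht).val z)
  have e2 : (⨆ t ∈ Icc (0 : ℝ) T, ⨆ z, ‖derivWithin (fun τ => g τ z) (Icc (0 : ℝ) T) t‖ₑ)
      ≤ (K.toNNReal : ℝ≥0∞) :=
    iSup₂_le fun t ht => iSup_le fun z => hle (htime t ht z)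
  have e3 : (⨆ t ∈ Icc (0 : ℝ) T, ⨆ z, ‖fderiv ℝ (g t) z‖ₑ) ≤ ((c * M).toNNReal : ℝ≥0∞) :=
    iSup₂_le fun t ht => iSup_le fun z => hle ((hb t ht).der z)
  rw [spaceTimeC1bNorm]
  refine (add_le_add (add_le_add e1 e2) e3).trans ?_
  push_cast
  exact le_self_add

end Classical

/-! ### The norm of `A` in `L²(0,T; L^∞)`. -/

section Zeta

variable {T : ℝ} {A : ℝ → E3 → E3}

/-- The set where the bound holds is closed by continuity and of full measure, hence dense. It turns
the essential supremum in `zeta` into the pointwise bound used for characteristics. -/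
theorem enorm_le_eLpNorm_top {u : E3 → E3} (hu : Continuous u) (x : E3) :
    ‖u x‖ₑ ≤ eLpNorm u ∞ volume := by
  have h1 : ∀ᵐ x, ‖u x‖ₑ ≤ eLpNorm u ∞ volume := by
    rw [eLpNorm_exponent_top]
    exact ae_le_eLpNormEssSup
  have h2 : IsClosed {x | ‖u x‖ₑ ≤ eLpNorm u ∞ volume} := isClosed_le hu.enorm continuous_const
  exact h2.closure_subset_iff.2 subset_rfl (Measure.dense_of_ae h1 x)

theorem eLpNorm_top_le_c1bNorm (u : E3 → E3) : eLpNorm u ∞ volume ≤ c1bNorm u := by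
  rw [eLpNorm_exponent_top]
  exact essSup_le_of_ae_le _ (Eventually.of_forall fun x => enorm_le_c1bNorm u x)

/-- The function `t ↦ ‖A(t)‖_{L^∞}`, frozen outside `[0,T]`. -/
noncomputable def supNorm (T : ℝ) (A : ℝ → E3 → E3) (t : ℝ) : ℝ :=
  (eLpNorm (A (timeClamp T t)) ∞ volume).toReal

theorem MemCTC1b.eLpNorm_ne_top (hA : MemCTC1b T A) {t : ℝ} (ht : t ∈ Icc 0 T) :
    eLpNorm (A t) ∞ volume ≠ ∞ :=
  ((eLpNorm_top_le_c1bNorm _).trans_lt (hA.1 t ht).2).ne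

theorem MemCTC1b.norm_le_supNorm (hT : 0 ≤ T) (hA : MemCTC1b T A) (t : ℝ) (x : E3) :
    ‖A (timeClamp T t) x‖ ≤ supNorm T A t := by
  have h := enorm_le_eLpNorm_top (hA.1 _ (clamp_mem hT t)).1.continuous x
  have := ENNReal.toReal_mono (hA.eLpNorm_ne_top (clamp_mem hT t)) h
  rwa [toReal_enorm] at this

theorem MemCTC1b.continuous_supNorm (hT : 0 ≤ T) (hA : MemCTC1b T A) :
    Continuous (supNorm T A) := by
  have hmeas : ∀ t ∈ Icc 0 T, AEStronglyMeasurable (A t) volume := fun t ht =>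
    (hA.1 t ht).1.continuous.aestronglyMeasurable
  have hle : ∀ s ∈ Icc 0 T, ∀ t ∈ Icc 0 T, (eLpNorm (A s) ∞ volume).toReal
      ≤ (eLpNorm (A t) ∞ volume).toReal + (eLpNorm (A s - A t) ∞ volume).toReal := by
    intro s hs t ht
    have hfin : eLpNorm (A s - A t) ∞ volume ≠ ∞ :=
      ((eLpNorm_sub_le (hmeas s hs) (hmeas t ht) le_top).trans_lt
        (ENNReal.add_lt_top.2 ⟨(hA.eLpNorm_ne_top hs).lt_top, (hA.eLpNorm_ne_top ht).lt_top⟩)).ne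
    rw [← ENNReal.toReal_add (hA.eLpNorm_ne_top ht) hfin]
    refine ENNReal.toReal_mono (ENNReal.add_ne_top.2 ⟨hA.eLpNorm_ne_top ht, hfin⟩) ?_
    have := eLpNorm_add_le (p := ∞) (hmeas t ht) ((hmeas s hs).sub (hmeas t ht)) le_top
    rwa [add_sub_cancel] at this
  have hN : ∀ s ∈ Icc 0 T, ∀ t ∈ Icc 0 T, ∀ _ : Unit, ‖(eLpNorm (A s) ∞ volume).toReal
      - (eLpNorm (A t) ∞ volume).toReal‖ₑ ≤ c1bNorm (A s - A t) := by
    intro s hs t ht _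
    refine le_trans ?_ (eLpNorm_top_le_c1bNorm _)
    rw [Real.enorm_eq_ofReal_abs]
    refine ENNReal.ofReal_le_of_le_toReal (abs_sub_le_iff.2 ⟨?_, ?_⟩)
    · linarith [hle s hs t ht]
    · have := hle t ht s hs
      rw [eLpNorm_sub_comm] at this
      linarith
  have h := continuous_of_tendsto_edist (X := Unit) hT
    (v := fun t _ => (eLpNorm (A t) ∞ volume).toReal) (N := fun s t => c1bNorm (A s - A t))
    (fun _ _ => continuous_const) hA.2 hN
  have h' : Continuous fun t : ℝ => (t, ()) := by fun_prop
  have h'' := h.comp h'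
  simp only [Function.comp_def] at h''
  unfold supNorm
  exact h''

/-- Hölder's inequality between `L¹` and `L²` on an interval of length `T`. -/
theorem MemCTC1b.integral_supNorm_le (hT : 0 ≤ T) (hA : MemCTC1b T A) :
    ∫ t in (0 : ℝ)..T, supNorm T A t ≤ √T * l2LinftyNorm T A := by
  have hc := hA.continuous_supNorm hT
  set μ := volume.restrict (Ioo (0 : ℝ) T) with hμ
  have hμu : μ univ = ENNReal.ofReal T := by simp [hμ]
  have : IsFiniteMeasure μ := ⟨by rw [hμu]; exact ENNReal.ofReal_lt_top⟩
  obtain ⟨b, hb⟩ := (isCompact_Icc (a := (0 : ℝ)) (b := T)).exists_bound_of_continuousOn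
    hc.continuousOn
  have hmem : ∀ᵐ t ∂μ, t ∈ Ioo 0 T := ae_restrict_mem measurableSet_Ioo
  have hfin : eLpNorm (supNorm T A) 2 μ ≠ ∞ :=
    (MemLp.of_bound hc.aestronglyMeasurable b
      (hmem.mono fun t ht => hb t (Ioo_subset_Icc_self ht))).eLpNorm_ne_top
  have h1 : eLpNorm (supNorm T A) 2 μ = eLpNorm (fun t => eLpNorm (A t) ∞ volume) 2 μ := by
    refine eLpNorm_congr_enorm_ae (hmem.mono fun t ht => ?_)
    have ht' := Ioo_subset_Icc_self ht
    rw [supNorm, clamp_of_mem ht', Real.enorm_of_nonneg ENNReal.toReal_nonneg,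
      ENNReal.ofReal_toReal (hA.eLpNorm_ne_top ht'), enorm_eq_self]
  have h2 := eLpNorm_le_eLpNorm_mul_rpow_measure_univ (p := 1) (q := 2) one_le_two
    (hc.aestronglyMeasurable (μ := μ))
  have h3 : ∫ t in (0 : ℝ)..T, supNorm T A t ≤ (eLpNorm (supNorm T A) 1 μ).toReal := by
    rw [intervalIntegral.integral_of_le hT, integral_Ioc_eq_integral_Ioo,
      eLpNorm_one_eq_lintegral_enorm]
    refine (le_abs_self _).trans ?_
    rw [← Real.norm_eq_abs, ← toReal_enorm]
    refine ENNReal.toReal_mono ?_ (enorm_integral_le_lintegral_enorm _)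
    rw [← eLpNorm_one_eq_lintegral_enorm]
    refine (h2.trans_lt (ENNReal.mul_lt_top hfin.lt_top ?_)).ne
    exact ENNReal.rpow_lt_top_of_nonneg (by norm_num) (measure_ne_top _ _)
  refine h3.trans ((ENNReal.toReal_mono (ENNReal.mul_ne_top hfin
    (ENNReal.rpow_ne_top_of_nonneg (by norm_num) (measure_ne_top _ _))) h2).trans_eq ?_)
  have e : 1 / ENNReal.toReal 1 - 1 / ENNReal.toReal 2 = 1 / 2 := by norm_num
  rw [e, ENNReal.toReal_mul, h1, hμu, ← ENNReal.toReal_rpow, ENNReal.toReal_ofReal hT, mul_comm,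
    Real.sqrt_eq_rpow, l2LinftyNorm]

end Zeta

/-! ### The characteristic flow, the support bound, and the theorem. -/

section Conclusion

variable {D : Coefficients} {T r M : ℝ}

theorem Coefficients.Tame.isCharacteristicFlow (hD : D.Tame r M) :
    D.IsCharacteristicFlow T fun s t z => hD.smoothField.curve t z s :=
  ⟨fun t _ z => hD.smoothField.curve_self t z,
    fun t _ z s _ => (hD.smoothField.hasDerivAt_curve t z s).hasDerivWithinAt⟩

theorem Coefficients.Tame.characteristicFlow_unique (hD : D.Tame r M)
    {Z : ℝ → ℝ → Phase → Phase} (hZ : D.IsCharacteristicFlow T Z) {s t : ℝ} (hs : s ∈ Icc 0 T)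
    (ht : t ∈ Icc 0 T) (z : Phase) : Z s t z = hD.smoothField.curve t z s := by
  have := hD.smoothField.eq_curve (γ := fun s => Z s t z) (hZ.ode t ht z) ht hs
  simpa only [hZ.initial t ht z] using this

/-- The growth estimate gives the closed ball with factor `exp T`, which `exp (2 * T)` dominates;
the additional `1` in the radius makes room for the open ball. -/
theorem tsupport_subset_ball_zeta {γ : ℝ≥0} (hT : 0 < T) {r₀ r₁ r₂ : ℝ} (hr : 0 ≤ max r₀ r₂)
    (hD : D.Regular T γ) (hS : D.Supported T r₀ r₁ r₂) {f : ℝ → Phase → ℝ}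
    (hf : (D.clamp T).IsClassicalSolution T f) {t : ℝ} (ht : t ∈ Icc 0 T) :
    tsupport (f t) ⊆ Metric.ball 0 (zeta T D.A (max r₀ r₂ + 1)) := by
  obtain ⟨M, hM⟩ := hD.exists_tame hT.le hS
  have hA := hD.A_mem.memCTC1b
  have hint := hA.integral_supNorm_le hT.le
  have h0 : 0 ≤ ∫ t in (0 : ℝ)..T, supNorm T D.A t :=
    intervalIntegral.integral_nonneg hT.le fun _ _ => ENNReal.toReal_nonneg
  have hexp : Real.exp T ≤ Real.exp (2 * T) := by
    gcongr
    linarith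
  have hle : Real.exp T * (max r₀ r₂ + ∫ t in (0 : ℝ)..T, supNorm T D.A t)
      ≤ zeta T D.A (max r₀ r₂) := by
    rw [zeta]
    gcongr
  have hsub : tsupport (f t) ⊆ Metric.closedBall 0 (zeta T D.A (max r₀ r₂)) := by
    refine closure_minimal (fun z hz => ?_) Metric.isClosed_closedBall
    rw [mem_closedBall_zero_iff]
    by_contra! hlt
    refine hz ?_
    rw [hM.eq_duhamel hT hf ht]
    exact hM.duhamel_eq_zero (T := T) (hA.continuous_supNorm hT.le)
      (fun t x => hA.norm_le_supNorm hT.le t x) hM.f₀_zero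
      (fun t z hz => hM.source_eq_zero t hz) ht (hle.trans_lt hlt)
  refine hsub.trans (Metric.closedBall_subset_ball ?_)
  rw [zeta, zeta]
  gcongr
  linarith

end Conclusion

end Vlasov

theorem mainTheorem2 (T r₀ r₂ : ℝ) (hT : 0 < T) (hr₀ : 0 ≤ r₀) (hr₂ : 0 < r₂) :
    (∀ (γ : ℝ≥0) (r₁ : ℝ) (D : Vlasov.Coefficients),
      0 < γ → γ < 1 → 0 ≤ r₁ → r₁ < r₂ → D.Regular T γ → D.Supported T r₀ r₁ r₂ →
      ∃ Z : ℝ → ℝ → Vlasov.Phase → Vlasov.Phase,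
        D.IsCharacteristicFlow T Z ∧
        (∀ Z', D.IsCharacteristicFlow T Z' →
          ∀ s ∈ Icc (0 : ℝ) T, ∀ t ∈ Icc (0 : ℝ) T, ∀ z, Z' s t z = Z s t z) ∧
        ∃ f : ℝ → Vlasov.Phase → ℝ,
          D.IsClassicalSolution T f ∧
          (∀ g, D.IsClassicalSolution T g → ∀ t ∈ Icc (0 : ℝ) T, ∀ z, g t z = f t z) ∧
          (∀ t ∈ Icc (0 : ℝ) T,
            tsupport (f t) ⊆ Metric.ball 0 (Vlasov.zeta T D.A (max r₀ r₂ + 1))) ∧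
          (∀ t ∈ Icc (0 : ℝ) T, ∀ z,
            f t z = D.f₀ (Z 0 t z) + ∫ s in (0 : ℝ)..t, D.source f s (Z s t z))) ∧
    (∀ M : ℝ≥0, ∃ K : ℝ≥0, 0 < K ∧
      ∀ (γ : ℝ≥0) (r₁ : ℝ) (D : Vlasov.Coefficients),
        0 < γ → γ < 1 → 0 ≤ r₁ → r₁ < r₂ → D.Regular T γ → D.Supported T r₀ r₁ r₂ →
        D.NormsLE T γ M →
        ∀ f : ℝ → Vlasov.Phase → ℝ, D.IsClassicalSolution T f →
          Vlasov.spaceTimeC1bNorm T f ≤ K) := by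
  constructor
  · intro γ r₁ D _ _ _ _ hD hS
    -- Everything is solved for the frozen coefficients and transferred back, since both notions of
    -- solution see only times in `[0,T]`.
    obtain ⟨M, hM⟩ := hD.exists_tame hT.le hS
    obtain ⟨f, hf⟩ := hM.exists_classical hT
    refine ⟨fun s t z => hM.smoothField.curve t z s,
      Vlasov.Coefficients.isCharacteristicFlow_clamp.1 hM.isCharacteristicFlow,
      fun Z' hZ' s hs t ht z => hM.characteristicFlow_unique
        (Vlasov.Coefficients.isCharacteristicFlow_clamp.2 hZ') hs ht z,
      f, Vlasov.Coefficients.isClassicalSolution_clamp.1 hf, fun g hg t ht z => ?_,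
      fun t ht => Vlasov.tsupport_subset_ball_zeta hT (hr₀.trans (le_max_left _ _)) hD hS hf ht,
      fun t ht z => ?_⟩
    · exact congr_fun (hM.classical_unique hT
        (Vlasov.Coefficients.isClassicalSolution_clamp.2 hg) hf ht) z
    · rw [hM.eq_duhamel hT hf ht z, Vlasov.SmoothField.duhamel]
      refine congrArg (_ + ·) (intervalIntegral.integral_congr fun s hs => ?_)
      rw [uIcc_of_le ht.1] at hs
      exact Vlasov.Coefficients.source_clamp ⟨hs.1, hs.2.trans ht.2⟩ f _
  · intro M
    -- The constant is fixed before the coefficients: it depends on `T`, `max r₀ r₂` and `M` alone.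
    obtain ⟨K, hK, h⟩ := Vlasov.exists_spaceTimeC1bNorm_le T (max r₀ r₂) M hT
    exact ⟨K, hK, fun γ r₁ D _ _ _ _ hD hS hN f hf => h _ (hN.tame hT.le hD hS) f
      (Vlasov.Coefficients.isClassicalSolution_clamp.2 hf)⟩
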